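/- Let $\mathbb P=\mathbb P(1^5,2^2)$ with coordinates $x_0,\dots,x_4$ of weight $1$ and $x_5,x_6$ of weight $2$. For $t\in\mathbb C$ let $\check X_{7,t}\subset\mathbb P$ be the Pfaffian variety $\{P_1=\dots=P_5=0\}$, where $P_i$ is the Pfaffian of the matrix obtained by deleting the $i$-th row and column of $$N_{7,t}=\begin{pmatrix}0&tx_2^3&x_0x_1&x_5&tx_6\\-tx_2^3&0&tx_5&x_6&x_3x_4\\-x_0x_1&-tx_5&0&t(x_3+x_4)&x_2\\-x_5&-x_6&-t(x_3+x_4)&0&t(x_0+x_1)\\-tx_6&-x_3x_4&-x_2&-t(x_0+x_1)&0\end{pmatrix},$$ with the convention $\mathrm{Pf}(N)=\frac1{r!\,2^r}\sum_{\sigma\in\mathfrak S_{2r}}\mathrm{sign}(\sigma)\prod_{i=1}^r n_{\sigma(i)\sigma(r+i)}$ for $2r\times2r$ matrices. Let $P_{1,3,5}=x_6$ be the Pfaffian of $N_{7,t}$ with rows and columns $1,3,5$ deleted. In the chart $x_0=1$ let $$\alpha=\mathrm{Res}\,\frac{P_{1,3,5}\,\Omega_0}{P_1P_3P_5}=\frac{P_{1,3,5}}{(2\pi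 i)^3\,\frac{\partial(P_1,P_3,P_5)}{\partial(x_1,x_2,x_3)}}\,dx_4\wedge dx_5\wedge dx_6,\qquad \Omega_0=\frac{dx_1\wedge\dots\wedge dx_6}{(2\pi i)^6},$$ be the holomorphic $3$-form on $\check X_{7,t}$. For $\varepsilon>0$ let $\gamma_0$ be the torus $\{x_0=1,\ x_1=x_2=x_3=0,\ |x_4|=|x_5|=|x_6|=\varepsilon\}\subset\check X_{7,0}$, oriented by $d\arg x_4\wedge d\arg x_5\wedge d\arg x_6$. Then $\gamma_0$ extends to a smooth family of $3$-dimensional torus cycles $\gamma_t\subset\check X_{7,t}$ for $|t|$ small, and there is a germ $\Phi_0$ of a holomorphic function at $0$, not depending on $\varepsilon$ or on the family, such that for every such family and all sufficiently small $t$ $$\int_{\gamma_t}\alpha=\Phi_0(\phi),\qquad \phi=t^9 .$$ This fundamental period has, near $\phi=0$, the expansion $$\Phi_0(\phi)=\sum_{n=0}^{\infty}\binom{2n}{n}^{2}\sum_{k=0}^{2n}\binom{n+k}{k}\binom{2n}{k}^2\phi^n .$$ With $\Theta=\phi\frac{d}{d\phi}$, its Picard–Fuchs operator is the operator $\mathscr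 D_7$ (No. 109 in the tables of Calabi–Yau equations) $$\begin{aligned}\mathscr D_7={}&7^2\Theta^4-2\cdot3\cdot7\,\phi(1272\Theta^4+2508\Theta^3+1779\Theta^2+525\Theta+56)\\&+2^2\cdot3\,\phi^2(43704\Theta^4+38088\Theta^3-25757\Theta^2-20608\Theta-3360)\\&-2^4\cdot3^3\,\phi^3(2736\Theta^4-1512\Theta^3-1672\Theta^2-357\Theta-14)\\&-2^6\cdot3^5\,\phi^4(2\Theta+1)^2(3\Theta+1)(3\Theta+2);\end{aligned}$$ that is, $\mathscr D_7\Phi_0=0$, and no nonzero linear differential operator in $\Theta$ of order less than $4$ with coefficients in $\mathbb C(\phi)$ annihilates $\Phi_0$. -/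

import Mathlib

open Filter Topology
open scoped ContDiff Polynomial

namespace PfaffianMirror

noncomputable section

/-- The Pfaffian of a `2r × 2r` matrix,
`Pf(N) = 1 / (r! 2^r) * ∑_σ sign(σ) ∏_{i=1}^r n_{σ(i), σ(r+i)}`. -/
def pf {r : ℕ} (N : Matrix (Fin (r + r)) (Fin (r + r)) ℂ) : ℂ :=
  1 / ((r.factorial : ℂ) * 2 ^ r) *
    ∑ σ : Equiv.Perm (Fin (r + r)),
      ((Equiv.Perm.sign σ : ℤ) : ℂ) *
        ∏ i : Fin r, N (σ (Fin.castAdd r i)) (σ (Fin.natAdd r i))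

/-- The skew-symmetric matrix `N_{7,t}` in the weighted homogeneous coordinates
`x_0, …, x_6` of `ℙ(1,1,1,1,1,2,2)`. -/
def N7 (t : ℂ) (x : Fin 7 → ℂ) : Matrix (Fin 5) (Fin 5) ℂ :=
  !![0, t * x 2 ^ 3, x 0 * x 1, x 5, t * x 6;
     -(t * x 2 ^ 3), 0, t * x 5, x 6, x 3 * x 4;
     -(x 0 * x 1), -(t * x 5), 0, t * (x 3 + x 4), x 2;
     -x 5, -x 6, -(t * (x 3 + x 4)), 0, t * (x 0 + x 1);
     -(t * x 6), -(x 3 * x 4), -x 2, -(t * (x 0 + x 1)), 0]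

/-- The submaximal Pfaffians: `P7 t i x` is the Pfaffian of `N_{7,t}(x)` without its `i`-th
row and column.  Indices start at `0`, so `P_1, …, P_5` are `P7 t 0, …, P7 t 4`. -/
def P7 (t : ℂ) (i : Fin 5) (x : Fin 7 → ℂ) : ℂ :=
  pf (r := 2) ((N7 t x).submatrix i.succAbove i.succAbove)

/-- `P_{1,3,5}`: the Pfaffian of `N_{7,t}(x)` without its first, third and fifth rows and
columns. -/
def P7_135 (t : ℂ) (x : Fin 7 → ℂ) : ℂ :=
  pf (r := 1) ((N7 t x).submatrix ![1, 3] ![1, 3])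

/-- The affine chart `x_0 = 1` of `ℙ(1,1,1,1,1,2,2)`.  Since `x_0` has weight one, it identifies
`ℂ⁶` with the open set `x_0 ≠ 0`.  The point `y` has `x_{j+1} = y j`. -/
def chart (y : Fin 6 → ℂ) : Fin 7 → ℂ := Fin.cons 1 y

/-- The part in the chart `x_0 = 1` of the Pfaffian variety `X̌_{7,t}`. -/
def X7 (t : ℂ) : Set (Fin 6 → ℂ) := {y | ∀ i, P7 t i (chart y) = 0}

/-- The differentials of `P_1, P_3, P_5` at the point `y` of the chart. -/
def dP (t : ℂ) (y : Fin 6 → ℂ) (i : Fin 3) : (Fin 6 → ℂ) →L[ℂ] ℂ :=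
  fderiv ℂ (fun z => P7 t (![0, 2, 4] i) (chart z)) y

/-- The Jacobian determinant `∂(P_1, P_3, P_5) / ∂(x_1, x_2, x_3)`. -/
def jac (t : ℂ) (y : Fin 6 → ℂ) : ℂ :=
  (Matrix.of fun i j : Fin 3 => dP t y i (Pi.single (Fin.castAdd 3 j) 1)).det

/-- The holomorphic three-form
`α = Res (P_{1,3,5} Ω₀ / (P_1 P_3 P_5)) =
  P_{1,3,5} / ((2πi)³ ∂(P_1, P_3, P_5)/∂(x_1, x_2, x_3)) dx_4 ∧ dx_5 ∧ dx_6`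
on `X̌_{7,t}`, in the chart `x_0 = 1`, where `Ω₀ = (2πi)⁻⁶ dx_1 ∧ ⋯ ∧ dx_6`.  It is evaluated
on three tangent vectors at the point `y`. -/
def alpha (t : ℂ) (y : Fin 6 → ℂ) (v : Fin 3 → Fin 6 → ℂ) : ℂ :=
  P7_135 t (chart y) / ((2 * Real.pi * Complex.I) ^ 3 * jac t y) *
    (Matrix.of fun a b : Fin 3 => v a (Fin.natAdd 3 b)).det

/-- `alpha` is the iterated Poincaré residue:
`dP_1 ∧ dP_3 ∧ dP_5 ∧ α = (2πi)⁻³ P_{1,3,5} dx_1 ∧ ⋯ ∧ dx_6`, evaluated on `(w, v)` with `v`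
tangent to `P_1 = P_3 = P_5 = 0`.  So it does not depend on the coordinates `x_4, x_5, x_6`
that are used to write it down. -/
theorem alpha_isResidue (t : ℂ) (y : Fin 6 → ℂ) (hy : jac t y ≠ 0)
    (w v : Fin 3 → Fin 6 → ℂ) (hv : ∀ i a, dP t y i (v a) = 0) :
    (Matrix.of fun i j : Fin 3 => dP t y i (w j)).det * alpha t y v =
      P7_135 t (chart y) / (2 * Real.pi * Complex.I) ^ 3 *
        (Matrix.of (Fin.append w v : Fin (3 + 3) → Fin (3 + 3) → ℂ)).det := by
  set J : Matrix (Fin 3) (Fin 3) ℂ :=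
    Matrix.of fun i j => dP t y i (Pi.single (Fin.castAdd 3 j) 1) with hJ
  set K : Matrix (Fin 3) (Fin 3) ℂ :=
    Matrix.of fun i j => dP t y i (Pi.single (Fin.natAdd 3 j) 1) with hK
  set Wm : Matrix (Fin 3 ⊕ Fin 3) (Fin 3 ⊕ Fin 3) ℂ :=
    Matrix.fromBlocks (Matrix.of fun j k => w j (Fin.castAdd 3 k))
      (Matrix.of fun j k => w j (Fin.natAdd 3 k)) (Matrix.of fun j k => v j (Fin.castAdd 3 k))
      (Matrix.of fun j k => v j (Fin.natAdd 3 k)) with hWm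
  have hW : (Matrix.of (Fin.append w v : Fin (3 + 3) → Fin (3 + 3) → ℂ)).det = Wm.det := by
    rw [← Matrix.det_submatrix_equiv_self (finSumFinEquiv (m := 3) (n := 3))]
    congr 1
    ext a b
    rcases a with a | a <;> rcases b with b | b <;>
      simp only [hWm, Matrix.submatrix_apply, Matrix.of_apply, finSumFinEquiv_apply_left,
        finSumFinEquiv_apply_right, Fin.append_left, Fin.append_right,
        Matrix.fromBlocks_apply₁₁, Matrix.fromBlocks_apply₁₂, Matrix.fromBlocks_apply₂₁,
        Matrix.fromBlocks_apply₂₂]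
  have hlin : ∀ (i : Fin 3) (u : Fin 6 → ℂ), dP t y i u =
      ∑ k, u (Fin.castAdd 3 k) * J i k + ∑ k, u (Fin.natAdd 3 k) * K i k := by
    intro i u
    have h := LinearMap.pi_apply_eq_sum_univ (dP t y i : (Fin (3 + 3) → ℂ) →ₗ[ℂ] ℂ) u
    have h1 : ∀ k : Fin (3 + 3),
        (fun j => if k = j then (1 : ℂ) else 0) = Pi.single k (1 : ℂ) := by
      intro k
      ext j
      simp [Pi.single_apply, eq_comm]
    simp only [h1] at h
    have h2 := Fin.sum_univ_add (a := 3) (b := 3)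
      (fun k : Fin (3 + 3) => u k • (dP t y i : (Fin (3 + 3) → ℂ) →ₗ[ℂ] ℂ) (Pi.single k 1))
    exact h.trans h2
  have hmul : Wm * Matrix.fromBlocks J.transpose 0 K.transpose 1 =
      Matrix.fromBlocks (Matrix.of fun i j : Fin 3 => dP t y i (w j)).transpose
        (Matrix.of fun j k : Fin 3 => w j (Fin.natAdd 3 k)) 0
        (Matrix.of fun j k : Fin 3 => v j (Fin.natAdd 3 k)) := by
    rw [hWm, Matrix.fromBlocks_multiply]
    congr 1
    · ext a b
      simp [hlin, Matrix.mul_apply]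
    · simp
    · ext a b
      have h := hv b a
      rw [hlin] at h
      simpa [Matrix.mul_apply] using h
    · simp
  have hdet := congrArg Matrix.det hmul
  rw [Matrix.det_mul, Matrix.det_fromBlocks_zero₁₂, Matrix.det_fromBlocks_zero₂₁,
    Matrix.det_transpose, Matrix.det_transpose, Matrix.det_one, mul_one] at hdet
  have hjac : jac t y = J.det := rfl
  have hpi : (2 * (Real.pi : ℂ) * Complex.I) ^ 3 ≠ 0 :=
    pow_ne_zero _ Complex.two_pi_I_ne_zero
  rw [alpha, hW]
  rw [hjac] at hy ⊢
  field_simp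
  linear_combination (-(P7_135 t (chart y))) * hdet

/-- A smooth family, over the disc `|t| < r`, of three-dimensional torus cycles
`γ_t : (ℝ/2πℤ)³ → X̌_{7,t}` that starts at `t = 0` with the torus
`|x_4| = |x_5| = |x_6| = ε` (in the chart `x_0 = 1`) in the component `x_1 = x_2 = x_3 = 0` of `X̌_{7,0}`. -/
structure IsTorusCycleFamily (ε r : ℝ) (γ : ℂ → (Fin 3 → ℝ) → (Fin 6 → ℂ)) : Prop where
  smooth : ContDiffOn ℝ ∞ (fun p : ℂ × (Fin 3 → ℝ) => γ p.1 p.2)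
    (Metric.ball (0 : ℂ) r ×ˢ Set.univ)
  periodic : ∀ t ∈ Metric.ball (0 : ℂ) r, ∀ (θ : Fin 3 → ℝ) (k : Fin 3),
    γ t (θ + Pi.single k (2 * Real.pi)) = γ t θ
  mem : ∀ t ∈ Metric.ball (0 : ℂ) r, ∀ θ : Fin 3 → ℝ, γ t θ ∈ X7 t
  initial : ∀ θ : Fin 3 → ℝ, γ 0 θ =
    ![0, 0, 0, ε * Complex.exp (θ 0 * Complex.I), ε * Complex.exp (θ 1 * Complex.I),
      ε * Complex.exp (θ 2 * Complex.I)]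

/-- The period integral `∫_{γ_t} α` over a torus `γ_t` parametrized by `[0, 2π]³`. -/
def period (γ : ℂ → (Fin 3 → ℝ) → (Fin 6 → ℂ)) (t : ℂ) : ℂ :=
  ∫ θ in Set.Icc (0 : Fin 3 → ℝ) (fun _ => 2 * Real.pi),
    alpha t (γ t θ) (fun a => fderiv ℝ (γ t) θ (Pi.single a 1))

/-- The Euler operator `Θ = φ d/dφ`. -/
def euler (f : ℂ → ℂ) : ℂ → ℂ := fun z => z * deriv f z

/-- A polynomial `L = ∑_j q_j(φ) Θ^j` in `Θ` with coefficients in `ℂ[φ]`, written to the left of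
the powers of `Θ`, acts on functions of `φ` as a linear differential operator. -/
def applyOp (L : ℂ[X][X]) (f : ℂ → ℂ) (z : ℂ) : ℂ :=
  L.sum fun j q => q.eval z * (euler^[j] f) z

/-- `L` is a Picard–Fuchs operator of the period `f` (a germ of a function of `φ` at `0`): it is
nonzero, annihilates `f`, and has the least order among the nonzero linear differential
operators that annihilate `f`.  Operators with coefficients in `ℂ(φ)` are covered, by clearing
denominators. -/
def IsPicardFuchsOperator (L : ℂ[X][X]) (f : ℂ → ℂ) : Prop :=
  L ≠ 0 ∧ (∀ᶠ z in 𝓝 (0 : ℂ), applyOp L f z = 0) ∧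
    ∀ M : ℂ[X][X], M ≠ 0 → (∀ᶠ z in 𝓝 (0 : ℂ), applyOp M f z = 0) →
      L.natDegree ≤ M.natDegree

/-- The operator `𝒟₇`; here `φ` is `C X` and `Θ` is the outer variable `X`. -/
def D7 : ℂ[X][X] :=
  let φ : ℂ[X][X] := Polynomial.C Polynomial.X
  let Θ : ℂ[X][X] := Polynomial.X
  7 ^ 2 * Θ ^ 4
    - 2 * 3 * 7 * φ * (1272 * Θ ^ 4 + 2508 * Θ ^ 3 + 1779 * Θ ^ 2 + 525 * Θ + 56)
    + 2 ^ 2 * 3 * φ ^ 2 *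
      (43704 * Θ ^ 4 + 38088 * Θ ^ 3 - 25757 * Θ ^ 2 - 20608 * Θ - 3360)
    - 2 ^ 4 * 3 ^ 3 * φ ^ 3 * (2736 * Θ ^ 4 - 1512 * Θ ^ 3 - 1672 * Θ ^ 2 - 357 * Θ - 14)
    - 2 ^ 6 * 3 ^ 5 * φ ^ 4 * (2 * Θ + 1) ^ 2 * (3 * Θ + 1) * (3 * Θ + 2)

end

end PfaffianMirror

namespace PfaffianMirror

/-! ### Binomial identities and creative telescoping for the inner sums -/

section

open Nat Finset

/-! The period. Where `x_6 ≠ 0` the variety is cut out by `P_1 = P_3 = P_5 = 0`. Write `u = (x_4,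
x_5, x_6)`. These equations say `x_2 = phi2`, `x_3 = phi3`, `x_1 = phi1`, and for small `t` the
three right sides are at most `1/8` on the polydisc of radius two. Hence the residue form at a point
of the cycle is an integral of `P_{1,3,5} / (P_1 P_3 P_5)` over the fixed torus `|x_1| = |x_2| =
|x_3| = 1` (`IsSmall.torusIntegral_residueIntegrand`). On this torus the integrand is a product of
geometric series, that is, a convergent series of Laurent monomials in `x_1, …, x_6`.

Any admissible family stays close to the initial torus, so along it `u_b = exp(iθ_b + h_b)` with
periodic `h_b`. By Stokes' theorem the integral of a Laurent monomial in `u` against `d log u_0 ∧ d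
log u_1 ∧ d log u_2` depends only on the winding (`integral_exp_mul_torusJac`). So only the balanced
monomials survive, whatever the family. They are indexed by two integers `n, s` and have degree `9n`
in `t` (`balancedSum_eq`). This gives a double sum that Vandermonde's identity converts into the
stated one (`innerSum_eq`). That a family exists is shown by solving the equations explicitly with
two square roots (`cyclePoint_mem`).

The equation. A rational certificate proves a recurrence of order two for the inner sums. Together
with the squared central binomial it implies the recurrence of order four that says `D7` annihilates
the series (`periodCoeff_recurrence`).

Minimality. An annihilator `M` of least order `N + 1 < 4` is a right factor of `D7` up to a
polynomial multiple, by division with remainder. As `D7` is Fuchsian, the exponents of `M` at each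
point are among those of `D7`. The residue theorem for the quotient of the two leading coefficients
of `M` is then Fuchs' relation: minus the sum of the chosen roots at infinity, which are among
`-1/2, -1/2, -1/3, -2/3`, is an integer, and for order two it is not positive. No choice of one, two
or three of these roots allows this (`four_le_natDegree`).

Operators are stored as commutative polynomials in `D` with coefficients on the left; composition
with `D` is `derivMul`, not multiplication by the variable. -/

theorem sum_choose_mul_choose_sub (a p r N : ℕ) (i : ℕ) (hi : i ≤ N) (hN : N ≤ r) (ha : a = N - i) :
    ∑ s ∈ range (N + 1), (if i ≤ s then a.choose (s - i) * p.choose (r - s) else 0) =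
      (a + p).choose (r - i) := by
  rw [Nat.add_choose_eq, Finset.Nat.sum_antidiagonal_eq_sum_range_succ_mk, ← Finset.sum_filter]
  have h1 : ∑ s ∈ range (N + 1) with i ≤ s, a.choose (s - i) * p.choose (r - s) =
      ∑ j ∈ range (N - i + 1), a.choose j * p.choose (r - i - j) := by
    symm
    apply Finset.sum_bij' (fun j _ => j + i) (fun s _ => s - i)
    · intro j hj; simp at hj ⊢; omega
    · intro j hj; simp at hj ⊢; omega
    · intro j hj; simp
    · intro j hj; simp at hj; omega
    · intro j hj; simp [Nat.sub_sub, add_comm]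
  rw [h1]
  apply Finset.sum_subset
  · intro j; simp; omega
  · intro j hj hj'
    simp at hj hj'
    rw [Nat.choose_eq_zero_of_lt (by omega), zero_mul]

/-- Vandermonde twice: once to expand `(m + s).choose s` in products of binomials of `m` and `s`,
and once, after `N.choose s * s.choose i = N.choose i * (N - i).choose (s - i)`, to sum over `s`.
The right side is nearly symmetric in `N` and `m`, which makes two different left sides comparable.
-/
theorem sum_choose_mul_choose_mul_choose (N m p r : ℕ) (hN : N ≤ r) :
    ∑ s ∈ range (N + 1), N.choose s * (m + s).choose s * p.choose (r - s) =
      ∑ i ∈ range (N + 1), N.choose i * m.choose i * (N - i + p).choose (r - i) := by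
  have h : ∀ s ∈ range (N + 1), (m + s).choose s =
      ∑ i ∈ range (N + 1), m.choose i * s.choose i := by
    intro s hs
    rw [Nat.add_choose_eq, Finset.Nat.sum_antidiagonal_eq_sum_range_succ_mk]
    refine Eq.trans (Finset.sum_congr rfl fun i hi => ?_)
      (Finset.sum_subset (s₁ := range s.succ) ?_ ?_)
    · simp at hi
      simp only
      rw [Nat.choose_symm (by omega)]
    · intro i; simp at hs ⊢; omega
    · intro i _ hi
      simp at hi
      rw [Nat.choose_eq_zero_of_lt (by omega : s < i), mul_zero]
  rw [Finset.sum_congr rfl fun s hs => by rw [h s hs]]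
  simp only [Finset.mul_sum, Finset.sum_mul]
  rw [Finset.sum_comm]
  refine Finset.sum_congr rfl fun i hi => ?_
  rw [← sum_choose_mul_choose_sub (N - i) p r N i (by simpa [Nat.lt_succ_iff] using hi) hN rfl,
    Finset.mul_sum]
  refine Finset.sum_congr rfl fun s hs => ?_
  split_ifs with hc
  · have := Nat.choose_mul (n := N) (k := s) (s := i) hc
    linear_combination (m.choose i * p.choose (r - s)) * this
  · rw [Nat.choose_eq_zero_of_lt (by omega : s < i)]; ring

/-- The summand of the inner sum of the period coefficients, in the form in which it arises from
the residue. -/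
def innerTerm (n s : ℕ) : ℕ := (3 * n).choose (n + s) * (2 * n + s).choose s * n.choose s

/-- The inner sum of the period coefficients. -/
def innerSum (n : ℕ) : ℕ := ∑ s ∈ range (n + 1), innerTerm n s

/-- Both sums are instances of the preceding transformation, with `(N, m, p)` equal to `(n, 2n, 3n)`
and `(2n, n, 2n)` and with `r = 2n`. Both become the sum of `n.choose i * (2n).choose i * (4n -
i).choose (2n - i)`. -/
theorem innerSum_eq (n : ℕ) :
    innerSum n = ∑ k ∈ range (2 * n + 1), (n + k).choose k * (2 * n).choose k ^ 2 := by
  have h1 := sum_choose_mul_choose_mul_choose n (2 * n) (3 * n) (2 * n) (by omega)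
  have h2 := sum_choose_mul_choose_mul_choose (2 * n) n (2 * n) (2 * n) le_rfl
  calc innerSum n = _ := Finset.sum_congr rfl fun s hs => ?_
    _ = _ := h1
    _ = _ := ?_
    _ = _ := h2.symm
    _ = _ := Finset.sum_congr rfl fun s hs => ?_
  · simp at hs
    rw [innerTerm, ← Nat.choose_symm (by omega : n + s ≤ 3 * n),
      show 3 * n - (n + s) = 2 * n - s by omega]
    ring
  · refine Eq.trans (Finset.sum_congr rfl fun i hi => ?_)
      (Finset.sum_subset (s₁ := range (n + 1)) ?_ ?_)
    · simp at hi
      rw [show n - i + 3 * n = 2 * n - i + 2 * n by omega]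
      ring
    · intro i; simp; omega
    · intro i _ hi
      simp at hi
      rw [Nat.choose_eq_zero_of_lt (by omega : n < i)]; ring
  · simp at hs
    rw [Nat.choose_symm (by omega)]
    ring

/-- The common hypergeometric factor of `innerTerm n s`, `innerTerm (n + 1) s` and
`innerTerm (n + 2) s`. -/
def commonTerm (n s : ℕ) : ℚ :=
  (3 * n)! * (2 * n + s)! * n ! /
    ((n + s + 2)! * (2 * n + 4 - s)! * s ! ^ 2 * (2 * n)! * (n + 2 - s)!)

theorem cast_innerTerm (s d : ℕ) :
    (innerTerm (s + d) s : ℚ) = (3 * (s + d))! * (2 * (s + d) + s)! * (s + d)! /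
      ((s + d + s)! * (s + d + d)! * s ! ^ 2 * (2 * (s + d))! * d !) := by
  rw [innerTerm, show 3 * (s + d) = (s + d + s) + (s + d + d) by ring, Nat.cast_mul, Nat.cast_mul,
    Nat.cast_add_choose, Nat.cast_add_choose, add_comm (2 * (s + d)) s, Nat.cast_add_choose]
  have h (k : ℕ) : (k ! : ℚ) ≠ 0 := by positivity
  have := h (s + d); have := h s; have := h d; have := h (2 * (s + d))
  field_simp

theorem innerTerm_eq_zero {n s : ℕ} (h : n < s) : innerTerm n s = 0 := by
  rw [innerTerm, Nat.choose_eq_zero_of_lt h, mul_zero]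

theorem cast_innerTerm_add_two {n s : ℕ} (h : s ≤ n + 2) :
    (innerTerm (n + 2) s : ℚ) =
      9 * (3 * n + 1) * (3 * n + 2) * (n + 1) * (3 * n + 4) * (3 * n + 5) * (n + 2) /
        (4 * (2 * n + 1) * (2 * n + 3)) *
      ((2 * n + s + 1) * (2 * n + s + 2) * (2 * n + s + 3) * (2 * n + s + 4)) *
      commonTerm n s := by
  obtain ⟨d, hd⟩ := Nat.exists_eq_add_of_le h
  rw [hd, cast_innerTerm, ← hd, commonTerm, show n + 2 - s = d by omega,
    show n + 2 + d = 2 * n + 4 - s by omega, show n + 2 + s = n + s + 2 by ring,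
    show 3 * (n + 2) = 3 * n + 6 by ring, show 2 * (n + 2) = 2 * n + 4 by ring,
    show 2 * n + 4 + s = 2 * n + s + 4 by ring]
  simp only [Nat.factorial_succ (3 * n + _), Nat.factorial_succ (2 * n + s + _),
    Nat.factorial_succ (2 * n + _), Nat.factorial_succ (n + 1), Nat.factorial_succ n,
    Nat.factorial_succ (3 * n), Nat.factorial_succ (2 * n)]
  have h (k : ℕ) : (k ! : ℚ) ≠ 0 := by positivity
  have := h (n + s + 2); have := h (2 * n + 4 - s); have := h s; have := h d; have := h (2 * n)
  push_cast
  field_simp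
  ring

/-- The range includes `s = n + 2`, where the binomial vanishes; the factor `n + 2 - s` makes the
right side vanish as well. The factors `n + 1 - s` and `n + 2 - s` do the same for `innerTerm n s`.
-/
theorem cast_innerTerm_add_one {n s : ℕ} (h : s ≤ n + 2) :
    (innerTerm (n + 1) s : ℚ) =
      3 * (3 * n + 1) * (3 * n + 2) * (n + 1) / (2 * (2 * n + 1)) *
      ((2 * n + s + 1) * (2 * n + s + 2) * (n + s + 2) * (2 * n + 3 - s) * (2 * n + 4 - s) *
        (n + 2 - s)) * commonTerm n s := by
  rcases Nat.lt_or_ge (n + 1) s with h1 | h1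
  · obtain rfl : s = n + 2 := by omega
    rw [innerTerm_eq_zero h1]
    push_cast
    ring
  obtain ⟨d, hd⟩ := Nat.exists_eq_add_of_le h1
  have hq : (n : ℚ) + 1 = s + d := mod_cast hd
  rw [hd, cast_innerTerm, ← hd, commonTerm, show n + 2 - s = d + 1 by omega,
    show 2 * n + 4 - s = n + 1 + d + 2 by omega, show n + 1 + s = n + s + 1 by ring,
    show 3 * (n + 1) = 3 * n + 3 by ring, show 2 * (n + 1) = 2 * n + 2 by ring,
    show 2 * n + 2 + s = 2 * n + s + 2 by ring, show (2 * n + 3 - s : ℚ) = n + d + 2 by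
      linear_combination hq, show (2 * n + 4 - s : ℚ) = n + d + 3 by
      linear_combination hq, show (n + 2 - s : ℚ) = d + 1 by linear_combination hq]
  simp only [Nat.factorial_succ (3 * n + _), Nat.factorial_succ (2 * n + s + _),
    Nat.factorial_succ (2 * n + _), Nat.factorial_succ (n + s + 1), Nat.factorial_succ n,
    Nat.factorial_succ (3 * n), Nat.factorial_succ (2 * n), Nat.factorial_succ (n + 1 + d + _),
    Nat.factorial_succ (n + 1 + d), Nat.factorial_succ d]
  have h (k : ℕ) : (k ! : ℚ) ≠ 0 := by positivity
  have := h (n + s + 1); have := h (n + 1 + d); have := h s; have := h d; have := h (2 * n)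
  push_cast
  field_simp
  ring

theorem cast_innerTerm_eq {n s : ℕ} (h : s ≤ n + 2) :
    (innerTerm n s : ℚ) =
      ((n + s + 1) * (n + s + 2) * (2 * n + 1 - s) * (2 * n + 2 - s) * (2 * n + 3 - s) *
        (2 * n + 4 - s) * (n + 1 - s) * (n + 2 - s)) * commonTerm n s := by
  rcases Nat.lt_or_ge n s with h1 | h1
  · rw [innerTerm_eq_zero h1]
    obtain rfl | rfl : s = n + 1 ∨ s = n + 2 := by omega
    all_goals
      push_cast
      ring
  obtain ⟨d, rfl⟩ := Nat.exists_eq_add_of_le h1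
  rw [cast_innerTerm, commonTerm, show s + d + 2 - s = d + 2 by omega,
    show 2 * (s + d) + 4 - s = s + d + d + 4 by omega]
  simp only [Nat.factorial_succ (s + d + d + _), Nat.factorial_succ (s + d + s + _),
    Nat.factorial_succ (s + d + d), Nat.factorial_succ (s + d + s),
    Nat.factorial_succ (d + 1), Nat.factorial_succ d]
  have h (k : ℕ) : (k ! : ℚ) ≠ 0 := by positivity
  have := h (s + d + s); have := h (s + d + d); have := h s; have := h d
  have := h (2 * (s + d))
  push_cast
  field_simp
  ring

theorem commonTerm_succ {n s : ℕ} (h : s ≤ n + 1) :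
    (2 * n + s + 1) * (2 * n + 4 - s) * (n + 2 - s) * commonTerm n s =
      (s + 1) ^ 2 * (n + s + 3) * commonTerm n (s + 1) := by
  obtain ⟨d, hd⟩ := Nat.exists_eq_add_of_le h
  have hq : (n : ℚ) + 1 = s + d := mod_cast hd
  rw [commonTerm, commonTerm, show n + 2 - s = d + 1 by omega,
    show 2 * n + 4 - s = n + d + 2 + 1 by omega, show n + 2 - (s + 1) = d by omega,
    show 2 * n + 4 - (s + 1) = n + d + 2 by omega, show (2 * n + 4 - s : ℚ) = n + d + 3 by
      linear_combination hq, show (n + 2 - s : ℚ) = d + 1 by linear_combination hq,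
    show n + (s + 1) + 2 = n + s + 2 + 1 by ring, ← add_assoc]
  simp only [Nat.factorial_succ (2 * n + s), Nat.factorial_succ d, Nat.factorial_succ s,
    Nat.factorial_succ (n + s + 2), Nat.factorial_succ (n + d + 2)]
  have h (k : ℕ) : (k ! : ℚ) ≠ 0 := by positivity
  have := h (n + s + 2); have := h (n + d + 2); have := h s; have := h d; have := h (2 * n)
  push_cast
  field_simp
  ring

/-- The numerator of the rational certificate for the recurrence of `innerSum`. -/
def certificate (x y : ℚ) : ℚ :=
    ((-9451776) + (-138296640)*x^1 + (-898211040)*x^2 + (-3430105392)*x^3 + (-8590659192)*x^4 + (-14883648864)*x^5 + (-18311025840)*x^6 + (-16133733840)*x^7 + (-10113186072)*x^8 + (-4402123680)*x^9 + (-1264158432)*x^10 + (-215227584)*x^11 + (-16443648)*x^12) +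
    ((-17478864) + (-221682996)*x^1 + (-1229855166)*x^2 + (-3951740562)*x^3 + (-8185232406)*x^4 + (-11485374822)*x^5 + (-11144393100)*x^6 + (-7477896324)*x^7 + (-3399859536)*x^8 + (-997102800)*x^9 + (-169648128)*x^10 + (-12669696)*x^11)*y^1 +
    ((-2976744) + (-25138230)*x^1 + (-71321865)*x^2 + (-29107221)*x^3 + (295608639)*x^4 + (810568803)*x^5 + (1052255250)*x^6 + (794274312)*x^7 + (355454208)*x^8 + (87587136)*x^9 + (9165312)*x^10)*y^2 +
    ((4548528) + (48488190)*x^1 + (217909515)*x^2 + (544317009)*x^3 + (834379365)*x^4 + (814044993)*x^5 + (504838416)*x^6 + (191397024)*x^7 + (40075776)*x^8 + (3504384)*x^9)*y^3 +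
    ((-570216) + (-6166374)*x^1 + (-27785073)*x^2 + (-68354085)*x^3 + (-100732833)*x^4 + (-91305465)*x^5 + (-49813254)*x^6 + (-14979276)*x^7 + (-1903824)*x^8)*y^4 +
    ((-62928) + (-531834)*x^1 + (-1795233)*x^2 + (-3197595)*x^3 + (-3283647)*x^4 + (-1957131)*x^5 + (-628992)*x^6 + (-84240)*x^7)*y^5 +
    ((5472) + (41964)*x^1 + (122790)*x^2 + (178782)*x^3 + (138114)*x^4 + (54054)*x^5 + (8424)*x^6)*y^6

/-- With `G(s) = s² (n + s + 2) * certificate n s * commonTerm n s` the right side is `G(s + 1) -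
G(s)`, by `commonTerm_succ`. It is written with `commonTerm n s` alone, so that it makes sense at `s
= n + 2` and becomes a polynomial identity once the common term is factored out. -/
theorem innerTerm_telescoping {n s : ℕ} (h : s ≤ n + 2) :
    2 * (2 * (n : ℚ) + 1) *
      (-((n + 1) * (3 * n + 1) * (3 * n + 2) * (468 * n ^ 3 + 2067 * n ^ 2 + 2967 * n + 1368)) *
          innerTerm n s
        - (416892 + 2297418 * n + 5132736 * n ^ 2 + 5948766 * n ^ 3 + 3778308 * n ^ 4 +
            1249560 * n ^ 5 + 168480 * n ^ 6) * innerTerm (n + 1) s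
        + (n + 2) * (2 * n + 3) *
          (1248 * n ^ 4 + 6136 * n ^ 3 + 10564 * n ^ 2 + 7516 * n + 1896) *
          innerTerm (n + 2) s) =
      certificate n (s + 1) *
          ((2 * n + s + 1) * (2 * n + 4 - s) * (n + 2 - s) * commonTerm n s) -
        s ^ 2 * (n + s + 2) * certificate n s * commonTerm n s := by
  rw [cast_innerTerm_eq h, cast_innerTerm_add_one h, cast_innerTerm_add_two h, certificate,
    certificate]
  have h1 : (2 * n + 1 : ℚ) ≠ 0 := by positivity
  have h3 : (2 * n + 3 : ℚ) ≠ 0 := by positivity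
  field_simp
  ring

theorem innerSum_eq_sum_range {n m : ℕ} (h : n < m) : innerSum n = ∑ s ∈ range m, innerTerm n s :=
  Finset.sum_subset (fun s => by simp; omega) fun s _ hs =>
    innerTerm_eq_zero (by simpa using hs)

/-- The recurrence of order two of the inner sums. -/
theorem innerSum_recurrence (n : ℕ) :
    (n + 2) * (2 * n + 3) * (1248 * n ^ 4 + 6136 * n ^ 3 + 10564 * n ^ 2 + 7516 * n + 1896) *
        (innerSum (n + 2) : ℚ) =
      (416892 + 2297418 * n + 5132736 * n ^ 2 + 5948766 * n ^ 3 + 3778308 * n ^ 4 +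
        1249560 * n ^ 5 + 168480 * n ^ 6) * innerSum (n + 1) +
      (n + 1) * (3 * n + 1) * (3 * n + 2) * (468 * n ^ 3 + 2067 * n ^ 2 + 2967 * n + 1368) *
        innerSum n := by
  set E : ℕ → ℚ := fun s => 2 * (2 * (n : ℚ) + 1) *
      (-((n + 1) * (3 * n + 1) * (3 * n + 2) * (468 * n ^ 3 + 2067 * n ^ 2 + 2967 * n + 1368)) *
          innerTerm n s
        - (416892 + 2297418 * n + 5132736 * n ^ 2 + 5948766 * n ^ 3 + 3778308 * n ^ 4 +
            1249560 * n ^ 5 + 168480 * n ^ 6) * innerTerm (n + 1) s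
        + (n + 2) * (2 * n + 3) *
          (1248 * n ^ 4 + 6136 * n ^ 3 + 10564 * n ^ 2 + 7516 * n + 1896) *
          innerTerm (n + 2) s) with hE
  -- The telescoped sum; its lower end vanishes because of the factor `s²`.
  have hG : ∀ k ≤ n + 2, ∑ s ∈ range k, E s =
      k ^ 2 * (n + k + 2) * certificate n k * commonTerm n k := by
    intro k hk
    induction k with
    | zero => simp
    | succ k ih =>
      rw [Finset.sum_range_succ, ih (by omega), hE]
      simp only
      rw [innerTerm_telescoping (by omega), commonTerm_succ (by omega)]
      push_cast
      ring
  -- At `s = n + 2` the forward term contains `n + 2 - s = 0`, so the last summand cancels the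
  -- telescoped sum.
  have hsum : ∑ s ∈ range (n + 3), E s = 0 := by
    rw [Finset.sum_range_succ, hG _ le_rfl, hE]
    simp only
    rw [innerTerm_telescoping le_rfl]
    push_cast
    ring
  rw [hE, ← Finset.mul_sum, Finset.sum_add_distrib, Finset.sum_sub_distrib, ← Finset.mul_sum,
    ← Finset.mul_sum, ← Finset.mul_sum] at hsum
  have h1 : (2 * (2 * n + 1) : ℚ) ≠ 0 := by positivity
  have := (mul_eq_zero.1 hsum).resolve_left h1
  rw [innerSum_eq_sum_range (show n < n + 3 by omega),
    innerSum_eq_sum_range (show n + 1 < n + 3 by omega),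
    innerSum_eq_sum_range (show n + 2 < n + 3 by omega)]
  push_cast
  linear_combination this

/-- The coefficients of the fundamental period. -/
def periodCoeff (n : ℕ) : ℕ := (2 * n).choose n ^ 2 * innerSum n

end

/-! ### The recurrence of order four for the period coefficients -/

section

open Nat Finset

theorem cast_centralBinom_succ (n : ℕ) :
    ((2 * (n + 1)).choose (n + 1) : ℚ) = 2 * (2 * n + 1) / (n + 1) * (2 * n).choose n := by
  have h := Nat.succ_mul_centralBinom_succ n
  rw [Nat.centralBinom_eq_two_mul_choose, Nat.centralBinom_eq_two_mul_choose] at h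
  have h' : ((n : ℚ) + 1) * (2 * (n + 1)).choose (n + 1) =
      2 * (2 * n + 1) * (2 * n).choose n := mod_cast h
  field_simp
  linear_combination h'

set_option maxHeartbeats 1000000 in
/-- The recurrence of the period coefficients that corresponds to `D7`. -/
theorem periodCoeff_recurrence (n : ℕ) :
    49 * (n + 4 : ℚ) ^ 4 * periodCoeff (n + 4) -
      42 * (1272 * (n + 3) ^ 4 + 2508 * (n + 3) ^ 3 + 1779 * (n + 3) ^ 2 + 525 * (n + 3) + 56) *
        periodCoeff (n + 3) +
      12 * (43704 * (n + 2) ^ 4 + 38088 * (n + 2) ^ 3 - 25757 * (n + 2) ^ 2 - 20608 * (n + 2)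
        - 3360) * periodCoeff (n + 2) -
      432 * (2736 * (n + 1) ^ 4 - 1512 * (n + 1) ^ 3 - 1672 * (n + 1) ^ 2 - 357 * (n + 1) - 14) *
        periodCoeff (n + 1) -
      15552 * (2 * n + 1) ^ 2 * (3 * n + 1) * (3 * n + 2) * periodCoeff n = 0 := by
  -- Three shifts of the order-two recurrence express `b4, b3, b2` through `b1, b0`, and all central
  -- binomials are multiples of one. What remains is an identity of rational functions in `n`,
  -- linear in `b0` and `b1`.
  have h2 := innerSum_recurrence n
  have h3 := innerSum_recurrence (n + 1)
  have h4 := innerSum_recurrence (n + 2)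
  have c1 := cast_centralBinom_succ n
  have c2 := cast_centralBinom_succ (n + 1)
  have c3 := cast_centralBinom_succ (n + 2)
  have c4 := cast_centralBinom_succ (n + 3)
  simp only [periodCoeff]
  push_cast at *
  simp only [add_assoc] at *
  norm_num at *
  rw [c4, c3, c2, c1]
  generalize ((2 * n).choose n : ℚ) = C
  generalize (innerSum (n + 4) : ℚ) = b4 at *
  generalize (innerSum (n + 3) : ℚ) = b3 at *
  generalize (innerSum (n + 2) : ℚ) = b2 at *
  generalize (innerSum (n + 1) : ℚ) = b1 at *
  generalize (innerSum n : ℚ) = b0 at *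
  have hx : (0 : ℚ) ≤ n := n.cast_nonneg
  generalize (n : ℚ) = x at *
  rw [mul_comm, ← eq_div_iff (by positivity)] at h2 h3 h4
  rw [h4, h3, h2]
  field_simp
  ring

end

/-! ### Differential operators with polynomial coefficients and their right division -/

noncomputable section

open Polynomial Finset

/-- The action of the differential operator `∑_j q_j(x) D^j` on a module over `ℂ[x]` with an
operator `D` in the role of `d/dx`. -/
def act {V : Type*} [AddCommGroup V] [Module ℂ[X] V] (D : V → V) (f : V) : ℂ[X][X] →ₗ[ℂ[X]] V :=
  Polynomial.lsum fun j => LinearMap.toSpanSingleton ℂ[X] V (D^[j] f)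

section act

variable {V : Type*} [AddCommGroup V] [Module ℂ[X] V] (D : V → V) (f : V)

theorem act_eq_sum (L : ℂ[X][X]) : act D f L = L.sum fun j q => q • D^[j] f := rfl

theorem act_eq_sum_range (L : ℂ[X][X]) {m : ℕ} (hm : L.natDegree ≤ m) :
    act D f L = ∑ j ∈ range (m + 1), L.coeff j • D^[j] f :=
  Polynomial.sum_over_range' L (by simp) (m + 1) (by omega)

@[simp] theorem act_monomial (j : ℕ) (q : ℂ[X]) : act D f (monomial j q) = q • D^[j] f := by
  rw [act_eq_sum, Polynomial.sum_monomial_index _ _ (by simp)]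

theorem act_C (q : ℂ[X]) : act D f (C q) = q • f := by
  rw [← Polynomial.monomial_zero_left, act_monomial]; rfl

theorem act_C_mul (q : ℂ[X]) (L : ℂ[X][X]) : act D f (C q * L) = q • act D f L := by
  rw [← Polynomial.smul_eq_C_mul, map_smul]

end act

/-- The operator `D ∘ L`. -/
def derivMul (L : ℂ[X][X]) : ℂ[X][X] :=
  X * L + ∑ j ∈ range (L.natDegree + 1), monomial j (derivative (L.coeff j))

theorem coeff_derivMul_natDegree (L : ℂ[X][X]) :
    (derivMul L).coeff (L.natDegree + 1) = L.leadingCoeff := by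
  rw [derivMul, coeff_add, coeff_X_mul, finsetSum_coeff, Finset.sum_eq_zero, add_zero]
  · rfl
  · intro j hj
    rw [coeff_monomial, if_neg]
    simp at hj
    omega

theorem natDegree_derivMul_le (L : ℂ[X][X]) : (derivMul L).natDegree ≤ L.natDegree + 1 := by
  refine natDegree_add_le_of_degree_le ?_ (natDegree_sum_le_of_forall_le _ _ fun j hj => ?_)
  · exact natDegree_mul_le.trans (by rw [natDegree_X, add_comm])
  · refine (natDegree_monomial_le _).trans ?_
    simp at hj
    omega

theorem natDegree_derivMul {L : ℂ[X][X]} (hL : L ≠ 0) :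
    (derivMul L).natDegree = L.natDegree + 1 := by
  refine (natDegree_derivMul_le L).antisymm (le_natDegree_of_ne_zero ?_)
  rwa [coeff_derivMul_natDegree, Ne, leadingCoeff_eq_zero]

theorem leadingCoeff_derivMul {L : ℂ[X][X]} (hL : L ≠ 0) :
    (derivMul L).leadingCoeff = L.leadingCoeff := by
  rw [leadingCoeff, natDegree_derivMul hL, coeff_derivMul_natDegree]

theorem iterate_derivMul {L : ℂ[X][X]} (hL : L ≠ 0) (k : ℕ) :
    derivMul^[k] L ≠ 0 ∧ (derivMul^[k] L).natDegree = L.natDegree + k ∧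
      (derivMul^[k] L).leadingCoeff = L.leadingCoeff := by
  induction k with
  | zero => exact ⟨hL, rfl, rfl⟩
  | succ k ih =>
    obtain ⟨h0, h1, h2⟩ := ih
    rw [Function.iterate_succ_apply']
    have h3 := leadingCoeff_derivMul h0
    refine ⟨fun h => ?_, by rw [natDegree_derivMul h0, h1]; ring, h3.trans h2⟩
    rw [h, leadingCoeff_zero, h2] at h3
    exact hL (leadingCoeff_eq_zero.1 h3.symm)

section act

variable {V : Type*} [AddCommGroup V] [Module ℂ[X] V] (D : V →+ V)

theorem act_derivMul
    (hD : ∀ (q : ℂ[X]) (f : V), D (q • f) = derivative q • f + q • D f)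
    (L : ℂ[X][X]) (f : V) : act D f (derivMul L) = D (act D f L) := by
  rw [act_eq_sum_range D f L le_rfl, map_sum, derivMul, map_add, map_sum]
  have hX : act D f (X * L) = ∑ j ∈ range (L.natDegree + 1), L.coeff j • D^[j + 1] f := by
    conv_lhs => rw [L.as_sum_range' (L.natDegree + 1) (by omega), Finset.mul_sum, map_sum]
    refine Finset.sum_congr rfl fun j _ => ?_
    rw [X_mul_monomial, act_monomial]
  rw [hX, ← Finset.sum_add_distrib]
  refine Finset.sum_congr rfl fun j _ => ?_
  rw [hD, act_monomial, Function.iterate_succ_apply', add_comm]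

theorem act_iterate_derivMul
    (hD : ∀ (q : ℂ[X]) (f : V), D (q • f) = derivative q • f + q • D f)
    (L : ℂ[X][X]) (f : V) (k : ℕ) :
    act D f (derivMul^[k] L) = D^[k] (act D f L) := by
  induction k with
  | zero => rfl
  | succ k ih => rw [Function.iterate_succ_apply', act_derivMul D hD, ih,
      Function.iterate_succ_apply']

/-- Pseudo-division of differential operators with remainder, on the right. -/
theorem exists_act_division {M : ℂ[X][X]} (hM : M ≠ 0) (L : ℂ[X][X]) :
    ∃ (c : ℂ[X]) (Q R : ℂ[X][X]), c ≠ 0 ∧ R.degree < M.degree ∧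
      Q.natDegree ≤ L.natDegree - M.natDegree ∧
      ∀ (V : Type) [AddCommGroup V] [Module ℂ[X] V] (D : V →+ V),
        (∀ (q : ℂ[X]) (f : V), D (q • f) = derivative q • f + q • D f) → ∀ f : V,
        c • act D f L = act D (act D f M) Q + act D f R := by
  induction h : L.degree using WellFoundedLT.induction generalizing L with
  | ind n ih =>
    subst h
    by_cases hlt : L.degree < M.degree
    · exact ⟨1, 0, L, one_ne_zero, hlt, by simp, fun V _ _ D _ f => by simp⟩
    rw [not_lt] at hlt
    have hL : L ≠ 0 := by
      rintro rfl
      rw [degree_zero, le_bot_iff, degree_eq_bot] at hlt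
      exact hM hlt
    have hle := natDegree_le_natDegree hlt
    -- `D^k ∘ M` has the order of `L` and the leading coefficient of `M`. Cross-multiplying the
    -- leading coefficients cancels the top term without denominators.
    set k := L.natDegree - M.natDegree with hk
    obtain ⟨h0, h1, h2⟩ := iterate_derivMul hM k
    set Mk := derivMul^[k] M with hMk
    have hcM : M.leadingCoeff ≠ 0 := leadingCoeff_ne_zero.2 hM
    have hcL : L.leadingCoeff ≠ 0 := leadingCoeff_ne_zero.2 hL
    have hdeg : (C M.leadingCoeff * L - C L.leadingCoeff * Mk).degree < L.degree := by
      rw [← degree_C_mul (p := L) hcM]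
      refine degree_sub_lt_left ?_ (mul_ne_zero (C_ne_zero.2 hcM) hL) ?_
      · rw [degree_C_mul hcM, degree_C_mul hcL, degree_eq_natDegree hL, degree_eq_natDegree h0, h1]
        congr 1
        omega
      · rw [leadingCoeff_mul, leadingCoeff_mul, leadingCoeff_C, leadingCoeff_C, h2, mul_comm]
    obtain ⟨c, Q, R, hc, hR, hQ, hact⟩ := ih _ hdeg _ rfl
    refine ⟨c * M.leadingCoeff, Q + monomial k (c * L.leadingCoeff), R, mul_ne_zero hc hcM, hR, ?_,
      fun V _ _ D hD f => ?_⟩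
    · refine natDegree_add_le_of_degree_le (hQ.trans ?_) (natDegree_monomial_le _)
      exact Nat.sub_le_sub_right (natDegree_le_natDegree hdeg.le) _
    · have := hact V D hD f
      rw [map_sub, act_C_mul, act_C_mul, hMk, act_iterate_derivMul D hD, smul_sub, sub_eq_iff_eq_add] at this
      rw [mul_smul, this, map_add, act_monomial, mul_smul]
      abel

end act

end

/-! ### Action on monomials and symbols of compositions -/

noncomputable section

open Polynomial Finset

/-- The coefficient of `x^(n + i)` in `x^N L(x^n)`, as a polynomial in the exponent `n`. -/
def symb (N : ℕ) (L : ℂ[X][X]) (i : ℕ) : ℂ[X] :=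
  ∑ j ∈ range (N + 1), C ((X ^ (N - j) * L.coeff j).coeff i) * descPochhammer ℂ j

/-- The polynomial `x^(N - n) L(x^n)`. -/
def symbAt (N : ℕ) (L : ℂ[X][X]) (n : ℂ) : ℂ[X] :=
  ∑ j ∈ range (N + 1), C ((descPochhammer ℂ j).eval n) * (X ^ (N - j) * L.coeff j)

theorem coeff_symbAt (N : ℕ) (L : ℂ[X][X]) (n : ℂ) (i : ℕ) :
    (symbAt N L n).coeff i = (symb N L i).eval n := by
  rw [symbAt, symb, finsetSum_coeff, eval_finsetSum]
  refine Finset.sum_congr rfl fun j _ => ?_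
  rw [coeff_C_mul, eval_mul, eval_C, mul_comm]

theorem X_pow_mul_act_X_pow {N : ℕ} {L : ℂ[X][X]} (hN : L.natDegree ≤ N) (n : ℕ) :
    X ^ N * act derivative (X ^ n : ℂ[X]) L = X ^ n * symbAt N L n := by
  rw [act_eq_sum_range _ _ L hN, symbAt, Finset.mul_sum, Finset.mul_sum]
  refine Finset.sum_congr rfl fun j hj => ?_
  have hj : j ≤ N := by simpa [Nat.lt_succ_iff] using hj
  rw [iterate_derivative_X_pow_eq_C_mul, descPochhammer_eval_eq_descFactorial, smul_eq_mul]
  -- For `n < j` the subtraction `n - j` is truncated, but the descending factorial is zero.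
  rcases Nat.lt_or_ge n j with h | h
  · simp [Nat.descFactorial_of_lt h]
  · have h1 : (X : ℂ[X]) ^ N = X ^ (N - j) * X ^ j := by rw [← pow_add]; congr 1; omega
    have h2 : (X : ℂ[X]) ^ n = X ^ (n - j) * X ^ j := by rw [← pow_add]; congr 1; omega
    rw [h1, h2, show X ^ (n - j) * X ^ j = (X : ℂ[X]) ^ n from h2.symm]
    rw [show C ((n.descFactorial j : ℕ) : ℂ) * X ^ (n - j) =
      (X ^ (n - j) * C ((n.descFactorial j : ℕ) : ℂ) : ℂ[X]) from mul_comm _ _, h2]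
    ring

theorem act_derivative_add (L : ℂ[X][X]) (f g : ℂ[X]) :
    act derivative (f + g) L = act derivative f L + act derivative g L := by
  rw [act_eq_sum_range _ _ L le_rfl, act_eq_sum_range _ _ L le_rfl, act_eq_sum_range _ _ L le_rfl,
    ← Finset.sum_add_distrib]
  refine Finset.sum_congr rfl fun j _ => ?_
  rw [iterate_map_add, smul_add]

theorem act_derivative_C_mul (L : ℂ[X][X]) (c : ℂ) (f : ℂ[X]) :
    act derivative (C c * f) L = C c * act derivative f L := by
  rw [act_eq_sum_range _ _ L le_rfl, act_eq_sum_range _ _ L le_rfl, Finset.mul_sum]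
  refine Finset.sum_congr rfl fun j _ => ?_
  rw [iterate_derivative_C_mul, smul_eq_mul, smul_eq_mul]
  ring

theorem act_derivative_zero (L : ℂ[X][X]) : act derivative (0 : ℂ[X]) L = 0 := by
  simpa using act_derivative_C_mul L 0 0

theorem act_derivative_sum {ι : Type*} (L : ℂ[X][X]) (s : Finset ι) (f : ι → ℂ[X]) :
    act derivative (∑ i ∈ s, f i) L = ∑ i ∈ s, act derivative (f i) L := by
  classical
  induction s using Finset.induction_on with
  | empty => simp [act_derivative_zero]
  | insert a s ha ih => rw [Finset.sum_insert ha, Finset.sum_insert ha, act_derivative_add, ih]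

/-- The symbol of a composition of operators. -/
theorem symb_comp {c : ℂ[X]} {L Q M : ℂ[X][X]} {q m : ℕ} (hQ : Q.natDegree ≤ q)
    (hM : M.natDegree ≤ m) (hL : L.natDegree ≤ q + m)
    (h : ∀ f : ℂ[X], c * act derivative f L = act derivative (act derivative f M) Q) (k : ℕ) :
    ∑ ij ∈ antidiagonal k, C (c.coeff ij.1) * symb (q + m) L ij.2 =
      ∑ ij ∈ antidiagonal k, symb m M ij.1 * (symb q Q ij.2).comp (X + C ((ij.1 : ℂ) - m)) := by
  -- Both sides are polynomials in the exponent, so it suffices to apply the operators to `x^n` for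
  -- `n ≥ m`. For such `n`, `M(x^n)` is divisible by `x^(n - m)`.
  refine Polynomial.eq_of_infinite_eval_eq _ _ (Set.Infinite.mono ?_
    ((Set.Ici_infinite m).image (Nat.cast_injective (R := ℂ)).injOn))
  rintro _ ⟨n, hn, rfl⟩
  rw [Set.mem_Ici] at hn
  have hX : (X : ℂ[X]) ≠ 0 := X_ne_zero
  set a := symbAt m M n with ha
  have h1 : act derivative (X ^ n : ℂ[X]) M = X ^ (n - m) * a := by
    apply mul_left_cancel₀ (pow_ne_zero m hX)
    rw [X_pow_mul_act_X_pow hM, ← mul_assoc, ← pow_add]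
    congr 2
    omega
  have h2 : X ^ q * act derivative (X ^ (n - m) * a) Q =
      X ^ (n - m) * ∑ i ∈ range (a.natDegree + 1),
        C (a.coeff i) * X ^ i * symbAt q Q ((n : ℂ) + (i - m)) := by
    conv_lhs => rw [a.as_sum_range_C_mul_X_pow, Finset.mul_sum, act_derivative_sum]
    rw [Finset.mul_sum, Finset.mul_sum]
    refine Finset.sum_congr rfl fun i _ => ?_
    rw [mul_left_comm, ← pow_add, act_derivative_C_mul, mul_left_comm, X_pow_mul_act_X_pow hQ,
      pow_add]
    have : ((n - m + i : ℕ) : ℂ) = n + (i - m) := by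
      push_cast [Nat.cast_sub hn]
      ring
    rw [this]
    ring
  -- `M(x^n)` consists of monomials of exponent `n + i - m`, and `Q` acts on each of them
  -- separately; this is the origin of the shifted argument.
  have h3 : c * symbAt (q + m) L n = ∑ i ∈ range (a.natDegree + 1),
        C (a.coeff i) * X ^ i * symbAt q Q ((n : ℂ) + (i - m)) := by
    apply mul_left_cancel₀ (pow_ne_zero n hX)
    have h4 := h (X ^ n)
    rw [h1] at h4
    calc X ^ n * (c * symbAt (q + m) L n) = X ^ m * (X ^ q * (c * act derivative (X ^ n) L)) := by
          rw [mul_left_comm, ← X_pow_mul_act_X_pow hL]; ring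
      _ = _ := by
          rw [h4, h2, ← mul_assoc, ← pow_add, Nat.add_sub_cancel' hn]
  have h5 := congrArg (fun p => coeff p k) h3
  rw [coeff_mul, finsetSum_coeff] at h5
  rw [Set.mem_ofPred_eq, eval_finsetSum, eval_finsetSum]
  refine Eq.trans (Finset.sum_congr rfl fun ij _ => ?_) (h5.trans ?_)
  · rw [eval_mul, eval_C, coeff_symbAt]
  · have h6 : ∀ i, (C (a.coeff i) * X ^ i * symbAt q Q ((n : ℂ) + (i - m))).coeff k =
        if i ≤ k then a.coeff i * (symbAt q Q ((n : ℂ) + (i - m))).coeff (k - i) else 0 := by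
      intro i
      rw [mul_assoc, coeff_C_mul, coeff_X_pow_mul']
      split_ifs <;> simp
    rw [Finset.sum_congr rfl fun i _ => h6 i, Finset.Nat.sum_antidiagonal_eq_sum_range_succ_mk]
    have h7 : ∀ i, (symb m M i * (symb q Q (k - i)).comp (X + C ((i : ℂ) - m))).eval (n : ℂ) =
        a.coeff i * (symbAt q Q ((n : ℂ) + (i - m))).coeff (k - i) := by
      intro i
      rw [eval_mul, eval_comp, ← coeff_symbAt, ← ha]
      simp [coeff_symbAt]
    rw [Finset.sum_congr rfl fun i _ => h7 i, ← Finset.sum_filter]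
    set g : ℕ → ℂ := fun i => a.coeff i * (symbAt q Q ((n : ℂ) + (i - m))).coeff (k - i)
    -- The degree of `a` may be smaller or larger than `k`, so both index ranges are compared inside
    -- a common one.
    have e1 : ∑ i ∈ range (a.natDegree + 1) with i ≤ k, g i =
        ∑ i ∈ range (max a.natDegree k + 1) with i ≤ k, g i := by
      refine Finset.sum_subset (fun i => by simp; omega) fun i _ hi => ?_
      simp only [mem_filter, mem_range, not_and] at *
      have : a.natDegree < i := by
        by_contra hc
        exact hi (by omega) (by tauto)
      simp only [g]
      rw [coeff_eq_zero_of_natDegree_lt this, zero_mul]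
    rw [e1]
    refine Finset.sum_congr ?_ fun _ _ => rfl
    ext i
    simp
    omega

end

/-! ### Indicial polynomials as lowest and highest terms of the symbol -/

noncomputable section

open Polynomial Finset

/-- `P` is the first nonzero term (for `r = (· < ·)`) or the last nonzero term
(for `r = (· > ·)`) of the sequence `a`, and `v` is its position. -/
def IsExtreme (r : ℕ → ℕ → Prop) (a : ℕ → ℂ[X]) (v : ℕ) (P : ℂ[X]) : Prop :=
  a v = P ∧ P ≠ 0 ∧ ∀ i, r i v → a i = 0

theorem exists_isExtreme {r : ℕ → ℕ → Prop} (hr : r = (· < ·) ∨ r = (· > ·)) {a : ℕ → ℂ[X]}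
    {B i : ℕ} (hB : ∀ i, B < i → a i = 0) (hi : a i ≠ 0) : ∃ v P, IsExtreme r a v P := by
  classical
  have hiB : i ≤ B := by
    by_contra h
    exact hi (hB i (by omega))
  rcases hr with rfl | rfl
  · exact ⟨Nat.find ⟨i, hi⟩, _, rfl, Nat.find_spec (p := fun i => a i ≠ 0) ⟨i, hi⟩, fun j hj => by
      simpa using Nat.find_min (p := fun i => a i ≠ 0) ⟨i, hi⟩ hj⟩
  · refine ⟨Nat.findGreatest (fun i => a i ≠ 0) B, _, rfl,
      Nat.findGreatest_spec (P := fun i => a i ≠ 0) hiB hi, fun j hj => ?_⟩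
    by_cases hjB : j ≤ B
    · simpa using Nat.findGreatest_is_greatest (P := fun i => a i ≠ 0) hj hjB
    · exact hB j (by omega)

/-- As for the lowest or highest term of a product of polynomials: beyond `v + w` every pair has an
index beyond `v` or `w`, and at `v + w` only `(v, w)` remains. The order `<` serves the finite
points, `>` serves infinity. -/
theorem sum_antidiagonal_of_isExtreme {r : ℕ → ℕ → Prop} (hr : r = (· < ·) ∨ r = (· > ·))
    {a b : ℕ → ℂ[X]} (s : ℕ → ℂ[X]) {v w : ℕ} {P P' : ℂ[X]} (ha : IsExtreme r a v P)
    (hb : IsExtreme r b w P') :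
    (∑ ij ∈ antidiagonal (v + w), a ij.1 * (b ij.2).comp (s ij.1) = P * P'.comp (s v)) ∧
      ∀ k, r k (v + w) → ∑ ij ∈ antidiagonal k, a ij.1 * (b ij.2).comp (s ij.1) = 0 := by
  constructor
  · rw [Finset.sum_eq_single (v, w)]
    · rw [ha.1, hb.1]
    · rintro ⟨i, j⟩ hij hne
      rw [HasAntidiagonal.mem_antidiagonal] at hij
      have : r i v ∨ r j w := by
        simp only [ne_eq, Prod.mk.injEq, not_and] at hne
        rcases hr with rfl | rfl <;> simp only <;> omega
      rcases this with h | h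
      · rw [ha.2.2 i h, zero_mul]
      · rw [hb.2.2 j h, zero_comp, mul_zero]
    · simp
  · intro k hk
    refine Finset.sum_eq_zero fun ij hij => ?_
    rw [HasAntidiagonal.mem_antidiagonal] at hij
    have : r ij.1 v ∨ r ij.2 w := by
      rcases hr with rfl | rfl <;> simp only at hk ⊢ <;> omega
    rcases this with h | h
    · rw [ha.2.2 _ h, zero_mul]
    · rw [hb.2.2 _ h, zero_comp, mul_zero]

theorem IsExtreme.unique {r : ℕ → ℕ → Prop} (hr : r = (· < ·) ∨ r = (· > ·))
    {a : ℕ → ℂ[X]} {v w : ℕ} {P P' : ℂ[X]} (h : IsExtreme r a v P) (h' : IsExtreme r a w P') :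
    P = P' := by
  have hvw : v = w := by
    by_contra hne
    have : r v w ∨ r w v := by
      rcases hr with rfl | rfl <;> simp only <;> omega
    rcases this with hc | hc
    · exact h.2.1 (h.1.symm.trans (h'.2.2 v hc))
    · exact h'.2.1 (h'.1.symm.trans (h.2.2 w hc))
  subst hvw
  exact h.1.symm.trans h'.1

theorem coeff_descPochhammer_self (j : ℕ) : (descPochhammer ℂ j).coeff j = 1 := by
  have h := monic_descPochhammer ℂ j
  rwa [Monic, leadingCoeff, descPochhammer_natDegree] at h

theorem natDegree_symb_le (N : ℕ) (L : ℂ[X][X]) (i : ℕ) : (symb N L i).natDegree ≤ N := by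
  refine natDegree_sum_le_of_forall_le _ _ fun j hj => ?_
  refine (natDegree_C_mul_le _ _).trans ?_
  rw [descPochhammer_natDegree]
  simpa [Nat.lt_succ_iff] using hj

theorem coeff_symb_self (N : ℕ) (L : ℂ[X][X]) (i : ℕ) :
    (symb N L i).coeff N = (L.coeff N).coeff i := by
  rw [symb, finsetSum_coeff, Finset.sum_range_succ, Finset.sum_eq_zero, coeff_C_mul,
    coeff_descPochhammer_self]
  · simp
  · intro j hj
    rw [coeff_C_mul, coeff_eq_zero_of_natDegree_lt (p := descPochhammer ℂ j), mul_zero]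
    rw [descPochhammer_natDegree]
    simpa using hj

theorem coeff_descPochhammer_succ (j : ℕ) :
    (descPochhammer ℂ (j + 1)).coeff j = -((j : ℂ) * (j + 1) / 2) := by
  induction j with
  | zero => simp
  | succ j ih =>
    rw [descPochhammer_succ_right, mul_sub, coeff_sub, coeff_mul_X, ih, ← C_eq_natCast, coeff_mul_C,
      coeff_descPochhammer_self]
    push_cast
    ring

/-- The exponents at a point are the roots of the indicial polynomial, so its two top coefficients
determine their sum. The correction is the second coefficient `-N(N + 1)/2` of `n (n - 1) ⋯ (n -
N)`. -/
theorem coeff_symb_succ (N : ℕ) (L : ℂ[X][X]) (i : ℕ) :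
    (symb (N + 1) L i).coeff N = (X * L.coeff N).coeff i -
      (N : ℂ) * (N + 1) / 2 * (L.coeff (N + 1)).coeff i := by
  rw [symb, finsetSum_coeff, Finset.sum_range_succ, Finset.sum_range_succ, Finset.sum_eq_zero,
    coeff_C_mul, coeff_C_mul, coeff_descPochhammer_self, coeff_descPochhammer_succ]
  · simp
    ring
  · intro j hj
    rw [coeff_C_mul, coeff_eq_zero_of_natDegree_lt (p := descPochhammer ℂ j), mul_zero]
    rw [descPochhammer_natDegree]
    simpa using hj

theorem symb_eq_zero_of_lt (N : ℕ) (L : ℂ[X][X]) :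
    ∃ B, ∀ i, B < i → symb N L i = 0 := by
  refine ⟨∑ j ∈ range (N + 1), (X ^ (N - j) * L.coeff j).natDegree, fun i hi => ?_⟩
  refine Finset.sum_eq_zero fun j hj => ?_
  rw [coeff_eq_zero_of_natDegree_lt, C_0, zero_mul]
  exact (Finset.single_le_sum (f := fun j => (X ^ (N - j) * L.coeff j).natDegree)
    (fun _ _ => Nat.zero_le _) hj).trans_lt hi

/-- A right factor `M` of `L` has an indicial polynomial of the full degree, which divides the
indicial polynomial of `L`. -/
theorem exists_isExtreme_symb_dvd {r : ℕ → ℕ → Prop} (hr : r = (· < ·) ∨ r = (· > ·))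
    {c : ℂ[X]} (hc : c ≠ 0) {L Q M : ℂ[X][X]} {q : ℕ} (hQ : Q.natDegree ≤ q)
    (hM : M ≠ 0) (hL : L.natDegree ≤ q + M.natDegree)
    (h : ∀ f : ℂ[X], c * act derivative f L = act derivative (act derivative f M) Q)
    {u : ℕ} {P : ℂ[X]} (hP : IsExtreme r (symb (q + M.natDegree) L) u P)
    (hdeg : P.natDegree = q + M.natDegree) :
    ∃ v P', IsExtreme r (symb M.natDegree M) v P' ∧ P' ∣ P ∧ P'.natDegree = M.natDegree := by
  set m := M.natDegree with hm
  have hcomp := symb_comp hQ hm.ge hL h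
  -- The multiplier `c` is treated as an operator of order zero, whose symbol is its sequence of
  -- coefficients.
  obtain ⟨e, c₀, hc'⟩ : ∃ e c₀, IsExtreme r (fun i => C (c.coeff i)) e (C c₀) := by
    rcases hr with rfl | rfl
    · refine ⟨_, _, rfl, C_ne_zero.2 (trailingCoeff_nonzero_iff_nonzero.2 hc), fun i hi => ?_⟩
      beta_reduce
      rw [coeff_eq_zero_of_lt_natTrailingDegree hi, C_0]
    · refine ⟨_, _, rfl, C_ne_zero.2 (leadingCoeff_ne_zero.2 hc), fun i hi => ?_⟩
      beta_reduce
      rw [coeff_eq_zero_of_natDegree_lt hi, C_0]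
  have hl := sum_antidiagonal_of_isExtreme hr (fun _ => X) hc' hP
  simp only [comp_X] at hl
  have hc₀ : c₀ ≠ 0 := C_ne_zero.1 hc'.2.1
  obtain ⟨B, hB⟩ := symb_eq_zero_of_lt m M
  obtain ⟨B', hB'⟩ := symb_eq_zero_of_lt q Q
  obtain ⟨i, hi⟩ : ∃ i, symb m M i ≠ 0 := by
    refine ⟨M.leadingCoeff.natDegree, fun h0 => ?_⟩
    have := congrArg (fun p => coeff p m) h0
    simp only [coeff_symb_self, coeff_zero] at this
    exact hM (leadingCoeff_eq_zero.1 (leadingCoeff_eq_zero.1 this))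
  have hPne : C c₀ * P ≠ 0 := mul_ne_zero hc'.2.1 hP.2.1
  obtain ⟨j, hj⟩ : ∃ j, symb q Q j ≠ 0 := by
    by_contra! h0
    refine hPne (hl.1.symm.trans ((hcomp _).trans (Finset.sum_eq_zero fun ij _ => ?_)))
    rw [h0, zero_comp, mul_zero]
  obtain ⟨v, P', hP'⟩ := exists_isExtreme hr hB hi
  obtain ⟨w, P'', hP''⟩ := exists_isExtreme hr hB' hj
  have hrr := sum_antidiagonal_of_isExtreme hr (fun i => X + C ((i : ℂ) - m)) hP' hP''
  have hP''deg : P''.natDegree ≤ q := hP''.1 ▸ natDegree_symb_le q Q w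
  have hP'deg : P'.natDegree ≤ m := hP'.1 ▸ natDegree_symb_le m M v
  have hX : (X + C ((v : ℂ) - m)).natDegree = 1 := natDegree_X_add_C _
  have hcne : P''.comp (X + C ((v : ℂ) - m)) ≠ 0 :=
    comp_X_add_C_ne_zero_iff.2 hP''.2.1
  -- The extreme terms of the two sides of the composition formula agree. Since `P` has the full
  -- degree `q + m`, while `P'` and `P''` have degree at most `m` and `q`, both attain their bounds.
  have key : C c₀ * P = P' * P''.comp (X + C ((v : ℂ) - m)) := by
    refine IsExtreme.unique hr (v := e + u) (w := v + w)
      (a := fun k => ∑ ij ∈ antidiagonal k, C (c.coeff ij.1) * symb (q + m) L ij.2)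
      ⟨hl.1, hPne, fun k hk => hl.2 k hk⟩
      ⟨(hcomp _).trans hrr.1, mul_ne_zero hP'.2.1 hcne, fun k hk => (hcomp k).trans (hrr.2 k hk)⟩
  refine ⟨v, P', hP', ?_, ?_⟩
  · have : P' ∣ C c₀ * P := ⟨_, key⟩
    rwa [(isUnit_C.2 hc₀.isUnit).dvd_mul_left] at this
  · have h1 := congrArg natDegree key
    rw [natDegree_C_mul hc₀, natDegree_mul hP'.2.1 hcne, natDegree_comp, hX, hdeg] at h1
    omega

end

/-! ### Sums of exponents, the residue theorem and translation -/

noncomputable section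

open Polynomial Finset

/-- The roots of the indicial polynomial of a right factor `M` of `L` form a submultiset of those
of `L`, and their sum is read off from the two leading coefficients of `M`. -/
theorem exists_exponents {r : ℕ → ℕ → Prop} (hr : r = (· < ·) ∨ r = (· > ·))
    {c : ℂ[X]} (hc : c ≠ 0) {L Q M : ℂ[X][X]} {q N : ℕ} (hQ : Q.natDegree ≤ q)
    (hM : M.natDegree = N + 1) (hL : L.natDegree ≤ q + (N + 1))
    (h : ∀ f : ℂ[X], c * act derivative f L = act derivative (act derivative f M) Q)
    {u : ℕ} {P : ℂ[X]} (hP : IsExtreme r (symb (q + (N + 1)) L) u P)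
    (hdeg : P.natDegree = q + (N + 1)) :
    ∃ (v : ℕ) (E : Multiset ℂ), E ≤ P.roots ∧ E.card = N + 1 ∧ M.leadingCoeff.coeff v ≠ 0 ∧
      (X * M.coeff N).coeff v = ((N : ℂ) * (N + 1) / 2 - E.sum) * M.leadingCoeff.coeff v ∧
      ∀ i, r i v → M.leadingCoeff.coeff i = 0 ∧ (X * M.coeff N).coeff i = 0 := by
  have hM0 : M ≠ 0 := by
    rintro rfl
    simp at hM
  obtain ⟨v, P', hP', hdvd, hdeg'⟩ :=
    exists_isExtreme_symb_dvd hr hc hQ hM0 (hM ▸ hL) h (hM ▸ hP) (hM ▸ hdeg)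
  rw [hM] at hP' hdeg'
  have hlead : M.leadingCoeff = M.coeff (N + 1) := by rw [leadingCoeff, hM]
  have h1 : P'.coeff (N + 1) = M.leadingCoeff.coeff v := by
    rw [← hP'.1, coeff_symb_self, hlead]
  have h2 : P'.coeff N = (X * M.coeff N).coeff v -
      (N : ℂ) * (N + 1) / 2 * M.leadingCoeff.coeff v := by
    rw [← hP'.1, coeff_symb_succ, hlead]
  -- Vieta's formula for the sum of the roots. The resulting ratio of coefficients at `v` is, at a
  -- finite point, the residue of `M.coeff N / M.leadingCoeff`; the factor `X` accounts for the
  -- simple pole.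
  have hsplit := IsAlgClosed.splits P'
  have h3 := hsplit.nextCoeff_eq_neg_sum_roots_mul_leadingCoeff
  rw [nextCoeff_of_natDegree_pos (by omega), leadingCoeff, hdeg', Nat.add_sub_cancel] at h3
  refine ⟨v, P'.roots, roots.le_of_dvd hP.2.1 hdvd, ?_, ?_, ?_, fun i hi => ?_⟩
  · rw [← hsplit.natDegree_eq_card_roots, hdeg']
  · rw [← h1]
    have := leadingCoeff_ne_zero.2 hP'.2.1
    rwa [leadingCoeff, hdeg'] at this
  · rw [h1, h2] at h3
    linear_combination h3
  · have h4 := hP'.2.2 i hi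
    have h5 := congrArg (fun p => coeff p (N + 1)) h4
    have h6 := congrArg (fun p => coeff p N) h4
    simp only [coeff_symb_self, coeff_symb_succ, coeff_zero] at h5 h6
    rw [hlead]
    refine ⟨h5, ?_⟩
    rw [h5] at h6
    linear_combination h6

/-- The residue theorem for `g / f` when all its poles are simple. -/
theorem sum_residues_eq {f g : ℂ[X]} (hf : f ≠ 0) (hfg : (X * g).natDegree ≤ f.natDegree)
    {S : Finset ℂ} (hS : S.Nonempty) (hroots : ∀ p, f.IsRoot p → p ∈ S) {ρ : ℂ → ℂ}
    (hρ : ∀ p ∈ S, ∃ v, (taylor p f).coeff v ≠ 0 ∧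
      (X * taylor p g).coeff v = ρ p * (taylor p f).coeff v ∧
      ∀ i < v, (taylor p f).coeff i = 0 ∧ (X * taylor p g).coeff i = 0) :
    (X * g).coeff f.natDegree = (∑ p ∈ S, ρ p) * f.leadingCoeff := by
  set A : ℂ[X] := ∏ p ∈ S, (X - C p) with hA
  have hAmonic : A.Monic := monic_prod_of_monic _ _ fun p _ => monic_X_sub_C p
  have hAdeg : A.natDegree = #S := by
    rw [hA, natDegree_prod_of_monic _ _ fun p _ => monic_X_sub_C p]
    simp
  have hAp : ∀ p ∈ S, A = (X - C p) * ∏ q ∈ S.erase p, (X - C q) := fun p hp =>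
    (Finset.mul_prod_erase S _ hp).symm
  have htX : ∀ p : ℂ, taylor p (X - C p) = X := fun p => by simp
  -- Simplicity of the poles: at a root of `f` the order of `g` falls short by at most one, which
  -- `A` supplies.
  have hdvd : f ∣ g * A := by
    by_cases hg : g * A = 0
    · rw [hg]; exact dvd_zero f
    refine (IsAlgClosed.dvd_iff_roots_le_roots hf hg).2 (Multiset.le_iff_count.2 fun p => ?_)
    rw [count_roots, count_roots]
    by_cases hp : f.IsRoot p
    · obtain ⟨v, hv, -, hlow⟩ := hρ p (hroots p hp)
      rw [rootMultiplicity_eq_natTrailingDegree, rootMultiplicity_eq_natTrailingDegree,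
        ← taylor_apply, ← taylor_apply]
      refine (natTrailingDegree_le_of_ne_zero hv).trans ?_
      refine le_natTrailingDegree (by rwa [Ne, taylor_eq_zero]) fun i hi => ?_
      rw [hAp p (hroots p hp), mul_left_comm, ← mul_assoc, taylor_mul, taylor_mul, htX, coeff_mul]
      refine Finset.sum_eq_zero fun ij hij => ?_
      rw [HasAntidiagonal.mem_antidiagonal] at hij
      rw [(hlow ij.1 (by omega)).2, zero_mul]
    · rw [rootMultiplicity_eq_zero hp]
      exact Nat.zero_le _
  obtain ⟨B, hB⟩ := hdvd
  have hBp : ∀ p ∈ S, B.eval p / ∏ q ∈ S.erase p, (p - q) = ρ p := by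
    intro p hp
    obtain ⟨v, hv, hvg, hlow⟩ := hρ p hp
    have h1 : (X * taylor p g) * taylor p (∏ q ∈ S.erase p, (X - C q)) =
        taylor p f * taylor p B := by
      rw [← taylor_mul, ← hB, hAp p hp, taylor_mul, taylor_mul, htX]
      ring
    have h2 := congrArg (fun P => coeff P v) h1
    have key : ∀ P P' : ℂ[X], (∀ i < v, P.coeff i = 0) →
        (P * P').coeff v = P.coeff v * P'.coeff 0 := by
      intro P P' hP
      rw [coeff_mul, Finset.sum_eq_single (v, 0)]
      · rintro ⟨i, j⟩ hij hne
        rw [HasAntidiagonal.mem_antidiagonal] at hij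
        have : i < v := by
          by_contra hc
          apply hne
          ext <;> simp only at * <;> omega
        rw [hP i this, zero_mul]
      · simp
    rw [key _ _ fun i hi => (hlow i hi).2, key _ _ fun i hi => (hlow i hi).1, hvg,
      taylor_coeff_zero, taylor_coeff_zero, eval_prod] at h2
    simp only [eval_sub, eval_X, eval_C] at h2
    have hne : ∏ q ∈ S.erase p, (p - q) ≠ 0 :=
      Finset.prod_ne_zero_iff.2 fun q hq => sub_ne_zero.2 (Finset.ne_of_mem_erase hq).symm
    rw [div_eq_iff hne]
    apply mul_left_cancel₀ hv
    linear_combination -h2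
  have hcard : 0 < #S := hS.card_pos
  have hBdeg : B.degree < #S := by
    by_cases hB0 : B = 0
    · rw [hB0, degree_zero]; exact WithBot.bot_lt_coe _
    have hg : g ≠ 0 := by
      rintro rfl
      rw [zero_mul] at hB
      exact mul_ne_zero hf hB0 hB.symm
    have h1 := congrArg natDegree hB
    rw [natDegree_mul hg hAmonic.ne_zero, natDegree_mul hf hB0, hAdeg] at h1
    rw [natDegree_X_mul hg] at hfg
    rw [degree_eq_natDegree hB0]
    exact_mod_cast (by omega : B.natDegree < #S)
  -- With `g * A = f * B` the residue at `p` is `B(p) / ∏ (p - q)`. Lagrange interpolation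
  -- identifies the sum of these values with the coefficient of degree `#S - 1` of `B`, which is
  -- compared with the top coefficient of `X * g`.
  have hL := Lagrange.coeff_eq_sum (v := fun x : ℂ => x) (s := S) Function.injective_id.injOn hBdeg
  rw [Finset.sum_congr rfl hBp] at hL
  have h1 : ((X * g) * A).coeff (f.natDegree + #S) = (X * g).coeff f.natDegree := by
    rw [coeff_mul_add_eq_of_natDegree_le hfg hAdeg.le]
    have := hAmonic.coeff_natDegree
    rw [hAdeg] at this
    rw [this, mul_one]
  have hXB : (X * B).natDegree ≤ #S := by
    by_cases hB0 : B = 0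
    · simp [hB0]
    rw [natDegree_X_mul hB0]
    have := (natDegree_lt_iff_degree_lt hB0).2 hBdeg
    omega
  have h2 : ((X * g) * A).coeff (f.natDegree + #S) = f.leadingCoeff * B.coeff (#S - 1) := by
    rw [mul_assoc, hB, mul_left_comm, coeff_mul_add_eq_of_natDegree_le le_rfl hXB]
    congr 1
    conv_lhs => rw [show #S = #S - 1 + 1 by omega, coeff_X_mul]
  rw [← h1, h2, hL, mul_comm]

/-- The translate `L(x + p, d/dx)` of a differential operator. -/
def translate (p : ℂ) (L : ℂ[X][X]) : ℂ[X][X] := L.map (taylorAlgHom p : ℂ[X] →+* ℂ[X])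

theorem coeff_translate (p : ℂ) (L : ℂ[X][X]) (j : ℕ) :
    (translate p L).coeff j = taylor p (L.coeff j) := coeff_map _ _

theorem natDegree_translate (p : ℂ) (L : ℂ[X][X]) : (translate p L).natDegree = L.natDegree :=
  natDegree_map_eq_of_injective (taylor_injective p) L

theorem iterate_derivative_taylor (p : ℂ) (f : ℂ[X]) (j : ℕ) :
    derivative^[j] (taylor p f) = taylor p (derivative^[j] f) := by
  induction j with
  | zero => rfl
  | succ j ih =>
    rw [Function.iterate_succ_apply', Function.iterate_succ_apply', ih, taylor_apply, taylor_apply,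
      derivative_comp]
    simp

theorem act_translate (p : ℂ) (L : ℂ[X][X]) (f : ℂ[X]) :
    act derivative (taylor p f) (translate p L) = taylor p (act derivative f L) := by
  rw [act_eq_sum_range _ _ _ (natDegree_translate p L).le, act_eq_sum_range _ _ _ le_rfl, map_sum]
  refine Finset.sum_congr rfl fun j _ => ?_
  rw [coeff_translate, iterate_derivative_taylor, smul_eq_mul, smul_eq_mul, taylor_mul]

/-- Translation commutes with `d/dx`, so a factorization can be moved to any point and local
statements are needed only at the origin. -/
theorem act_translate_comp {c : ℂ[X]} {L Q M : ℂ[X][X]}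
    (h : ∀ f : ℂ[X], c * act derivative f L = act derivative (act derivative f M) Q) (p : ℂ)
    (f : ℂ[X]) : taylor p c * act derivative f (translate p L) =
      act derivative (act derivative f (translate p M)) (translate p Q) := by
  have hf : f = taylor p (taylor (-p) f) := by rw [taylor_taylor]; simp
  rw [hf, act_translate, act_translate, act_translate, ← taylor_mul, h]

end

/-! ### Local exponents of `D7` at all points -/

noncomputable section

open Polynomial Finset

/-- The coefficients of `x^j (d/dx)^j` in `D7`. -/
def eulerCoeff : ℕ → ℂ[X]
  | 0 => C (-2352) * X + C (-40320) * X ^ 2 + C 6048 * X ^ 3 + C (-31104) * X ^ 4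
  | 1 => C 49 + C (-255528) * X + C 425124 * X ^ 2 + C 347760 * X ^ 3 + C (-2768256) * X ^ 4
  | 2 => C 343 + C (-764694) * X + C 4733220 * X ^ 2 + C (-5591808) * X ^ 3 +
      C (-8102592) * X ^ 4
  | 3 => C 294 + C (-425880) * X + C 3603744 * X ^ 2 + C (-6438528) * X ^ 3 +
      C (-4478976) * X ^ 4
  | 4 => C 49 + C (-53424) * X + C 524448 * X ^ 2 + C (-1181952) * X ^ 3 + C (-559872) * X ^ 4
  | _ => 0

/-- The operator `D7`, written in `d/dx` instead of `Θ`. -/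
def D7ord : ℂ[X][X] := ∑ j ∈ range 5, monomial j (X ^ j * eulerCoeff j)

theorem coeff_D7ord (j : ℕ) : D7ord.coeff j = X ^ j * eulerCoeff j := by
  rw [D7ord, finsetSum_coeff]
  simp only [coeff_monomial]
  rw [Finset.sum_ite_eq' (range 5) j]
  split_ifs with h
  · rfl
  · have : 5 ≤ j := by simpa using h
    obtain ⟨k, rfl⟩ := Nat.exists_eq_add_of_le' this
    simp [eulerCoeff]

theorem natDegree_D7ord_le : D7ord.natDegree ≤ 4 :=
  natDegree_sum_le_of_forall_le _ _ fun j hj => (natDegree_monomial_le _).trans (by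
    simp at hj; omega)

theorem descPochhammer_two : descPochhammer ℂ 2 = X * (X - 1) := by
  rw [descPochhammer_succ_right, descPochhammer_one]; simp

theorem descPochhammer_three : descPochhammer ℂ 3 = X * (X - 1) * (X - 2) := by
  rw [descPochhammer_succ_right, descPochhammer_two]; simp

theorem descPochhammer_four : descPochhammer ℂ 4 = X * (X - 1) * (X - 2) * (X - 3) := by
  rw [descPochhammer_succ_right, descPochhammer_three]; simp

theorem symb_four_zero (L : ℂ[X][X]) :
    symb 4 L 0 = C ((L.coeff 4).coeff 0) * descPochhammer ℂ 4 := by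
  simp [symb, Finset.sum_range_succ]

theorem symb_four_one (L : ℂ[X][X]) :
    symb 4 L 1 = C ((L.coeff 4).coeff 1) * descPochhammer ℂ 4 +
      C ((L.coeff 3).coeff 0) * descPochhammer ℂ 3 := by
  simp [symb, Finset.sum_range_succ, coeff_X_pow_mul']
  ring

theorem symb_four_two (L : ℂ[X][X]) :
    symb 4 L 2 = C ((L.coeff 4).coeff 2) * descPochhammer ℂ 4 +
      C ((L.coeff 3).coeff 1) * descPochhammer ℂ 3 +
      C ((L.coeff 2).coeff 0) * descPochhammer ℂ 2 := by
  simp [symb, Finset.sum_range_succ, coeff_X_pow_mul']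
  ring

/-- The quartic polynomial with leading coefficient `a` and the given roots. -/
def quartic (a e₁ e₂ e₃ e₄ : ℂ) : ℂ[X] :=
  C a * ((X - C e₁) * (X - C e₂) * (X - C e₃) * (X - C e₄))

theorem quartic_ne_zero {a : ℂ} (ha : a ≠ 0) (e₁ e₂ e₃ e₄ : ℂ) : quartic a e₁ e₂ e₃ e₄ ≠ 0 :=
  mul_ne_zero (C_ne_zero.2 ha) (mul_ne_zero (mul_ne_zero (mul_ne_zero (X_sub_C_ne_zero _)
    (X_sub_C_ne_zero _)) (X_sub_C_ne_zero _)) (X_sub_C_ne_zero _))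

theorem roots_quartic {a : ℂ} (ha : a ≠ 0) (e₁ e₂ e₃ e₄ : ℂ) :
    (quartic a e₁ e₂ e₃ e₄).roots = {e₁, e₂, e₃, e₄} := by
  have h : (X - C e₁) * (X - C e₂) * (X - C e₃) * (X - C e₄) =
      (Multiset.map (fun e => X - C e) {e₁, e₂, e₃, e₄}).prod := by
    simp [mul_assoc]
  rw [quartic, roots_C_mul _ ha, h, roots_multiset_prod_X_sub_C]

theorem natDegree_quartic {a : ℂ} (ha : a ≠ 0) (e₁ e₂ e₃ e₄ : ℂ) :
    (quartic a e₁ e₂ e₃ e₄).natDegree = 4 := by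
  rw [(IsAlgClosed.splits _).natDegree_eq_card_roots, roots_quartic ha]
  rfl

/-- The local exponents of `D7` at a point `p ≠ 0`. -/
theorem isExtreme_symb_D7ord {p : ℂ} (hp : p ≠ 0) :
    ∃ (u e₁ e₂ e₃ : ℕ) (b : ℂ), b ≠ 0 ∧ 0 < e₁ ∧ 0 < e₂ ∧ 0 < e₃ ∧
      IsExtreme (· < ·) (symb 4 (translate p D7ord)) u (quartic b 0 e₁ e₂ e₃) := by
  -- The finite singular points other than zero are `7/36` and the two roots of the quadratic
  -- factor.
  have hl : (eulerCoeff 4).eval p = (7 - 36 * p) ^ 2 * (1 - 1080 * p - 432 * p ^ 2) := by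
    simp [eulerCoeff]
    ring
  have c0 (j : ℕ) : ((translate p D7ord).coeff j).coeff 0 = p ^ j * (eulerCoeff j).eval p := by
    rw [coeff_translate, taylor_coeff_zero, coeff_D7ord, eval_mul, eval_pow, eval_X]
  have c1 (j : ℕ) : ((translate p D7ord).coeff j).coeff 1 =
      j * p ^ (j - 1) * (eulerCoeff j).eval p + p ^ j * (derivative (eulerCoeff j)).eval p := by
    rw [coeff_translate, taylor_coeff_one, coeff_D7ord]
    simp [derivative_X_pow]
  have c2 : 2 * ((translate p D7ord).coeff 4).coeff 2 =
      (derivative (derivative (X ^ 4 * eulerCoeff 4))).eval p := by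
    have h := congrArg (eval p) (congrFun (factorial_smul_hasseDeriv (R := ℂ) 2)
      (X ^ 4 * eulerCoeff 4))
    rw [coeff_translate, taylor_coeff, coeff_D7ord]
    simpa using h
  by_cases h0 : (eulerCoeff 4).eval p = 0
  swap
  -- An ordinary point, with exponents `0, 1, 2, 3`.
  · refine ⟨0, 1, 2, 3, p ^ 4 * (eulerCoeff 4).eval p, mul_ne_zero (pow_ne_zero 4 hp) h0, by simp,
      by simp, by simp, ?_, quartic_ne_zero (mul_ne_zero (pow_ne_zero 4 hp) h0) _ _ _ _, by simp⟩
    rw [symb_four_zero, c0, descPochhammer_four, quartic]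
    refine Polynomial.funext fun x => ?_
    simp
  have hs0 : symb 4 (translate p D7ord) 0 = 0 := by
    rw [symb_four_zero, c0, h0]
    simp
  -- At the double root the exponents are `0, 1, 3, 4`. The constant `-405769/972` is the second
  -- Taylor coefficient of the leading coefficient there.
  by_cases h1 : 7 - 36 * p = 0
  · have hp' : p = 7 / 36 := by linear_combination -h1 / 36
    have hb : (-405769 / 972 : ℂ) ≠ 0 := by norm_num
    have e1 : ((translate p D7ord).coeff 4).coeff 1 = 0 := by
      rw [c1, h0, hp']
      simp [eulerCoeff]
      norm_num
    have e2 : ((translate p D7ord).coeff 3).coeff 0 = 0 := by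
      rw [c0, hp']
      simp [eulerCoeff]
      norm_num
    have e3 : ((translate p D7ord).coeff 4).coeff 2 = -405769 / 972 := by
      apply mul_left_cancel₀ (two_ne_zero (α := ℂ))
      rw [c2, hp']
      simp [eulerCoeff]
      norm_num
    have e4 : ((translate p D7ord).coeff 3).coeff 1 = -2 * (-405769 / 972) := by
      rw [c1, hp']
      simp [eulerCoeff]
      norm_num
    have e5 : ((translate p D7ord).coeff 2).coeff 0 = 2 * (-405769 / 972) := by
      rw [c0, hp']
      simp [eulerCoeff]
      norm_num
    refine ⟨2, 1, 3, 4, _, hb, by simp, by simp, by simp, ?_, quartic_ne_zero hb _ _ _ _,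
      fun i hi => ?_⟩
    · rw [symb_four_two, e3, e4, e5, descPochhammer_four, descPochhammer_three, descPochhammer_two,
        quartic]
      generalize (-405769 / 972 : ℂ) = b
      simp only [map_mul, map_neg, map_ofNat, map_zero, Nat.cast_ofNat, Nat.cast_one, map_one]
      ring
    · have : i = 0 ∨ i = 1 := by simp only at hi; omega
      rcases this with rfl | rfl
      · exact hs0
      · rw [symb_four_one, e1, e2]
        simp
  -- Simple zeros of the leading coefficient, with exponents `0, 1, 1, 2`. The factor `-1080 - 864 *
  -- p` of `b` is the derivative of the quadratic.
  · have h2 : 1 - 1080 * p - 432 * p ^ 2 = 0 := by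
      rw [hl] at h0
      exact (mul_eq_zero.1 h0).resolve_left (pow_ne_zero 2 h1)
    set b := p ^ 4 * ((7 - 36 * p) ^ 2 * (-1080 - 864 * p)) with hb
    have hb0 : b ≠ 0 := by
      refine mul_ne_zero (pow_ne_zero 4 hp) (mul_ne_zero (pow_ne_zero 2 h1) fun h => ?_)
      have hp' : p = -5 / 4 := by linear_combination -h / 864
      rw [hp'] at h2
      norm_num at h2
    have e1 : ((translate p D7ord).coeff 4).coeff 1 = b := by
      rw [c1, h0, hb, mul_zero, zero_add]
      congr 1
      simp [eulerCoeff]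
      linear_combination (-72 * (7 - 36 * p)) * h2
    have e2 : ((translate p D7ord).coeff 3).coeff 0 = 2 * b := by
      rw [c0, hb]
      simp [eulerCoeff]
      linear_combination p ^ 3 * (-98 + 2520 * p - 10368 * p ^ 2 + 8 * (7 - 36 * p) ^ 2 - 144 * p * (7 - 36 * p)) * h2
    refine ⟨1, 1, 1, 2, b, hb0, by simp, by simp, by simp, ?_, quartic_ne_zero hb0 _ _ _ _,
      fun i hi => ?_⟩
    · rw [symb_four_one, e1, e2, descPochhammer_four, descPochhammer_three, quartic]
      simp only [map_mul, map_ofNat, map_zero, Nat.cast_ofNat, Nat.cast_one, map_one]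
      ring
    · have : i = 0 := by simp only at hi; omega
      rw [this, hs0]

/-- At zero all exponents vanish. The position is `4` because every term of the symbol carries `X ^
4`; for the same reason it is `4 + 4` at infinity. -/
theorem isExtreme_symb_D7ord_zero :
    IsExtreme (· < ·) (symb 4 (translate 0 D7ord)) 4 (quartic 49 0 0 0 0) := by
  have h : translate 0 D7ord = D7ord := by
    ext1 j
    rw [coeff_translate, taylor_zero]
  rw [h]
  have hc (i : ℕ) : symb 4 D7ord i =
      ∑ j ∈ range 5, C ((X ^ 4 * eulerCoeff j).coeff i) * descPochhammer ℂ j := by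
    refine Finset.sum_congr rfl fun j hj => ?_
    rw [coeff_D7ord, ← mul_assoc, ← pow_add, Nat.sub_add_cancel]
    simpa [Nat.lt_succ_iff] using hj
  refine ⟨?_, quartic_ne_zero (by norm_num) _ _ _ _, fun i hi => ?_⟩
  · rw [hc, quartic]
    simp only [coeff_X_pow_mul', Finset.sum_range_succ, descPochhammer_four, descPochhammer_three, descPochhammer_two]
    refine Polynomial.funext fun x => ?_
    simp [eulerCoeff, coeff_X, coeff_C]
    ring
  · rw [hc]
    refine Finset.sum_eq_zero fun j _ => ?_
    rw [coeff_X_pow_mul', if_neg (by simp only at hi; omega)]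
    simp

theorem isExtreme_symb_D7ord_infinity :
    IsExtreme (· > ·) (symb 4 D7ord) 8 (quartic (-559872) (-1 / 2) (-1 / 2) (-1 / 3) (-2 / 3)) := by
  have hc (i : ℕ) : symb 4 D7ord i =
      ∑ j ∈ range 5, C ((X ^ 4 * eulerCoeff j).coeff i) * descPochhammer ℂ j := by
    refine Finset.sum_congr rfl fun j hj => ?_
    rw [coeff_D7ord, ← mul_assoc, ← pow_add, Nat.sub_add_cancel]
    simpa [Nat.lt_succ_iff] using hj
  refine ⟨?_, quartic_ne_zero (by norm_num) _ _ _ _, fun i hi => ?_⟩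
  · rw [hc, quartic]
    simp only [coeff_X_pow_mul', Finset.sum_range_succ, descPochhammer_four, descPochhammer_three, descPochhammer_two]
    refine Polynomial.funext fun x => ?_
    simp [eulerCoeff]
    ring
  · rw [hc]
    refine Finset.sum_eq_zero fun j hj => ?_
    have hd : (eulerCoeff j).natDegree ≤ 4 := by
      simp only [mem_range] at hj
      interval_cases j <;> simp only [eulerCoeff] <;> compute_degree
    rw [coeff_eq_zero_of_natDegree_lt (lt_of_le_of_lt natDegree_mul_le _), C_0, zero_mul]
    rw [natDegree_X_pow]
    simp only at hi
    omega

end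

/-! ### Minimality: no annihilator of order less than four -/

noncomputable section

open Polynomial Finset

theorem act_zero {V : Type*} [AddCommGroup V] [Module ℂ[X] V] (D : V →+ V) (L : ℂ[X][X]) :
    act D 0 L = 0 := by
  rw [act_eq_sum_range _ _ L le_rfl]
  exact Finset.sum_eq_zero fun j _ => by rw [iterate_map_zero, smul_zero]

theorem smul_powerSeries (q : ℂ[X]) (f : PowerSeries ℂ) : q • f = (q : PowerSeries ℂ) * f := by
  rw [Algebra.smul_def, PowerSeries.algebraMap_apply', Algebra.algebraMap_self, PowerSeries.map_id]
  rfl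

theorem derivative_smul_powerSeries (q : ℂ[X]) (f : PowerSeries ℂ) :
    PowerSeries.derivative ℂ (q • f) = derivative q • f + q • PowerSeries.derivative ℂ f := by
  rw [smul_powerSeries, smul_powerSeries, smul_powerSeries, Derivation.leibniz,
    PowerSeries.derivative_coe, smul_eq_mul, smul_eq_mul]
  ring

/-- The derivative of formal power series, as an additive map. -/
def derivPS : PowerSeries ℂ →+ PowerSeries ℂ := (PowerSeries.derivative ℂ).toLinearMap.toAddMonoidHom

/-- The exponent zero occurs only once, so two or more exponents have a positive sum. This excludes
right factors of order two. -/
theorem sum_exponents_ne_zero {e₁ e₂ e₃ : ℕ} (h₁ : 0 < e₁) (h₂ : 0 < e₂) (h₃ : 0 < e₃)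
    {E : Multiset ℂ} (hE : E ≤ {(0 : ℂ), (e₁ : ℂ), (e₂ : ℂ), (e₃ : ℂ)}) :
    ∃ n : ℕ, E.sum = n ∧ (2 ≤ E.card → 1 ≤ n) := by
  have : CanLift ℂ ℕ Nat.cast (fun x => ∃ n : ℕ, (n : ℂ) = x) := ⟨fun _ h => h⟩
  lift E to Multiset ℕ using fun x hx => by
    have := Multiset.mem_of_le hE hx
    simp only [Multiset.insert_eq_cons, Multiset.mem_cons, Multiset.mem_singleton] at this
    rcases this with rfl | rfl | rfl | rfl
    exacts [⟨0, by simp⟩, ⟨e₁, rfl⟩, ⟨e₂, rfl⟩, ⟨e₃, rfl⟩]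
  have hE' : E ≤ {0, e₁, e₂, e₃} := by
    rw [← Multiset.map_le_map_iff (f := (Nat.cast : ℕ → ℂ)) Nat.cast_injective]
    simpa using hE
  refine ⟨E.sum, by simp, fun hc => Nat.one_le_iff_ne_zero.2 fun h0 => ?_⟩
  have h0' : E = Multiset.replicate E.card 0 :=
    Multiset.eq_replicate.2 ⟨rfl, fun x hx => Multiset.sum_eq_zero_iff.1 h0 x hx⟩
  have h1 := Multiset.count_le_of_le 0 hE'
  rw [h0', Multiset.count_replicate_self] at h1
  simp [h₁.ne, h₂.ne, h₃.ne] at h1 hc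
  omega

theorem not_intCast_of_mem {T : Multiset ℂ}
    (hT : ∀ x ∈ T, x = -1 / 2 ∨ x = -1 / 3 ∨ x = -2 / 3) {a : ℂ} (ha : a ∈ T) (z : ℤ) :
    a ≠ z := by
  intro h
  rcases hT a ha with rfl | rfl | rfl
  · have : ((-1 : ℤ) : ℂ) = ((2 * z : ℤ) : ℂ) := by push_cast; linear_combination 2 * h
    have := Int.cast_injective this
    omega
  · have : ((-1 : ℤ) : ℂ) = ((3 * z : ℤ) : ℂ) := by push_cast; linear_combination 3 * h
    have := Int.cast_injective this
    omega
  · have : ((-2 : ℤ) : ℂ) = ((3 * z : ℤ) : ℂ) := by push_cast; linear_combination 3 * h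
    have := Int.cast_injective this
    omega

/-- A nonzero power series that is annihilated by `D7` is annihilated by no nonzero operator of
order less than four. -/
theorem four_le_natDegree {F : PowerSeries ℂ} (hF : F ≠ 0) (hL : act derivPS F D7ord = 0)
    {M : ℂ[X][X]} (hM : M ≠ 0) (hMF : act derivPS F M = 0) : 4 ≤ M.natDegree := by
  by_contra! hlt
  induction hn : M.natDegree using Nat.strong_induction_on generalizing M with
  | h m ih =>
  subst hn
  -- Order zero: a nonzero polynomial cannot annihilate a nonzero element of the domain of power
  -- series.
  by_cases h0 : M.natDegree = 0
  · rw [eq_C_of_natDegree_eq_zero h0, act_C, smul_powerSeries] at hMF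
    have hq : M.coeff 0 = 0 := by
      have := (mul_eq_zero.1 hMF).resolve_right hF
      exact_mod_cast this
    rw [eq_C_of_natDegree_eq_zero h0, hq, C_0] at hM
    exact hM rfl
  obtain ⟨N, hN⟩ := Nat.exists_eq_succ_of_ne_zero h0
  rw [Nat.succ_eq_add_one] at hN
  -- The same `c, Q, R` work in every differential module. On power series they show that `R`
  -- annihilates `F`, so `R = 0` by induction; on polynomials they then give the factorization
  -- needed for the symbols.
  obtain ⟨c, Q, R, hc, hR, hQ, hact⟩ := exists_act_division hM D7ord
  have hR0 : R = 0 := by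
    by_contra hR0
    have hdeg := natDegree_lt_natDegree hR0 hR
    refine ih _ hdeg hR0 ?_ (by omega) rfl
    have := hact _ derivPS derivative_smul_powerSeries F
    rwa [hL, hMF, act_zero, smul_zero, zero_add, eq_comm] at this
  have hcomp : ∀ f : ℂ[X], c * act derivative f D7ord =
      act derivative (act derivative f M) Q := by
    intro f
    have := hact ℂ[X] (derivative (R := ℂ)).toAddMonoidHom
      (fun q f => by simp [derivative_mul]) f
    rw [hR0, map_zero, add_zero] at this
    exact this
  obtain ⟨q, hq⟩ : ∃ q, q + (N + 1) = 4 := ⟨3 - N, by omega⟩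
  have hQ' : Q.natDegree ≤ q := hQ.trans (by have := natDegree_D7ord_le; omega)
  have htc (p : ℂ) : taylor p c ≠ 0 := by rwa [Ne, taylor_eq_zero]
  have hlead (p : ℂ) : (translate p M).leadingCoeff = taylor p M.leadingCoeff := by
    rw [leadingCoeff, natDegree_translate, coeff_translate, leadingCoeff]
  have hex : ∀ (p : ℂ) (u : ℕ) (P : ℂ[X]), IsExtreme (· < ·) (symb 4 (translate p D7ord)) u P →
      P.natDegree = 4 → ∃ (v : ℕ) (E : Multiset ℂ), E ≤ P.roots ∧ E.card = N + 1 ∧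
      (taylor p M.leadingCoeff).coeff v ≠ 0 ∧
      (X * taylor p (M.coeff N)).coeff v =
        ((N : ℂ) * (N + 1) / 2 - E.sum) * (taylor p M.leadingCoeff).coeff v ∧
      ∀ i < v, (taylor p M.leadingCoeff).coeff i = 0 ∧ (X * taylor p (M.coeff N)).coeff i = 0 := by
    intro p u P hP hdeg
    have := exists_exponents (Or.inl rfl) (htc p) (L := translate p D7ord) (Q := translate p Q)
      (M := translate p M) (q := q) (N := N) (by rwa [natDegree_translate])
      (by rw [natDegree_translate, hN])
      (by rw [natDegree_translate, hq]; exact natDegree_D7ord_le) (act_translate_comp hcomp p)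
      (hq.symm ▸ hP) (hq.symm ▸ hdeg)
    rwa [hlead, coeff_translate] at this
  -- At infinity `v` is the degree of the leading coefficient, and the formula for the coefficient
  -- at `v` gives the sum of all finite residues.
  obtain ⟨v, E, hE, hEc, hv, hEs, hhigh⟩ := exists_exponents (Or.inr rfl) hc hQ' hN
    (hq.symm ▸ natDegree_D7ord_le) hcomp (hq.symm ▸ isExtreme_symb_D7ord_infinity)
    (by rw [hq, natDegree_quartic (by norm_num)])
  rw [roots_quartic (by norm_num)] at hE
  have hvdeg : v = M.leadingCoeff.natDegree := by
    refine le_antisymm (le_natDegree_of_ne_zero hv) (natDegree_le_iff_coeff_eq_zero.2 fun i hi => ?_)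
    exact (hhigh i hi).1
  have hXg : (X * M.coeff N).natDegree ≤ M.leadingCoeff.natDegree :=
    hvdeg ▸ natDegree_le_iff_coeff_eq_zero.2 fun i hi => (hhigh i hi).2
  -- All finite residues are integers `N(N + 1)/2 - ∑ E`. At zero `∑ E = 0`; elsewhere, for `N = 1`,
  -- `∑ E ≥ 1` makes them nonpositive.
  have hloc : ∀ p : ℂ, ∃ (z : ℤ) (v : ℕ), (p = 0 → 2 * z = N * (N + 1)) ∧
      (p ≠ 0 → N = 1 → z ≤ 0) ∧ (taylor p M.leadingCoeff).coeff v ≠ 0 ∧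
      (X * taylor p (M.coeff N)).coeff v = z * (taylor p M.leadingCoeff).coeff v ∧
      ∀ i < v, (taylor p M.leadingCoeff).coeff i = 0 ∧ (X * taylor p (M.coeff N)).coeff i = 0 := by
    intro p
    obtain ⟨T, hT⟩ : ∃ T : ℤ, 2 * T = N * (N + 1) := by
      obtain ⟨T, hT⟩ := Int.even_mul_succ_self (N : ℤ)
      exact ⟨T, by rw [two_mul]; exact hT.symm⟩
    have hT' : (N : ℂ) * (N + 1) / 2 = T := by
      have : (2 : ℂ) * T = N * (N + 1) := mod_cast hT
      linear_combination -this / 2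
    by_cases hp : p = 0
    · subst hp
      obtain ⟨v, E, hE, -, h1, h2, h3⟩ := hex 0 _ _ isExtreme_symb_D7ord_zero
        (natDegree_quartic (by norm_num) _ _ _ _)
      rw [roots_quartic (by norm_num)] at hE
      have hs : E.sum = 0 := Multiset.sum_eq_zero fun x hx => by
        simpa using Multiset.mem_of_le hE hx
      refine ⟨T, v, fun _ => hT, fun h => absurd rfl h, h1, ?_, h3⟩
      rw [h2, hs, hT', sub_zero]
    · obtain ⟨u, e₁, e₂, e₃, b, hb, p₁, p₂, p₃, hP⟩ := isExtreme_symb_D7ord hp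
      obtain ⟨v, E, hE, hEc, h1, h2, h3⟩ := hex p _ _ hP (natDegree_quartic hb _ _ _ _)
      rw [roots_quartic hb] at hE
      obtain ⟨n, hn, hn1⟩ := sum_exponents_ne_zero p₁ p₂ p₃ hE
      refine ⟨T - n, v, fun h => absurd h hp, fun _ h => ?_, h1, ?_, h3⟩
      · subst h
        have := hn1 hEc.ge
        push_cast at hT
        omega
      · rw [h2, hn, hT']
        push_cast
        rfl
  choose z w hz0 hz1 hρ using hloc
  have hf : M.leadingCoeff ≠ 0 := leadingCoeff_ne_zero.2 hM
  -- Zero is included among the points even if it is no pole, so that its residue can be split off.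
  have hres := sum_residues_eq hf hXg (S := insert 0 M.leadingCoeff.roots.toFinset)
    (Finset.insert_nonempty _ _) (fun p hp => by simp [hf, hp.eq_zero]) (ρ := fun p => z p)
    fun p _ => ⟨w p, hρ p⟩
  rw [← hvdeg, hEs, hvdeg] at hres
  have hsum := mul_right_cancel₀ (leadingCoeff_ne_zero.2 hf) hres
  rw [← Finset.insert_erase (Finset.mem_insert_self (0 : ℂ) _),
    Finset.sum_insert (Finset.notMem_erase _ _)] at hsum
  set S := (insert 0 M.leadingCoeff.roots.toFinset).erase (0 : ℂ) with hS
  have hz00 : (2 : ℂ) * z 0 = N * (N + 1) := mod_cast hz0 0 rfl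
  -- Fuchs' relation: the residue at zero cancels the term `N(N + 1)/2` from infinity.
  have hkey : -E.sum = ((∑ p ∈ S, z p : ℤ) : ℂ) := by
    push_cast
    linear_combination hsum + hz00 / 2
  have hneg : N = 1 → ∑ p ∈ S, z p ≤ 0 := fun h =>
    Finset.sum_nonpos fun p hp => hz1 p (Finset.ne_of_mem_erase hp) h
  generalize ∑ p ∈ S, z p = Z at hkey hneg
  have hmem : ∀ x ∈ ({-1 / 2, -1 / 2, -1 / 3, -2 / 3} : Multiset ℂ),
      x = -1 / 2 ∨ x = -1 / 3 ∨ x = -2 / 3 := by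
    intro x hx
    simp only [Multiset.insert_eq_cons, Multiset.mem_cons, Multiset.mem_singleton] at hx
    tauto
  have hN3 : N = 0 ∨ N = 1 ∨ N = 2 := by omega
  -- Order one: a single root at infinity is not an integer. Order two: minus the sum of two of them
  -- is positive. Order three: all four add up to `-2`, so the omitted root would be an integer.
  rcases hN3 with rfl | rfl | rfl
  · obtain ⟨a, rfl⟩ := Multiset.card_eq_one.1 hEc
    rw [Multiset.sum_singleton] at hkey
    exact not_intCast_of_mem hmem (Multiset.mem_of_le hE (Multiset.mem_singleton_self a)) (-Z)
      (by push_cast; linear_combination -hkey)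
  · obtain ⟨a, b, rfl⟩ := Multiset.card_eq_two.1 hEc
    have ha := hmem a (Multiset.mem_of_le hE (by simp))
    have hb := hmem b (Multiset.mem_of_le hE (by simp))
    have hZ : (Z : ℝ) ≤ 0 := by exact_mod_cast hneg rfl
    rw [Multiset.insert_eq_cons, Multiset.sum_cons, Multiset.sum_singleton] at hkey
    have hre := congrArg Complex.re hkey
    rcases ha with rfl | rfl | rfl <;> rcases hb with rfl | rfl | rfl <;> norm_num at hre <;>
      linarith
  · obtain ⟨T, hT⟩ := Multiset.le_iff_exists_add.1 hE
    have hTc := congrArg Multiset.card hT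
    rw [Multiset.card_add, hEc] at hTc
    simp only [Multiset.insert_eq_cons, Multiset.card_cons, Multiset.card_singleton] at hTc
    obtain ⟨a, rfl⟩ := Multiset.card_eq_one.1 (show T.card = 1 by omega)
    have hs := congrArg Multiset.sum hT
    simp only [Multiset.insert_eq_cons, Multiset.sum_cons, Multiset.sum_singleton,
      Multiset.sum_add] at hs
    refine not_intCast_of_mem hmem (a := a) (hT ▸ by simp) (Z - 2) ?_
    push_cast
    linear_combination hkey - hs

end

/-! ### From germs of analytic functions to formal power series -/

noncomputable section

open Polynomial Finset

/-- The formal power series `A` converges to `f` near `0`. -/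
def ConvergesTo (A : PowerSeries ℂ) (f : ℂ → ℂ) : Prop :=
  ∀ᶠ z in 𝓝 (0 : ℂ), HasSum (fun n => PowerSeries.coeff n A * z ^ n) (f z)

theorem convergesTo_iff {A : PowerSeries ℂ} {f : ℂ → ℂ} : ConvergesTo A f ↔
    HasFPowerSeriesAt f
      (FormalMultilinearSeries.ofScalars ℂ (fun n => PowerSeries.coeff n A)) 0 := by
  rw [hasFPowerSeriesAt_iff, ConvergesTo]
  simp [FormalMultilinearSeries.coeff_ofScalars, mul_comm]

theorem ConvergesTo.add {A B : PowerSeries ℂ} {f g : ℂ → ℂ} (hf : ConvergesTo A f)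
    (hg : ConvergesTo B g) : ConvergesTo (A + B) (fun z => f z + g z) := by
  filter_upwards [hf, hg] with z h1 h2
  simpa [add_mul] using h1.add h2

theorem ConvergesTo.const_mul {A : PowerSeries ℂ} {f : ℂ → ℂ} (hf : ConvergesTo A f) (c : ℂ) :
    ConvergesTo (PowerSeries.C c * A) (fun z => c * f z) := by
  filter_upwards [hf] with z h1
  simpa [mul_assoc] using h1.mul_left c

theorem ConvergesTo.X_mul {A : PowerSeries ℂ} {f : ℂ → ℂ} (hf : ConvergesTo A f) :
    ConvergesTo (PowerSeries.X * A) (fun z => z * f z) := by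
  filter_upwards [hf] with z h1
  rw [← hasSum_nat_add_iff' 1]
  simp only [PowerSeries.coeff_succ_X_mul, Finset.range_one, Finset.sum_singleton,
    PowerSeries.coeff_zero_X_mul, zero_mul, sub_zero]
  have h2 : (fun n => PowerSeries.coeff n A * z ^ (n + 1)) =
      fun n => z * (PowerSeries.coeff n A * z ^ n) := by
    ext n
    ring
  rw [h2]
  exact h1.mul_left z

theorem convergesTo_zero : ConvergesTo 0 (fun _ => 0) :=
  Eventually.of_forall fun z => by simp

theorem ConvergesTo.sum {ι : Type*} (s : Finset ι) {A : ι → PowerSeries ℂ} {f : ι → ℂ → ℂ}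
    (h : ∀ i ∈ s, ConvergesTo (A i) (f i)) :
    ConvergesTo (∑ i ∈ s, A i) (fun z => ∑ i ∈ s, f i z) := by
  classical
  induction s using Finset.induction_on with
  | empty => simpa using convergesTo_zero
  | insert a s ha ih =>
    simp only [Finset.sum_insert ha]
    exact (h a (by simp)).add (ih fun i hi => h i (by simp [hi]))

theorem ConvergesTo.polynomial_mul {A : PowerSeries ℂ} {f : ℂ → ℂ} (hf : ConvergesTo A f)
    (q : ℂ[X]) : ConvergesTo (q • A) (fun z => q.eval z * f z) := by
  have hp : ∀ n : ℕ, ConvergesTo (PowerSeries.X ^ n * A) (fun z => z ^ n * f z) := by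
    intro n
    induction n with
    | zero => simpa using hf
    | succ n ih =>
      convert ih.X_mul using 1
      · ring
      · ext z; ring
  have := ConvergesTo.sum (range (q.natDegree + 1)) fun n _ => (hp n).const_mul (q.coeff n)
  convert this using 1
  · rw [smul_powerSeries]
    conv_lhs => rw [q.as_sum_range_C_mul_X_pow]
    rw [← Polynomial.coeToPowerSeries.ringHom_apply, map_sum, Finset.sum_mul]
    simp [mul_assoc]
  · ext z
    rw [Polynomial.eval_eq_sum_range, Finset.sum_mul]
    simp [mul_assoc]

theorem ConvergesTo.deriv {A : PowerSeries ℂ} {f : ℂ → ℂ} (hf : ConvergesTo A f) :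
    ConvergesTo (derivPS A) (deriv f) := by
  obtain ⟨r, hr⟩ := convergesTo_iff.1 hf
  have h1 := (ContinuousLinearMap.apply ℂ ℂ (1 : ℂ)).comp_hasFPowerSeriesOnBall hr.fderiv
  have h2 := hasFPowerSeriesAt_iff.1 ⟨r, h1⟩
  filter_upwards [h2] with z hz
  rw [zero_add] at hz
  refine (congrArg (fun g => HasSum g (_root_.deriv f z)) (funext fun n => ?_)).mpr hz
  rw [smul_eq_mul, mul_comm]
  congr 1
  have := FormalMultilinearSeries.derivSeries_coeff_one
    (FormalMultilinearSeries.ofScalars ℂ (fun n => PowerSeries.coeff n A)) n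
  rw [FormalMultilinearSeries.coeff_ofScalars] at this
  have h3 : PowerSeries.coeff n (derivPS A) = PowerSeries.coeff (n + 1) A * (n + 1) :=
    PowerSeries.coeff_derivative A n
  rw [h3]
  refine Eq.trans ?_ this.symm
  simp [mul_comm]

/-- The Euler operator `x d/dx` on formal power series. -/
def eulerPS (A : PowerSeries ℂ) : PowerSeries ℂ := PowerSeries.X * derivPS A

theorem ConvergesTo.euler {A : PowerSeries ℂ} {f : ℂ → ℂ} (hf : ConvergesTo A f) :
    ConvergesTo (eulerPS A) (euler f) := hf.deriv.X_mul

theorem ConvergesTo.iterate_euler {A : PowerSeries ℂ} {f : ℂ → ℂ} (hf : ConvergesTo A f) (j : ℕ) :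
    ConvergesTo (eulerPS^[j] A) (PfaffianMirror.euler^[j] f) := by
  induction j with
  | zero => exact hf
  | succ j ih =>
    rw [Function.iterate_succ_apply', Function.iterate_succ_apply']
    exact ih.euler

theorem ConvergesTo.applyOp {A : PowerSeries ℂ} {f : ℂ → ℂ} (hf : ConvergesTo A f) (L : ℂ[X][X]) :
    ConvergesTo (act eulerPS A L) (applyOp L f) :=
  ConvergesTo.sum L.support fun j _ => (hf.iterate_euler j).polynomial_mul (L.coeff j)

/-- Uniqueness of power series; it turns annihilation of a germ, both for `D7` and for a competing
operator, into a formal statement. -/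
theorem ConvergesTo.eventually_eq_zero_iff {A : PowerSeries ℂ} {f : ℂ → ℂ}
    (hf : ConvergesTo A f) : (∀ᶠ z in 𝓝 (0 : ℂ), f z = 0) ↔ A = 0 := by
  constructor
  · intro h
    have h1 := (convergesTo_iff.1 hf).eq_zero_of_eventually h
    ext n
    have h2 := congrArg (fun p => p.coeff n) h1
    simp only [FormalMultilinearSeries.coeff_ofScalars] at h2
    exact h2.trans (by simp [FormalMultilinearSeries.coeff])
  · rintro rfl
    filter_upwards [hf] with z hz
    simp only [map_zero, zero_mul] at hz
    exact hz.unique hasSum_zero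

theorem eulerPS_smul (q : ℂ[X]) (A : PowerSeries ℂ) :
    eulerPS (q • A) = (X * derivative q) • A + q • eulerPS A := by
  have : derivPS (q • A) = derivative q • A + q • derivPS A := derivative_smul_powerSeries q A
  rw [eulerPS, this]
  simp only [smul_powerSeries, eulerPS]
  push_cast
  ring

/-- The operator `(x d/dx)^j`, written in `d/dx`. -/
def eulerPow (j : ℕ) : ℂ[X][X] := (fun T => C X * derivMul T)^[j] 1

theorem act_eulerPow (A : PowerSeries ℂ) (j : ℕ) : act derivPS A (eulerPow j) = eulerPS^[j] A := by
  induction j with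
  | zero =>
    rw [eulerPow, Function.iterate_zero_apply, ← C_1, act_C, one_smul]
    rfl
  | succ j ih =>
    rw [eulerPow, Function.iterate_succ_apply', ← eulerPow, act_C_mul,
      act_derivMul derivPS derivative_smul_powerSeries, ih, Function.iterate_succ_apply', eulerPS,
      smul_powerSeries, Polynomial.coe_X]

theorem eulerPow_spec (j : ℕ) : (eulerPow j).natDegree ≤ j ∧ (eulerPow j).coeff j = X ^ j := by
  induction j with
  | zero => simp [eulerPow]
  | succ j ih =>
    have hne : eulerPow j ≠ 0 := fun h => by
      rw [h, coeff_zero] at ih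
      exact pow_ne_zero j X_ne_zero ih.2.symm
    have hdeg : (eulerPow j).natDegree = j := le_antisymm ih.1
      (le_natDegree_of_ne_zero (by rw [ih.2]; exact pow_ne_zero j X_ne_zero))
    rw [eulerPow, Function.iterate_succ_apply', ← eulerPow]
    refine ⟨(natDegree_C_mul_le _ _).trans ((natDegree_derivMul_le _).trans (by omega)), ?_⟩
    have := coeff_derivMul_natDegree (eulerPow j)
    rw [hdeg] at this
    rw [coeff_C_mul, this, leadingCoeff, hdeg, ih.2]
    ring

/-- An operator in `x d/dx` can be written in `d/dx`, with the same order. -/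
theorem exists_act_derivPS_eq {L : ℂ[X][X]} (hL : L ≠ 0) :
    ∃ L' : ℂ[X][X], L' ≠ 0 ∧ L'.natDegree ≤ L.natDegree ∧
      ∀ A, act derivPS A L' = act eulerPS A L := by
  set L' := ∑ j ∈ range (L.natDegree + 1), C (L.coeff j) * eulerPow j with hL'
  refine ⟨L', fun h0 => ?_, ?_, fun A => ?_⟩
  · have h1 : L'.coeff L.natDegree = L.leadingCoeff * X ^ L.natDegree := by
      rw [hL', finsetSum_coeff, Finset.sum_range_succ, Finset.sum_eq_zero, coeff_C_mul,
        (eulerPow_spec _).2, zero_add]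
      · rfl
      · intro j hj
        rw [coeff_C_mul, coeff_eq_zero_of_natDegree_lt (p := eulerPow j), mul_zero]
        exact lt_of_le_of_lt (eulerPow_spec j).1 (by simpa using hj)
    rw [h0, coeff_zero] at h1
    exact mul_ne_zero (leadingCoeff_ne_zero.2 hL) (pow_ne_zero _ X_ne_zero) h1.symm
  · refine natDegree_sum_le_of_forall_le _ _ fun j hj => (natDegree_C_mul_le _ _).trans
      ((eulerPow_spec j).1.trans ?_)
    simpa [Nat.lt_succ_iff] using hj
  · rw [act_eq_sum_range eulerPS A L le_rfl, hL', map_sum]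
    refine Finset.sum_congr rfl fun j _ => ?_
    rw [act_C_mul, act_eulerPow]

end

/-! ### `D7` annihilates the generating series -/

noncomputable section

open Polynomial Finset

/-- The generating series of the period coefficients. -/
def periodSeries : PowerSeries ℂ := PowerSeries.mk fun n => (periodCoeff n : ℂ)

theorem periodSeries_ne_zero : periodSeries ≠ 0 := fun h => by
  have := congrArg (PowerSeries.coeff 0) h
  simp [periodSeries, periodCoeff, innerSum, innerTerm] at this

theorem coeff_iterate_eulerPS (A : PowerSeries ℂ) (j n : ℕ) :
    PowerSeries.coeff n (eulerPS^[j] A) = (n : ℂ) ^ j * PowerSeries.coeff n A := by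
  induction j with
  | zero => simp
  | succ j ih =>
    rw [Function.iterate_succ_apply', eulerPS]
    rcases n with _ | n
    · simp
    · have h3 : PowerSeries.coeff n (derivPS (eulerPS^[j] A)) =
        PowerSeries.coeff (n + 1) (eulerPS^[j] A) * (n + 1) := PowerSeries.coeff_derivative _ n
      rw [PowerSeries.coeff_succ_X_mul, h3, ih]
      push_cast
      ring

/-- The coefficients of `Θ^j` in `D7`. -/
def D7coeff : ℕ → ℂ[X]
  | 0 => C (-2352) * X + C (-40320) * X ^ 2 + C 6048 * X ^ 3 + C (-31104) * X ^ 4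
  | 1 => C (-22050) * X + C (-247296) * X ^ 2 + C 154224 * X ^ 3 + C (-264384) * X ^ 4
  | 2 => C (-74718) * X + C (-309084) * X ^ 2 + C 722304 * X ^ 3 + C (-824256) * X ^ 4
  | 3 => C (-105336) * X + C 457056 * X ^ 2 + C 653184 * X ^ 3 + C (-1119744) * X ^ 4
  | 4 => C 49 + C (-53424) * X + C 524448 * X ^ 2 + C (-1181952) * X ^ 3 + C (-559872) * X ^ 4
  | _ => 0

theorem D7_eq_sum : D7 = ∑ j ∈ range 5, C (D7coeff j) * X ^ j := by
  simp only [D7, D7coeff, Finset.sum_range_succ, Finset.sum_range_zero]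
  simp only [map_add, map_mul, map_pow, map_neg, map_ofNat]
  ring

theorem coeff_D7 (j : ℕ) : D7.coeff j = D7coeff j := by
  rw [D7_eq_sum, finsetSum_coeff]
  simp only [coeff_C_mul_X_pow]
  rw [Finset.sum_ite_eq (range 5) j]
  split_ifs with h
  · rfl
  · have : 5 ≤ j := by simpa using h
    obtain ⟨k, rfl⟩ := Nat.exists_eq_add_of_le' this
    rfl

theorem natDegree_D7 : D7.natDegree = 4 := by
  refine le_antisymm ?_ (le_natDegree_of_ne_zero fun h => ?_)
  · rw [D7_eq_sum]
    refine natDegree_sum_le_of_forall_le _ _ fun j hj => (natDegree_C_mul_X_pow_le _ _).trans ?_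
    simp at hj
    omega
  · rw [coeff_D7] at h
    have := congrArg (eval 0) h
    simp [D7coeff] at this

theorem act_eulerPS_D7 (A : PowerSeries ℂ) :
    act eulerPS A D7 = ∑ j ∈ range 5, (D7coeff j : PowerSeries ℂ) * eulerPS^[j] A := by
  rw [act_eq_sum_range _ _ _ natDegree_D7.le]
  simp only [coeff_D7, smul_powerSeries]

theorem X_pow_succ_mul_derivPS (j : ℕ) (B : PowerSeries ℂ) :
    PowerSeries.X ^ (j + 1) * derivPS B =
      eulerPS (PowerSeries.X ^ j * B) - (j : PowerSeries ℂ) * (PowerSeries.X ^ j * B) := by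
  have h := eulerPS_smul (X ^ j) B
  simp only [smul_powerSeries, derivative_X_pow] at h
  push_cast at h
  rw [h, eulerPS]
  rcases j with _ | j
  · simp
  · rw [Nat.add_sub_cancel, map_natCast]
    push_cast
    ring

/-- From `x^(j+1) D^(j+1) = (Θ - j) x^j D^j` one gets `x^j D^j = Θ (Θ - 1) ⋯ (Θ - j + 1)`, and the
coefficients of both forms are compared. -/
theorem act_derivPS_D7ord (A : PowerSeries ℂ) : act derivPS A D7ord = act eulerPS A D7 := by
  have hsub : ∀ B B', eulerPS (B - B') = eulerPS B - eulerPS B' := fun B B' => by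
    rw [eulerPS, map_sub, mul_sub]; rfl
  have hnat : ∀ (k : ℕ) B, eulerPS ((k : PowerSeries ℂ) * B) = k * eulerPS B := fun k B => by
    rw [← nsmul_eq_mul, eulerPS, map_nsmul, nsmul_eq_mul, eulerPS]; ring
  have hstep : ∀ j, PowerSeries.X ^ (j + 1) * derivPS^[j + 1] A =
      eulerPS (PowerSeries.X ^ j * derivPS^[j] A) - (j : PowerSeries ℂ) *
        (PowerSeries.X ^ j * derivPS^[j] A) := fun j => by
    rw [Function.iterate_succ_apply', X_pow_succ_mul_derivPS]
  have e0 : PowerSeries.X ^ 0 * derivPS^[0] A = A := by simp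
  have e1 := hstep 0
  rw [e0] at e1
  have e2 := hstep 1
  rw [e1] at e2
  have e3 := hstep 2
  rw [e2] at e3
  have e4 := hstep 3
  rw [e3] at e4
  simp only [hsub, hnat, Nat.reduceAdd, zero_add] at e1 e2 e3 e4
  rw [act_eulerPS_D7, act_eq_sum_range _ _ _ natDegree_D7ord_le]
  simp only [coeff_D7ord, smul_powerSeries, Finset.sum_range_succ, Finset.sum_range_zero]
  have hmul : ∀ j (q : ℂ[X]), ((X ^ j * q : ℂ[X]) : PowerSeries ℂ) * derivPS^[j] A =
      (q : PowerSeries ℂ) * (PowerSeries.X ^ j * derivPS^[j] A) := fun j q => by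
    push_cast
    ring
  simp only [hmul, e0, e1, e2, e3, e4]
  simp only [Function.iterate_succ_apply', Function.iterate_zero_apply]
  generalize eulerPS (eulerPS (eulerPS (eulerPS A))) = y4
  generalize eulerPS (eulerPS (eulerPS A)) = y3
  generalize eulerPS (eulerPS A) = y2
  generalize eulerPS A = y1
  simp only [eulerCoeff, D7coeff]
  push_cast
  simp only [map_neg, map_ofNat]
  ring

theorem act_eulerPS_periodSeries : act eulerPS periodSeries D7 = 0 := by
  rw [act_eulerPS_D7]
  ext n
  have hc : ∀ (c : ℂ) (k : ℕ) (B : PowerSeries ℂ),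
      PowerSeries.coeff n (((C c * X ^ k : ℂ[X]) : PowerSeries ℂ) * B) =
        if k ≤ n then c * PowerSeries.coeff (n - k) B else 0 := by
    intro c k B
    push_cast
    rw [mul_assoc, PowerSeries.coeff_C_mul, PowerSeries.coeff_X_pow_mul']
    split_ifs <;> simp
  have h0 : ∀ (c : ℂ) (B : PowerSeries ℂ),
      PowerSeries.coeff n (((C c : ℂ[X]) : PowerSeries ℂ) * B) = c * PowerSeries.coeff n B := by
    intro c B
    simpa only [pow_zero, mul_one, Nat.zero_le, if_true, Nat.sub_zero] using hc c 0 B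
  have h1 : ∀ (c : ℂ) (B : PowerSeries ℂ),
      PowerSeries.coeff n (((C c * X : ℂ[X]) : PowerSeries ℂ) * B) =
        if 1 ≤ n then c * PowerSeries.coeff (n - 1) B else 0 := by
    intro c B
    simpa only [pow_one] using hc c 1 B
  simp only [D7coeff, Finset.sum_range_succ, Finset.sum_range_zero, Polynomial.coe_add, add_mul,
    map_add, h0, h1, hc, coeff_iterate_eulerPS, zero_add]
  have ha (k : ℕ) : PowerSeries.coeff k periodSeries = periodCoeff k := by simp [periodSeries]
  simp only [ha, map_zero]
  -- The recurrence covers the coefficients from index four on; the first four involve fewer terms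
  -- and are checked from these values.
  have v0 : periodCoeff 0 = 1 := by
    simp [periodCoeff, innerSum, innerTerm, Nat.choose]
  have v1 : periodCoeff 1 = 48 := by
    simp [periodCoeff, innerSum, innerTerm, Finset.sum_range_succ, Nat.choose]
  have v2 : periodCoeff 2 = 15840 := by
    simp [periodCoeff, innerSum, innerTerm, Finset.sum_range_succ, Nat.choose]
  have v3 : periodCoeff 3 = 8148000 := by
    simp [periodCoeff, innerSum, innerTerm, Finset.sum_range_succ, Nat.choose]
  rcases n with _ | _ | _ | _ | n
  · simp
  · simp [v0, v1]; norm_num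
  · simp [v0, v1, v2]; norm_num
  · simp [v0, v1, v2, v3]; norm_num
  · have := congrArg (Rat.cast : ℚ → ℂ) (periodCoeff_recurrence n)
    push_cast at this
    simp only [show n + 1 + 1 + 1 + 1 = n + 4 by ring, show n + 4 - 1 = n + 3 by omega,
      show n + 4 - 2 = n + 2 by omega, show n + 4 - 3 = n + 1 by omega,
      show n + 4 - 4 = n by omega, show 1 ≤ n + 4 by omega, show 2 ≤ n + 4 by omega,
      show 3 ≤ n + 4 by omega, show 4 ≤ n + 4 by omega, if_true]
    push_cast
    linear_combination this

end

/-! ### Convergence of the fundamental period -/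

noncomputable section

open Polynomial Finset

theorem periodCoeff_eq (n : ℕ) : periodCoeff n = (2 * n).choose n ^ 2 *
    ∑ k ∈ Finset.range (2 * n + 1), (n + k).choose k * (2 * n).choose k ^ 2 := by
  rw [periodCoeff, innerSum_eq]

/-- Every binomial is bounded by a power of two; the exponents `4n + 2n + 3n + 4n` give `2^13 =
8192`. Only some positive radius of convergence is needed. -/
theorem periodCoeff_le (n : ℕ) : periodCoeff n ≤ 8192 ^ n := by
  have h : ∀ k ∈ Finset.range (2 * n + 1),
      (n + k).choose k * (2 * n).choose k ^ 2 ≤ 2 ^ (3 * n) * (2 ^ (2 * n)) ^ 2 := by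
    intro k hk
    have hk : k ≤ 2 * n := by simpa [Nat.lt_succ_iff] using hk
    refine Nat.mul_le_mul ?_ (Nat.pow_le_pow_left (Nat.choose_le_two_pow _ _) 2)
    exact (Nat.choose_le_two_pow _ _).trans (Nat.pow_le_pow_right (by norm_num) (by omega))
  have h2 : 2 * n + 1 ≤ 2 ^ (2 * n) := Nat.lt_two_pow_self
  calc periodCoeff n ≤ (2 ^ (2 * n)) ^ 2 * (2 ^ (2 * n) * (2 ^ (3 * n) * (2 ^ (2 * n)) ^ 2)) := by
        rw [periodCoeff_eq]
        refine Nat.mul_le_mul (Nat.pow_le_pow_left (Nat.choose_le_two_pow _ _) 2) ?_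
        refine (Finset.sum_le_card_nsmul _ _ _ h).trans ?_
        rw [Finset.card_range, smul_eq_mul]
        exact Nat.mul_le_mul_right _ h2
    _ = 8192 ^ n := by
        rw [show 8192 = 2 ^ 13 by norm_num, ← pow_mul, ← pow_mul, ← pow_add, ← pow_add, ← pow_add]
        congr 1
        ring

/-- The fundamental period. -/
def fundamentalPeriod (z : ℂ) : ℂ := ∑' n, (periodCoeff n : ℂ) * z ^ n

theorem hasSum_fundamentalPeriod {z : ℂ} (hz : ‖z‖ < 1 / 8192) :
    HasSum (fun n => (periodCoeff n : ℂ) * z ^ n) (fundamentalPeriod z) := by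
  refine (Summable.of_norm_bounded (g := fun n => (8192 * ‖z‖) ^ n)
    (summable_geometric_of_lt_one (by positivity) (by linarith)) fun n => ?_).hasSum
  rw [norm_mul, norm_pow, Complex.norm_natCast, mul_pow]
  gcongr
  exact_mod_cast periodCoeff_le n

theorem convergesTo_fundamentalPeriod : ConvergesTo periodSeries fundamentalPeriod := by
  have : Metric.ball (0 : ℂ) (1 / 8192) ∈ 𝓝 (0 : ℂ) := Metric.ball_mem_nhds _ (by norm_num)
  filter_upwards [this] with z hz
  simpa [periodSeries] using hasSum_fundamentalPeriod (mem_ball_zero_iff.1 hz)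

theorem analyticAt_fundamentalPeriod : AnalyticAt ℂ fundamentalPeriod 0 :=
  (convergesTo_iff.1 convergesTo_fundamentalPeriod).analyticAt

theorem isPicardFuchsOperator_D7 : IsPicardFuchsOperator D7 fundamentalPeriod := by
  refine ⟨fun h => ?_, ?_, fun M hM hMΦ => ?_⟩
  · have := natDegree_D7
    simp [h] at this
  · rw [(convergesTo_fundamentalPeriod.applyOp D7).eventually_eq_zero_iff]
    exact act_eulerPS_periodSeries
  · rw [(convergesTo_fundamentalPeriod.applyOp M).eventually_eq_zero_iff] at hMΦ
    obtain ⟨L, hL, hdeg, hact⟩ := exists_act_derivPS_eq hM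
    rw [natDegree_D7]
    refine (four_le_natDegree periodSeries_ne_zero ?_ hL ?_).trans hdeg
    · rw [act_derivPS_D7ord, act_eulerPS_periodSeries]
    · rw [hact, hMΦ]

end

/-! ### The Pfaffians and the Jacobian in coordinates -/

section


theorem sum_perm_fin_two (G : Fin 2 → Fin 2 → ℂ) :
    ∑ σ : Equiv.Perm (Fin 2), ((Equiv.Perm.sign σ : ℤ) : ℂ) * G (σ 0) (σ 1) =
      G 0 1 - G 1 0 := by
  rw [← Equiv.sum_comp Equiv.Perm.decomposeFin.symm]
  simp [Fintype.sum_prod_type, Fin.sum_univ_succ, Equiv.swap_apply_def]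
  ring

theorem sum_perm_fin_three (G : Fin 3 → Fin 3 → Fin 3 → ℂ) :
    ∑ σ : Equiv.Perm (Fin 3), ((Equiv.Perm.sign σ : ℤ) : ℂ) * G (σ 0) (σ 1) (σ 2) =
      G 0 1 2 - G 0 2 1 - G 1 0 2 + G 1 2 0 + G 2 0 1 - G 2 1 0 := by
  rw [← Equiv.sum_comp Equiv.Perm.decomposeFin.symm, Fintype.sum_prod_type]
  have h (p : Fin 3) (e : Equiv.Perm (Fin 2)) :
      ((Equiv.Perm.sign (Equiv.Perm.decomposeFin.symm (p, e)) : ℤ) : ℂ) *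
        G (Equiv.Perm.decomposeFin.symm (p, e) 0) (Equiv.Perm.decomposeFin.symm (p, e) 1)
          (Equiv.Perm.decomposeFin.symm (p, e) 2) =
      (if p = 0 then 1 else -1) * (((Equiv.Perm.sign e : ℤ) : ℂ) *
        G p (Equiv.swap 0 p (e 0).succ) (Equiv.swap 0 p (e 1).succ)) := by
    rw [Equiv.Perm.decomposeFin.symm_sign, Equiv.Perm.decomposeFin_symm_apply_zero,
      Equiv.Perm.decomposeFin_symm_apply_one, show (2 : Fin 3) = Fin.succ 1 from rfl,
      Equiv.Perm.decomposeFin_symm_apply_succ]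
    split_ifs <;> simp
  have h2 (p : Fin 3) := sum_perm_fin_two
    fun i j => G p (Equiv.swap 0 p i.succ) (Equiv.swap 0 p j.succ)
  simp only [h, ← Finset.mul_sum, h2]
  simp [Fin.sum_univ_succ, Equiv.swap_apply_def]
  ring

theorem sum_perm_fin_four (G : Fin 4 → Fin 4 → Fin 4 → Fin 4 → ℂ) :
    ∑ σ : Equiv.Perm (Fin 4), ((Equiv.Perm.sign σ : ℤ) : ℂ) * G (σ 0) (σ 1) (σ 2) (σ 3) =
      G 0 1 2 3 - G 0 1 3 2 - G 0 2 1 3 + G 0 2 3 1 + G 0 3 1 2 - G 0 3 2 1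
      - G 1 0 2 3 + G 1 0 3 2 + G 1 2 0 3 - G 1 2 3 0 - G 1 3 0 2 + G 1 3 2 0
      + G 2 0 1 3 - G 2 0 3 1 - G 2 1 0 3 + G 2 1 3 0 + G 2 3 0 1 - G 2 3 1 0
      - G 3 0 1 2 + G 3 0 2 1 + G 3 1 0 2 - G 3 1 2 0 - G 3 2 0 1 + G 3 2 1 0 := by
  rw [← Equiv.sum_comp Equiv.Perm.decomposeFin.symm, Fintype.sum_prod_type]
  have h (p : Fin 4) (e : Equiv.Perm (Fin 3)) :
      ((Equiv.Perm.sign (Equiv.Perm.decomposeFin.symm (p, e)) : ℤ) : ℂ) *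
        G (Equiv.Perm.decomposeFin.symm (p, e) 0) (Equiv.Perm.decomposeFin.symm (p, e) 1)
          (Equiv.Perm.decomposeFin.symm (p, e) 2) (Equiv.Perm.decomposeFin.symm (p, e) 3) =
      (if p = 0 then 1 else -1) * (((Equiv.Perm.sign e : ℤ) : ℂ) *
        G p (Equiv.swap 0 p (e 0).succ) (Equiv.swap 0 p (e 1).succ)
          (Equiv.swap 0 p (e 2).succ)) := by
    rw [Equiv.Perm.decomposeFin.symm_sign, Equiv.Perm.decomposeFin_symm_apply_zero,
      Equiv.Perm.decomposeFin_symm_apply_one, show (2 : Fin 4) = Fin.succ 1 from rfl,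
      Equiv.Perm.decomposeFin_symm_apply_succ, show (3 : Fin 4) = Fin.succ 2 from rfl,
      Equiv.Perm.decomposeFin_symm_apply_succ]
    split_ifs <;> simp
  have h2 (p : Fin 4) := sum_perm_fin_three
    fun i j k => G p (Equiv.swap 0 p i.succ) (Equiv.swap 0 p j.succ) (Equiv.swap 0 p k.succ)
  simp only [h, ← Finset.mul_sum, h2]
  simp only [Fin.sum_univ_four, Equiv.swap_apply_def, Fin.isValue,
    Fin.reduceSucc, Fin.reduceEq, if_true, if_false]
  ring

theorem pf_two (N : Matrix (Fin (1 + 1)) (Fin (1 + 1)) ℂ) :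
    pf (r := 1) N = (N 0 1 - N 1 0) / 2 := by
  have h := sum_perm_fin_two fun i j => N i j
  simp only [pf, Nat.factorial, Finset.univ_unique, Finset.prod_singleton]
  refine Eq.trans (congrArg _ (Eq.trans ?_ h)) (by simp; ring)
  rfl

/-- In this convention `σ(i)` is paired with `σ(r + i)`, so the value is the negative of the usual
Pfaffian of a `4 × 4` matrix. -/
theorem pf_four (N : Matrix (Fin (2 + 2)) (Fin (2 + 2)) ℂ) (hN : ∀ i j, N j i = -N i j) :
    pf (r := 2) N = N 0 2 * N 1 3 - N 0 1 * N 2 3 - N 0 3 * N 1 2 := by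
  have h := sum_perm_fin_four fun i j k l => N i k * N j l
  simp only [pf, Fin.prod_univ_two]
  refine Eq.trans (congrArg _ (Eq.trans ?_ h)) ?_
  · rfl
  · rw [hN 0 1, hN 0 2, hN 0 3, hN 1 2, hN 1 3, hN 2 3]
    simp [Nat.factorial]
    ring

theorem P7_135_chart (t : ℂ) (y : Fin 6 → ℂ) : P7_135 t (chart y) = y 5 := by
  rw [P7_135, pf_two]
  have : chart y 6 = y 5 := rfl
  simp [N7, this]

theorem N7_skew (t : ℂ) (x : Fin 7 → ℂ) (i j : Fin 5) : N7 t x j i = -N7 t x i j := by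
  fin_cases i <;> fin_cases j <;> simp [N7]

theorem P7_eq (t : ℂ) (i : Fin 5) (x : Fin 7 → ℂ) : P7 t i x =
    N7 t x (i.succAbove 0) (i.succAbove 2) * N7 t x (i.succAbove 1) (i.succAbove 3)
    - N7 t x (i.succAbove 0) (i.succAbove 1) * N7 t x (i.succAbove 2) (i.succAbove 3)
    - N7 t x (i.succAbove 0) (i.succAbove 3) * N7 t x (i.succAbove 1) (i.succAbove 2) :=
  pf_four _ fun _ _ => N7_skew _ _ _ _

theorem chart_apply (y : Fin 6 → ℂ) : chart y 0 = 1 ∧ chart y 1 = y 0 ∧ chart y 2 = y 1 ∧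
    chart y 3 = y 2 ∧ chart y 4 = y 3 ∧ chart y 5 = y 4 ∧ chart y 6 = y 5 :=
  ⟨rfl, rfl, rfl, rfl, rfl, rfl, rfl⟩

theorem P7_zero (t : ℂ) (y : Fin 6 → ℂ) : P7 t 0 (chart y) =
    y 1 * y 5 - t ^ 2 * y 4 * (1 + y 0) - t * (y 2 * y 3 * (y 2 + y 3)) := by
  obtain ⟨h0, h1, h2, h3, h4, h5, h6⟩ := chart_apply y
  rw [P7_eq]
  simp [N7, Fin.succAbove, h0, h1, h2, h3, h4, h5, h6]
  ring

theorem P7_one (t : ℂ) (y : Fin 6 → ℂ) : P7 t 1 (chart y) =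
    y 1 * y 4 - t * (y 0 * (1 + y 0)) - t ^ 2 * y 5 * (y 2 + y 3) := by
  obtain ⟨h0, h1, h2, h3, h4, h5, h6⟩ := chart_apply y
  rw [P7_eq]
  simp [N7, Fin.succAbove, h0, h1, h2, h3, h4, h5, h6]
  ring

theorem P7_two (t : ℂ) (y : Fin 6 → ℂ) : P7 t 2 (chart y) =
    y 2 * y 3 * y 4 - t ^ 2 * y 1 ^ 3 * (1 + y 0) - t * y 5 ^ 2 := by
  obtain ⟨h0, h1, h2, h3, h4, h5, h6⟩ := chart_apply y
  rw [P7_eq]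
  simp [N7, Fin.succAbove, h0, h1, h2, h3, h4, h5, h6]
  ring

theorem P7_three (t : ℂ) (y : Fin 6 → ℂ) : P7 t 3 (chart y) =
    y 0 * y 2 * y 3 - t * y 1 ^ 4 - t ^ 2 * y 4 * y 5 := by
  obtain ⟨h0, h1, h2, h3, h4, h5, h6⟩ := chart_apply y
  rw [P7_eq]
  simp [N7, Fin.succAbove, h0, h1, h2, h3, h4, h5, h6]
  ring

theorem P7_four (t : ℂ) (y : Fin 6 → ℂ) : P7 t 4 (chart y) =
    y 0 * y 5 - t ^ 2 * y 1 ^ 3 * (y 2 + y 3) - t * y 4 ^ 2 := by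
  obtain ⟨h0, h1, h2, h3, h4, h5, h6⟩ := chart_apply y
  rw [P7_eq]
  simp [N7, Fin.succAbove, h0, h1, h2, h3, h4, h5, h6]
  ring

/-- Where `x_6 ≠ 0`, the Pfaffians `P_1, P_3, P_5` cut out the Pfaffian variety. -/
theorem mem_X7_of_ne_zero {t : ℂ} {y : Fin 6 → ℂ} (hy : y 5 ≠ 0) (h0 : P7 t 0 (chart y) = 0)
    (h2 : P7 t 2 (chart y) = 0) (h4 : P7 t 4 (chart y) = 0) : y ∈ X7 t := by
  -- A syzygy: the vector of signed Pfaffians lies in the kernel of the matrix. The fourth row gives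
  -- `x_6 P_2` in terms of `P_1, P_3, P_5`, and the second row, used below, gives `x_6 P_4`.
  have h1 : P7 t 1 (chart y) = 0 := by
    rw [P7_zero] at h0
    rw [P7_two] at h2
    rw [P7_four] at h4
    rw [P7_one]
    refine (mul_eq_zero.1 (?_ : y 5 * _ = 0)).resolve_left hy
    linear_combination y 4 * h0 + t * (y 2 + y 3) * h2 - t * (1 + y 0) * h4
  have h3 : P7 t 3 (chart y) = 0 := by
    rw [P7_zero] at h0
    rw [P7_two] at h2
    rw [P7_four] at h4
    rw [P7_three]
    refine (mul_eq_zero.1 (?_ : y 5 * _ = 0)).resolve_left hy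
    linear_combination (-t * y 1 ^ 3) * h0 + t * y 4 * h2 + y 2 * y 3 * h4
  intro i
  fin_cases i
  exacts [h0, h1, h2, h3, h4]

theorem dP_apply (t : ℂ) (y : Fin 6 → ℂ) (i : Fin 3) (v : Fin 6 → ℂ) :
    dP t y i v = deriv (fun s : ℂ => P7 t (![0, 2, 4] i) (chart (y + s • v))) 0 := by
  have hd : Differentiable ℂ fun z => P7 t (![0, 2, 4] i) (chart z) := by
    fin_cases i
    · simp only [Fin.zero_eta, Matrix.cons_val_zero, P7_zero]; fun_prop
    · simp only [Fin.mk_one, Matrix.cons_val_one, Matrix.cons_val_zero, P7_two]; fun_prop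
    · simp only [Fin.reduceFinMk, Matrix.cons_val, P7_four]; fun_prop
  rw [dP, ← (hd y).lineDeriv_eq_fderiv]
  rfl

/-- The Jacobian determinant of `P_1, P_3, P_5` with respect to `x_1, x_2, x_3`. -/
theorem jac_eq (t : ℂ) (y : Fin 6 → ℂ) : jac t y = Matrix.det
    !![-(t ^ 2 * y 4), y 5, -(t * (y 3 * (2 * y 2 + y 3)));
       -(t ^ 2 * y 1 ^ 3), -(3 * t ^ 2 * y 1 ^ 2 * (1 + y 0)), y 3 * y 4;
       y 5, -(3 * t ^ 2 * y 1 ^ 2 * (y 2 + y 3)), -(t ^ 2 * y 1 ^ 3)] := by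
  rw [jac]
  congr 1
  ext i j
  rw [Matrix.of_apply, dP_apply]
  have key (f : ℂ → ℂ) (B C D : ℂ) (hf : ∀ s, f s = f 0 + B * s + C * s ^ 2 + D * s ^ 3) :
      deriv f 0 = B := by
    rw [funext hf]
    have h := (((hasDerivAt_id (0 : ℂ)).const_mul B).const_add (f 0)).add
      (((hasDerivAt_pow 2 (0 : ℂ)).const_mul C).add ((hasDerivAt_pow 3 (0 : ℂ)).const_mul D))
    refine Eq.trans (congrArg (fun g => deriv g 0) ?_) (h.deriv.trans (by simp))
    ext s
    simp [add_assoc]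
  fin_cases i
  · simp only [Fin.zero_eta, Matrix.cons_val_zero, P7_zero]
    fin_cases j
    · refine key _ _ 0 0 fun s => ?_
      simp
      ring
    · refine key _ _ 0 0 fun s => ?_
      simp
      ring
    · refine key _ _ (-(t * y 3)) 0 fun s => ?_
      simp
      ring
  · simp only [Fin.mk_one, Matrix.cons_val_one, Matrix.cons_val_zero, P7_two]
    fin_cases j
    · refine key _ _ 0 0 fun s => ?_
      simp
      ring
    · refine key _ _ (-(3 * t ^ 2 * y 1 * (1 + y 0))) (-(t ^ 2 * (1 + y 0))) fun s => ?_
      simp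
      ring
    · refine key _ _ 0 0 fun s => ?_
      simp
      ring
  · simp only [Fin.reduceFinMk, Matrix.cons_val, P7_four]
    fin_cases j
    · refine key _ _ 0 0 fun s => ?_
      simp
      ring
    · refine key _ _ (-(3 * t ^ 2 * y 1 * (y 2 + y 3))) (-(t ^ 2 * (y 2 + y 3))) fun s => ?_
      simp
      ring
    · refine key _ _ 0 0 fun s => ?_
      simp
      ring

end

/-! ### Stokes' theorem and Laurent monomials on the torus -/

noncomputable section

open MeasureTheory

/-- The fundamental cube of the torus `(ℝ/2πℤ)³`. -/
def cube : Set (Fin 3 → ℝ) := Set.Icc (0 : Fin 3 → ℝ) (fun _ => 2 * Real.pi)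

/-- The functions on `ℝ³` that are `2π`-periodic in each coordinate. -/
def IsTorusPeriodic (f : (Fin 3 → ℝ) → ℂ) : Prop :=
  ∀ (θ : Fin 3 → ℝ) (k : Fin 3), f (θ + Pi.single k (2 * Real.pi)) = f θ

/-- The partial derivative of `f` in the direction of the `k`-th coordinate. -/
def pderiv3 (k : Fin 3) (f : (Fin 3 → ℝ) → ℂ) (θ : Fin 3 → ℝ) : ℂ :=
  fderiv ℝ f θ (Pi.single k 1)

/-- The Jacobian determinant of three complex functions on `ℝ³`. -/
def torusJac (L : Fin 3 → (Fin 3 → ℝ) → ℂ) (θ : Fin 3 → ℝ) : ℂ :=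
  (Matrix.of fun a b : Fin 3 => pderiv3 a (L b) θ).det

theorem contDiff_pderiv3 {f : (Fin 3 → ℝ) → ℂ} (hf : ContDiff ℝ ∞ f) (k : Fin 3) :
    ContDiff ℝ ∞ (pderiv3 k f) :=
  (hf.fderiv_right (m := ∞) (by simp)).clm_apply contDiff_const

theorem pderiv3_comm {f : (Fin 3 → ℝ) → ℂ} (hf : ContDiff ℝ ∞ f) (j k : Fin 3) (θ : Fin 3 → ℝ) :
    pderiv3 j (pderiv3 k f) θ = pderiv3 k (pderiv3 j f) θ := by
  have h := (contDiff_infty.1 hf 2).contDiffAt.isSymmSndFDerivAt (x := θ) (by simp)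
  have hd : DifferentiableAt ℝ (fderiv ℝ f) θ :=
    ((hf.fderiv_right (m := ∞) (by simp)).differentiable (by simp)) θ
  have key (a b : Fin 3) : pderiv3 a (pderiv3 b f) θ =
      fderiv ℝ (fderiv ℝ f) θ (Pi.single a 1) (Pi.single b 1) := by
    unfold pderiv3
    rw [fderiv_clm_apply hd (differentiableAt_const _)]
    simp
  rw [key, key]
  exact h _ _

theorem IsTorusPeriodic.pderiv3 {f : (Fin 3 → ℝ) → ℂ} (hf : IsTorusPeriodic f) (k : Fin 3) :
    IsTorusPeriodic (pderiv3 k f) := by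
  intro θ j
  unfold PfaffianMirror.pderiv3
  rw [← fderiv_comp_add_right]
  congr 2
  ext1 x
  exact hf x j

theorem pderiv3_mul {f g : (Fin 3 → ℝ) → ℂ} (hf : ContDiff ℝ ∞ f) (hg : ContDiff ℝ ∞ g)
    (k : Fin 3) (θ : Fin 3 → ℝ) :
    pderiv3 k (fun x => f x * g x) θ = f θ * pderiv3 k g θ + pderiv3 k f θ * g θ := by
  unfold pderiv3
  rw [fderiv_fun_mul (hf.differentiable (by simp) θ) (hg.differentiable (by simp) θ)]
  simp
  ring

theorem pderiv3_sub {f g : (Fin 3 → ℝ) → ℂ} (hf : ContDiff ℝ ∞ f) (hg : ContDiff ℝ ∞ g)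
    (k : Fin 3) (θ : Fin 3 → ℝ) :
    pderiv3 k (fun x => f x - g x) θ = pderiv3 k f θ - pderiv3 k g θ := by
  unfold pderiv3
  rw [fderiv_fun_sub (hf.differentiable (by simp) θ) (hg.differentiable (by simp) θ)]
  simp

/-- The divergence of a periodic vector field integrates to zero over the torus. -/
theorem integral_divergence_eq_zero {F : Fin 3 → (Fin 3 → ℝ) → ℂ} (hF : ∀ i, ContDiff ℝ ∞ (F i))
    (hp : ∀ i, IsTorusPeriodic (F i)) : ∫ θ in cube, ∑ i, pderiv3 i (F i) θ = 0 := by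
  have hpi : (0 : Fin 3 → ℝ) ≤ fun _ => 2 * Real.pi := fun _ => by positivity
  have h := integral_divergence_of_hasFDerivAt_off_countable' (0 : Fin 3 → ℝ)
    (fun _ => 2 * Real.pi) hpi F (fun i => fderiv ℝ (F i)) ∅ Set.countable_empty
    (fun i => (hF i).continuous.continuousOn)
    (fun x _ i => ((hF i).differentiable (by simp) x).hasFDerivAt) ?_
  -- By periodicity opposite faces of the cube contribute equally.
  · refine h.trans (Finset.sum_eq_zero fun i _ => sub_eq_zero.2 ?_)
    congr 1
    ext1 x
    refine Eq.trans (congrArg (F i) ?_) (hp i _ i)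
    ext j
    refine Fin.succAboveCases i ?_ (fun k => ?_) j
    · simp
    · simp
  · refine Continuous.integrableOn_Icc (continuous_finsetSum _ fun i _ => ?_)
    exact (contDiff_pderiv3 (hF i) i).continuous

/-- `dL₀ ∧ dL₁ ∧ dL₂ = d(L₀ dL₁ ∧ dL₂)`: the Jacobian is the divergence of `L₀` times a row of
minors, whose own divergence vanishes by the symmetry of second derivatives. The functions `L₁, L₂`
need only periodic derivatives. -/
theorem integral_torusJac_eq_zero_of_zero {L : Fin 3 → (Fin 3 → ℝ) → ℂ}
    (hL : ∀ i, ContDiff ℝ ∞ (L i)) (hp : ∀ i k, IsTorusPeriodic (pderiv3 k (L i)))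
    (h0 : IsTorusPeriodic (L 0)) : ∫ θ in cube, torusJac L θ = 0 := by
  have hd (i k) := contDiff_pderiv3 (hL i) k
  have hm (k l : Fin 3) : ContDiff ℝ ∞ fun x => pderiv3 k (L 1) x * pderiv3 l (L 2) x :=
    (hd 1 k).mul (hd 2 l)
  have hM (k l : Fin 3) : ContDiff ℝ ∞ fun x =>
      pderiv3 k (L 1) x * pderiv3 l (L 2) x - pderiv3 l (L 1) x * pderiv3 k (L 2) x :=
    (hm k l).sub (hm l k)
  have hF (k l : Fin 3) : ContDiff ℝ ∞ fun x => L 0 x *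
      (pderiv3 k (L 1) x * pderiv3 l (L 2) x - pderiv3 l (L 1) x * pderiv3 k (L 2) x) :=
    (hL 0).mul (hM k l)
  have h := integral_divergence_eq_zero (F := fun i x => L 0 x *
    (pderiv3 (i + 1) (L 1) x * pderiv3 (i + 2) (L 2) x
      - pderiv3 (i + 2) (L 1) x * pderiv3 (i + 1) (L 2) x)) (fun i => hF _ _) ?_
  · refine Eq.trans (congrArg _ (funext fun θ => ?_)) h
    have hk (i k l : Fin 3) := pderiv3_mul (hL 0) (hM k l) i θ
    have hs (i k l : Fin 3) := pderiv3_sub (hm k l) (hm l k) i θ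
    have hn (i k l : Fin 3) := pderiv3_mul (hd 1 k) (hd 2 l) i θ
    have h10 (i) := pderiv3_comm (hL i) 1 0 θ
    have h20 (i) := pderiv3_comm (hL i) 2 0 θ
    have h21 (i) := pderiv3_comm (hL i) 2 1 θ
    rw [Fin.sum_univ_three, hk, hk, hk, hs, hs, hs, hn, hn, hn, hn, hn, hn, torusJac,
      Matrix.det_fin_three]
    simp only [Matrix.of_apply, Fin.isValue, Fin.reduceAdd, h10, h20, h21]
    ring
  · intro i θ k
    simp only [h0 θ k, hp _ _ θ k]

/-- **Stokes' theorem** on the torus: `∫ dL₀ ∧ dL₁ ∧ dL₂ = 0` if the differentials are periodic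
and one of the functions is periodic. -/
theorem integral_torusJac_eq_zero {L : Fin 3 → (Fin 3 → ℝ) → ℂ}
    (hL : ∀ i, ContDiff ℝ ∞ (L i)) (hp : ∀ i k, IsTorusPeriodic (pderiv3 k (L i))) (j : Fin 3)
    (hj : IsTorusPeriodic (L j)) : ∫ θ in cube, torusJac L θ = 0 := by
  have h := integral_torusJac_eq_zero_of_zero (L := fun i => L (Equiv.swap 0 j i))
    (fun i => hL _) (fun i => hp _) (by simpa using hj)
  have hs (θ) : torusJac (fun i => L (Equiv.swap 0 j i)) θ =
      ((Equiv.Perm.sign (Equiv.swap 0 j) : ℤ) : ℂ) * torusJac L θ := by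
    have h := Matrix.det_permute' (Equiv.swap 0 j) (Matrix.of fun a b => pderiv3 a (L b) θ)
    exact h
  simp only [hs] at h
  rw [integral_const_mul] at h
  refine (mul_eq_zero.1 h).resolve_left ?_
  rcases Int.units_eq_one_or (Equiv.Perm.sign (Equiv.swap 0 j)) with h | h <;> simp [h]

theorem torusJac_update (L : Fin 3 → (Fin 3 → ℝ) → ℂ) (i : Fin 3) (f : (Fin 3 → ℝ) → ℂ)
    (θ : Fin 3 → ℝ) : torusJac (Function.update L i f) θ =
      ((Matrix.of fun a b : Fin 3 => pderiv3 a (L b) θ).updateCol i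
        fun a => pderiv3 a f θ).det := by
  rw [torusJac]
  congr 1
  ext a b
  rw [Matrix.of_apply, Matrix.updateCol_apply]
  split_ifs with h
  · rw [h, Function.update_self]
  · rw [Function.update_of_ne h, Matrix.of_apply]

theorem contDiff_torusJac {L : Fin 3 → (Fin 3 → ℝ) → ℂ} (hL : ∀ i, ContDiff ℝ ∞ (L i)) :
    ContDiff ℝ ∞ (torusJac L) := by
  have hd (i k) := contDiff_pderiv3 (hL i) k
  unfold torusJac
  simp only [Matrix.det_fin_three, Matrix.of_apply]
  fun_prop

/-- Changing one of the functions by a periodic one does not change the integral, by multilinearity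
and Stokes. This is used to straighten a deformed torus one coordinate at a time. -/
theorem integral_torusJac_congr {L : Fin 3 → (Fin 3 → ℝ) → ℂ} {f : (Fin 3 → ℝ) → ℂ}
    (hL : ∀ i, ContDiff ℝ ∞ (L i)) (hf : ContDiff ℝ ∞ f)
    (hp : ∀ i k, IsTorusPeriodic (pderiv3 k (L i))) (j : Fin 3)
    (hj : IsTorusPeriodic fun x => L j x - f x) :
    ∫ θ in cube, torusJac L θ = ∫ θ in cube, torusJac (Function.update L j f) θ := by
  have hu {g : (Fin 3 → ℝ) → ℂ} (hg : ContDiff ℝ ∞ g) (i) :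
      ContDiff ℝ ∞ (Function.update L j g i) := by
    by_cases h : i = j
    · rwa [h, Function.update_self]
    · rw [Function.update_of_ne h]
      exact hL i
  have hs : ContDiff ℝ ∞ fun x => L j x - f x := (hL j).sub hf
  have h := integral_torusJac_eq_zero (L := Function.update L j fun x => L j x - f x) (hu hs)
    (fun i k => ?_) j (by rwa [Function.update_self])
  · rw [← sub_eq_zero, ← h]
    have hi {L : Fin 3 → (Fin 3 → ℝ) → ℂ} (hL : ∀ i, ContDiff ℝ ∞ (L i)) :
        IntegrableOn (torusJac L) cube := (contDiff_torusJac hL).continuous.integrableOn_Icc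
    rw [← integral_sub (hi hL) (hi (hu hf))]
    congr 1
    ext θ
    have hadd := Matrix.det_updateCol_add (Matrix.of fun a b : Fin 3 => pderiv3 a (L b) θ) j
      (fun a => pderiv3 a (fun x => L j x - f x) θ) (fun a => pderiv3 a f θ)
    rw [torusJac_update, torusJac_update, sub_eq_iff_eq_add, ← hadd, torusJac]
    congr 1
    ext a b
    rw [Matrix.updateCol_apply]
    split_ifs with h
    · simp [pderiv3_sub (hL j) hf, h]
    · rfl
  · by_cases h : i = j
    · rw [h, Function.update_self]
      exact hj.pderiv3 k
    · rw [Function.update_of_ne h]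
      exact hp i k

theorem pderiv3_angle (b k : Fin 3) (θ : Fin 3 → ℝ) :
    pderiv3 k (fun x => (x b : ℂ) * Complex.I) θ = if k = b then Complex.I else 0 := by
  have h : HasFDerivAt (fun x : Fin 3 → ℝ => (x b : ℂ) * Complex.I) _ θ :=
    (Complex.ofRealCLM.hasFDerivAt.comp θ (hasFDerivAt_apply b θ)).mul_const Complex.I
  rw [pderiv3, h.fderiv]
  by_cases hb : k = b <;> simp [hb]

theorem contDiff_angle (b : Fin 3) :
    ContDiff ℝ ∞ fun x : Fin 3 → ℝ => (x b : ℂ) * Complex.I :=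
  (Complex.ofRealCLM.contDiff.comp (contDiff_apply ℝ ℝ b)).mul contDiff_const

/-- The integral over the torus of a Laurent monomial in `u_b = exp(iθ_b + h_b)`, with `h_b`
periodic, against `d log u₀ ∧ d log u₁ ∧ d log u₂`. -/
theorem integral_exp_mul_torusJac {h : Fin 3 → (Fin 3 → ℝ) → ℂ}
    (hh : ∀ i, ContDiff ℝ ∞ (h i)) (hp : ∀ i, IsTorusPeriodic (h i)) (m : Fin 3 → ℤ) :
    ∫ θ in cube, Complex.exp (∑ b, m b * ((θ b : ℂ) * Complex.I + h b θ)) *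
      torusJac (fun b x => (x b : ℂ) * Complex.I + h b x) θ =
      if m = 0 then (2 * Real.pi * Complex.I) ^ 3 else 0 := by
  set L : Fin 3 → (Fin 3 → ℝ) → ℂ := fun b x => (x b : ℂ) * Complex.I + h b x with hLdef
  have hL (i) : ContDiff ℝ ∞ (L i) := (contDiff_angle i).add (hh i)
  have hdiff (i : Fin 3) (x) : DifferentiableAt ℝ (L i) x := (hL i).differentiable (by simp) x
  have hLp (i k) : IsTorusPeriodic (pderiv3 k (L i)) := by
    intro θ j
    have : pderiv3 k (L i) = fun x => (if k = i then Complex.I else 0) + pderiv3 k (h i) x := by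
      ext x
      rw [hLdef, ← pderiv3_angle i k x]
      unfold pderiv3
      rw [fderiv_fun_add ((contDiff_angle i).differentiable (by simp) x)
        ((hh i).differentiable (by simp) x)]
      rfl
    simp only [this, (hp i).pderiv3 k θ j]
  by_cases hm : m = 0
  · rw [if_pos hm, hm]
    simp only [Pi.zero_apply, Int.cast_zero, zero_mul, Finset.sum_const_zero, Complex.exp_zero,
      one_mul]
    -- In `M n` the first `n` of the three logarithms are replaced by pure angles.
    set M : ℕ → Fin 3 → (Fin 3 → ℝ) → ℂ := fun n b =>
      if (b : ℕ) < n then fun x => (x b : ℂ) * Complex.I else L b with hM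
    have hMs (n i) : ContDiff ℝ ∞ (M n i) := by
      simp only [hM]
      split_ifs
      exacts [contDiff_angle i, hL i]
    have hMp (n i k) : IsTorusPeriodic (pderiv3 k (M n i)) := by
      simp only [hM]
      split_ifs
      · intro θ j
        rw [pderiv3_angle, pderiv3_angle]
      · exact hLp i k
    have hstep (j : Fin 3) : ∫ θ in cube, torusJac (M j) θ = ∫ θ in cube, torusJac (M (j + 1)) θ := by
      have hMj : M j j = L j := if_neg (lt_irrefl _)
      have hup : Function.update (M j) j (fun x => (x j : ℂ) * Complex.I) = M (j + 1) := by
        ext1 b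
        by_cases hb : b = j
        · rw [hb, Function.update_self]
          exact (if_pos (Nat.lt_succ_self _)).symm
        · rw [Function.update_of_ne hb]
          have : (b : ℕ) ≠ j := fun h => hb (Fin.ext h)
          simp only [hM, Nat.lt_succ_iff_lt_or_eq, this, or_false]
      rw [integral_torusJac_congr (hMs j) (contDiff_angle j) (hMp j) j, hup]
      simpa [hMj, hLdef] using hp j
    have h0 : M 0 = L := by
      ext1 b
      simp [hM]
    have h3 : M 3 = fun b x => (x b : ℂ) * Complex.I := by
      ext1 b
      exact if_pos b.2
    rw [← h0]
    refine (hstep 0).trans ((hstep 1).trans ((hstep 2).trans ?_))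
    have hc (θ : Fin 3 → ℝ) : torusJac (M 3) θ = Complex.I ^ 3 := by
      simp [h3, torusJac, pderiv3_angle, Matrix.det_fin_three]
    have h32 : ((2 : Fin 3) : ℕ) + 1 = 3 := rfl
    simp only [h32, hc]
    have hv : volume.real cube = (2 * Real.pi) ^ 3 := by
      rw [Measure.real, cube, Real.volume_Icc_pi_toReal fun _ => by positivity]
      simp
    rw [setIntegral_const, hv, Complex.real_smul]
    push_cast
    ring
  · rw [if_neg hm]
    obtain ⟨j, hj⟩ := Function.ne_iff.1 hm
    have hj' : (m j : ℂ) ≠ 0 := by exact_mod_cast hj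
    -- A primitive in the direction `j`: in `df ∧ dL_k ∧ dL_l` only the `dL_j` part of `df`
    -- survives, with coefficient the monomial itself. It is periodic because the exponents are
    -- integers.
    set f : (Fin 3 → ℝ) → ℂ := fun θ => Complex.exp (∑ b, m b * L b θ) / m j with hf
    have hfs : ContDiff ℝ ∞ f := by
      have : ContDiff ℝ ∞ fun θ => ∑ b, (m b : ℂ) * L b θ :=
        ContDiff.sum fun b _ => contDiff_const.mul (hL b)
      exact (this.cexp).div_const _
    have hfp : IsTorusPeriodic f := by
      intro θ k
      have : ∑ b, (m b : ℂ) * L b (θ + Pi.single k (2 * Real.pi)) =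
          ∑ b, (m b : ℂ) * L b θ + m k * (2 * Real.pi * Complex.I) := by
        have h1 (b) : (m b : ℂ) * L b (θ + Pi.single k (2 * Real.pi)) = (m b : ℂ) * L b θ +
            if b = k then m k * (2 * Real.pi * Complex.I) else 0 := by
          simp only [hLdef, hp b θ k, Pi.add_apply, Pi.single_apply]
          split_ifs with hb
          · subst hb
            push_cast
            ring
          · simp
        simp only [h1, Finset.sum_add_distrib, Finset.sum_ite_eq', Finset.mem_univ, if_true]
      simp only [hf, this, Complex.exp_add, Complex.exp_int_mul_two_pi_mul_I, mul_one]
    have hint := integral_torusJac_eq_zero (L := Function.update L j f) (fun i => ?_)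
      (fun i k => ?_) j (by rwa [Function.update_self])
    · refine Eq.trans (congrArg _ (funext fun θ => ?_)) hint
      have hd (a) : pderiv3 a f θ =
          ∑ b, (Complex.exp (∑ b, m b * L b θ) * m b / m j) * pderiv3 a (L b) θ := by
        have h1 : HasFDerivAt f _ θ := ((HasFDerivAt.fun_sum (u := Finset.univ) fun b _ =>
          ((hdiff b θ).hasFDerivAt.const_mul (m b : ℂ))).cexp).mul_const (m j : ℂ)⁻¹
        rw [pderiv3, h1.fderiv]
        simp [pderiv3, Finset.mul_sum]
        refine Finset.sum_congr rfl fun b _ => ?_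
        ring
      rw [torusJac_update]
      simp only [hd]
      have := Matrix.det_updateCol_sum (Matrix.of fun a b : Fin 3 => pderiv3 a (L b) θ) j
        fun b => Complex.exp (∑ b, m b * L b θ) * m b / m j
      simp only [smul_eq_mul, Matrix.of_apply] at this
      rw [this, torusJac, mul_div_assoc, div_self hj', mul_one]
    · by_cases hi : i = j
      · rwa [hi, Function.update_self]
      · rw [Function.update_of_ne hi]
        exact hL i
    · by_cases hi : i = j
      · rw [hi, Function.update_self]
        exact hfp.pderiv3 k
      · rw [Function.update_of_ne hi]
        exact hLp i k

end

/-! ### Solving `P_1 = P_3 = P_5 = 0` by a contraction -/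

noncomputable section

open MeasureTheory Metric

/-- The residue at the attracting fixed point `W` of a contraction `ψ` of the unit disc. -/
theorem circleIntegral_div_sub_fixedPoint {ψ h : ℂ → ℂ} {W : ℂ}
    (hψ : DifferentiableOn ℂ ψ (ball 0 2)) (hh : DifferentiableOn ℂ h (ball 0 2))
    (hb : ∀ z ∈ ball (0 : ℂ) 2, ‖ψ z‖ ≤ 1 / 8) (hW : W ∈ ball (0 : ℂ) 1) (hfix : ψ W = W) :
    deriv ψ W ≠ 1 ∧
      ∮ z in C(0, 1), h z / (z - ψ z) = 2 * Real.pi * Complex.I * (h W / (1 - deriv ψ W)) := by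
  have hsub : closedBall (0 : ℂ) 1 ⊆ ball 0 2 := closedBall_subset_ball (by norm_num)
  have hW2 : W ∈ ball (0 : ℂ) 2 := ball_subset_ball (by norm_num) hW
  -- Cauchy's estimate on discs of radius `1/2`. Then difference quotients are at most `1/4`, so `z
  -- - ψ z` is `z - W` times a function without zeros on the closed disc, and Cauchy's integral
  -- formula applies.
  have hder (z : ℂ) (hz : z ∈ closedBall (0 : ℂ) 1) : ‖deriv ψ z‖ ≤ 1 / 4 := by
    have hs : closedBall z (1 / 2) ⊆ ball (0 : ℂ) 2 := by
      intro x hx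
      rw [mem_closedBall, dist_eq_norm] at hx
      rw [mem_closedBall_zero_iff] at hz
      rw [mem_ball_zero_iff]
      calc ‖x‖ = ‖(x - z) + z‖ := by ring_nf
        _ ≤ ‖x - z‖ + ‖z‖ := norm_add_le _ _
        _ < 2 := by linarith
    refine (Complex.norm_deriv_le_of_forall_mem_sphere_norm_le (C := 1 / 8) (R := 1 / 2)
      (by norm_num) ?_ fun x hx => hb x (hs (sphere_subset_closedBall hx))).trans (by norm_num)
    exact (hψ.mono hs).diffContOnCl_ball subset_rfl
  have hdiff (z : ℂ) (hz : z ∈ closedBall (0 : ℂ) 1) : DifferentiableAt ℂ ψ z :=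
    (hψ z (hsub hz)).differentiableAt (isOpen_ball.mem_nhds (hsub hz))
  have hne (z : ℂ) (hz : z ∈ closedBall (0 : ℂ) 1) : 1 - dslope ψ W z ≠ 0 := by
    have hn : ‖dslope ψ W z‖ ≤ 1 / 4 := by
      by_cases h : z = W
      · rw [h, dslope_same]
        exact hder W (ball_subset_closedBall hW)
      · rw [dslope_of_ne _ h, slope_def_field, norm_div,
          div_le_iff₀ (norm_pos_iff.2 (sub_ne_zero.2 h))]
        exact (convex_closedBall (0 : ℂ) 1).norm_image_sub_le_of_norm_deriv_le hdiff hder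
          (ball_subset_closedBall hW) hz
    intro h0
    rw [← sub_eq_zero.1 h0, norm_one] at hn
    norm_num at hn
  refine ⟨fun h => hne W (ball_subset_closedBall hW) (by rw [dslope_same, h, sub_self]), ?_⟩
  have hfac (z : ℂ) : z - ψ z = (z - W) * (1 - dslope ψ W z) := by
    have h := sub_smul_dslope ψ W z
    rw [smul_eq_mul, hfix] at h
    linear_combination h
  have hd : DifferentiableOn ℂ (fun z => h z / (1 - dslope ψ W z)) (closedBall 0 1) :=
    (hh.mono hsub).div ((differentiableOn_const _).sub
      (((Complex.differentiableOn_dslope (isOpen_ball.mem_nhds hW2)).2 hψ).mono hsub)) hne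
  have hint := (hd.diffContOnCl_ball subset_rfl).circleIntegral_sub_inv_smul hW
  rw [dslope_same, smul_eq_mul] at hint
  rw [← hint]
  refine circleIntegral.integral_congr (by norm_num) fun z hz => ?_
  simp only [smul_eq_mul, hfac]
  rw [div_mul_eq_div_div_swap, div_eq_inv_mul]

/-- `P_5 = x_6 (x_1 - phi1)`, where `u = (x_4, x_5, x_6)`. -/
def phi1 (t : ℂ) (u : Fin 3 → ℂ) (w2 w3 : ℂ) : ℂ :=
  (t ^ 2 * w2 ^ 3 * (w3 + u 0) + t * u 1 ^ 2) / u 2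

/-- `P_1 = x_6 (x_2 - phi2)`, where `u = (x_4, x_5, x_6)`. -/
def phi2 (t : ℂ) (u : Fin 3 → ℂ) (w1 w3 : ℂ) : ℂ :=
  (t ^ 2 * u 1 * (1 + w1) + t * (w3 * u 0 * (w3 + u 0))) / u 2

/-- `P_3 = x_4 x_5 (x_3 - phi3)`, where `u = (x_4, x_5, x_6)`. -/
def phi3 (t : ℂ) (u : Fin 3 → ℂ) (w1 w2 : ℂ) : ℂ :=
  (t ^ 2 * w2 ^ 3 * (1 + w1) + t * u 2 ^ 2) / (u 0 * u 1)

/-- The product of the slopes of `phi1` and `phi3` in `x_3` and `x_1`. -/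
def kappa (t : ℂ) (u : Fin 3 → ℂ) (w2 : ℂ) : ℂ :=
  t ^ 4 * w2 ^ 6 / (u 0 * u 1 * u 2)

/-- The parameter `t` is so small, in relation to `u = (x_4, x_5, x_6)`, that
`(phi1, phi2, phi3)` is strongly contracting on the polydisc of radius two. -/
structure IsSmall (t : ℂ) (u : Fin 3 → ℂ) : Prop where
  ne_zero : ∀ i, u i ≠ 0
  phi1_le : ∀ w2 w3, ‖w2‖ ≤ 2 → ‖w3‖ ≤ 2 → ‖phi1 t u w2 w3‖ ≤ 1 / 8
  phi2_le : ∀ w1 w3, ‖w1‖ ≤ 2 → ‖w3‖ ≤ 2 → ‖phi2 t u w1 w3‖ ≤ 1 / 8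
  phi3_le : ∀ w1 w2, ‖w1‖ ≤ 2 → ‖w2‖ ≤ 2 → ‖phi3 t u w1 w2‖ ≤ 1 / 8
  kappa_le : ∀ w2, ‖w2‖ ≤ 2 → ‖kappa t u w2‖ ≤ 1 / 8

/-- The solution `x_1` of `P_3 = P_5 = 0` as a function of `x_2`. -/
def solve1 (t : ℂ) (u : Fin 3 → ℂ) (w2 : ℂ) : ℂ :=
  phi1 t u w2 (phi3 t u 0 w2) / (1 - kappa t u w2)

/-- The solution `x_3` of `P_3 = P_5 = 0` as a function of `x_2`. -/
def solve3 (t : ℂ) (u : Fin 3 → ℂ) (w2 : ℂ) : ℂ := phi3 t u (solve1 t u w2) w2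

/-- On `P_3 = P_5 = 0` the equation `P_1 = 0` says that `x_2` is a fixed point of this function. -/
def solve2 (t : ℂ) (u : Fin 3 → ℂ) (w2 : ℂ) : ℂ := phi2 t u (solve1 t u w2) (solve3 t u w2)

/-- The point of the chart with `(x_1, x_2, x_3) = w` and `(x_4, x_5, x_6) = u`. -/
def joinPoint (w u : Fin 3 → ℂ) : Fin 6 → ℂ := ![w 0, w 1, w 2, u 0, u 1, u 2]

theorem P7_zero_join {t : ℂ} {w u : Fin 3 → ℂ} (hu : ∀ i, u i ≠ 0) :
    P7 t 0 (chart (joinPoint w u)) = u 2 * (w 1 - phi2 t u (w 0) (w 2)) := by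
  have := hu 2
  simp only [P7_zero, joinPoint, phi2, Matrix.cons_val]
  field_simp
  ring

theorem P7_two_join {t : ℂ} {w u : Fin 3 → ℂ} (hu : ∀ i, u i ≠ 0) :
    P7 t 2 (chart (joinPoint w u)) = u 0 * u 1 * (w 2 - phi3 t u (w 0) (w 1)) := by
  have := hu 0
  have := hu 1
  simp only [P7_two, joinPoint, phi3, Matrix.cons_val]
  field_simp
  ring

theorem P7_four_join {t : ℂ} {w u : Fin 3 → ℂ} (hu : ∀ i, u i ≠ 0) :
    P7 t 4 (chart (joinPoint w u)) = u 2 * (w 0 - phi1 t u (w 1) (w 2)) := by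
  have := hu 2
  simp only [P7_four, joinPoint, phi1, Matrix.cons_val]
  field_simp
  ring

namespace IsSmall

variable {t : ℂ} {u : Fin 3 → ℂ} (h : IsSmall t u)

theorem one_sub_kappa_ne {w2 : ℂ} (hw : ‖w2‖ ≤ 2) (h : IsSmall t u) : 1 - kappa t u w2 ≠ 0 := by
  intro h0
  have := h.kappa_le w2 hw
  rw [← sub_eq_zero.1 h0, norm_one] at this
  norm_num at this

/-- `phi1` is affine in `x_3` and `phi3` is affine in `x_1`, so eliminating `x_3` leaves a linear
equation for `x_1`, with slope `1 - kappa`. -/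
theorem sub_phi1_solve {w1 w2 : ℂ} (hw : ‖w2‖ ≤ 2) (h : IsSmall t u) :
    w1 - phi1 t u w2 (phi3 t u w1 w2) = (1 - kappa t u w2) * (w1 - solve1 t u w2) := by
  have hk := one_sub_kappa_ne hw h
  rw [mul_sub, solve1, mul_div_cancel₀ _ hk]
  have := h.ne_zero 0
  have := h.ne_zero 1
  have := h.ne_zero 2
  simp only [phi1, phi3, kappa]
  field_simp
  ring

theorem solve1_eq {w2 : ℂ} (hw : ‖w2‖ ≤ 2) (h : IsSmall t u) :
    solve1 t u w2 = phi1 t u w2 (solve3 t u w2) := by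
  have := sub_phi1_solve (w1 := solve1 t u w2) hw h
  rw [sub_self, mul_zero] at this
  exact sub_eq_zero.1 this

theorem norm_solve1_le {w2 : ℂ} (hw : ‖w2‖ ≤ 2) (h : IsSmall t u) : ‖solve1 t u w2‖ ≤ 1 / 4 := by
  have h3 := h.phi3_le 0 w2 (by simp) hw
  have h1 := h.phi1_le w2 _ hw (h3.trans (by norm_num))
  have hk : 7 / 8 ≤ ‖1 - kappa t u w2‖ := by
    have := norm_sub_norm_le (1 : ℂ) (kappa t u w2)
    rw [norm_one] at this
    linarith [h.kappa_le w2 hw]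
  rw [solve1, norm_div, div_le_iff₀ (by linarith)]
  linarith

theorem norm_solve3_le {w2 : ℂ} (hw : ‖w2‖ ≤ 2) (h : IsSmall t u) : ‖solve3 t u w2‖ ≤ 1 / 8 :=
  h.phi3_le _ _ ((norm_solve1_le hw h).trans (by norm_num)) hw

theorem norm_solve2_le {w2 : ℂ} (hw : ‖w2‖ ≤ 2) (h : IsSmall t u) : ‖solve2 t u w2‖ ≤ 1 / 8 :=
  h.phi2_le _ _ ((norm_solve1_le hw h).trans (by norm_num))
    ((norm_solve3_le hw h).trans (by norm_num))

theorem differentiableAt_kappa (w2 : ℂ) : DifferentiableAt ℂ (kappa t u) w2 := by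
  unfold kappa
  fun_prop

theorem differentiableAt_solve1 {w2 : ℂ} (hw : ‖w2‖ ≤ 2) (h : IsSmall t u) :
    DifferentiableAt ℂ (solve1 t u) w2 := by
  unfold solve1
  refine DifferentiableAt.div ?_ ((differentiableAt_kappa w2).const_sub 1) (one_sub_kappa_ne hw h)
  unfold phi1 phi3
  fun_prop

theorem differentiableAt_solve3 {w2 : ℂ} (hw : ‖w2‖ ≤ 2) (h : IsSmall t u) :
    DifferentiableAt ℂ (solve3 t u) w2 := by
  have := differentiableAt_solve1 hw h
  unfold solve3 phi3
  fun_prop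

theorem differentiableAt_solve2 {w2 : ℂ} (hw : ‖w2‖ ≤ 2) (h : IsSmall t u) :
    DifferentiableAt ℂ (solve2 t u) w2 := by
  have := differentiableAt_solve1 hw h
  have := differentiableAt_solve3 hw h
  unfold solve2 phi2
  fun_prop

/-- The points of the Pfaffian variety near `w = 0` solve the fixed point equation. -/
theorem eq_solve_of_mem {w : Fin 3 → ℂ} (hw : ‖w 1‖ ≤ 2) (h : IsSmall t u)
    (hmem : joinPoint w u ∈ X7 t) :
    w 0 = solve1 t u (w 1) ∧ w 2 = solve3 t u (w 1) ∧ solve2 t u (w 1) = w 1 := by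
  have h0 := hmem 0
  have h2 := hmem 2
  have h4 := hmem 4
  rw [P7_zero_join h.ne_zero, mul_eq_zero, or_iff_right (h.ne_zero 2), sub_eq_zero] at h0
  rw [P7_two_join h.ne_zero, mul_eq_zero,
    or_iff_right (mul_ne_zero (h.ne_zero 0) (h.ne_zero 1)), sub_eq_zero] at h2
  rw [P7_four_join h.ne_zero, mul_eq_zero, or_iff_right (h.ne_zero 2)] at h4
  have h1 : w 0 = solve1 t u (w 1) := by
    have := sub_phi1_solve (w1 := w 0) hw h
    rw [← h2, h4] at this
    exact sub_eq_zero.1 ((mul_eq_zero.1 this.symm).resolve_left (one_sub_kappa_ne hw h))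
  have h3 : w 2 = solve3 t u (w 1) := by rw [h2, solve3, ← h1]
  exact ⟨h1, h3, by rw [solve2, ← h1, ← h3, ← h0]⟩

/-- The Jacobian determinant at a point of the Pfaffian variety. -/
theorem jac_eq_mul {w : Fin 3 → ℂ} (hw' : ‖w 1‖ < 2) (h : IsSmall t u)
    (hmem : joinPoint w u ∈ X7 t) : jac t (joinPoint w u) =
      u 0 * u 1 * u 2 ^ 2 * ((1 - kappa t u (w 1)) * (1 - deriv (solve2 t u) (w 1))) := by
  have hw := hw'.le
  obtain ⟨h1, h3, h2⟩ := eq_solve_of_mem hw h hmem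
  have n0 := h.ne_zero 0
  have n1 := h.ne_zero 1
  have n2 := h.ne_zero 2
  set z := w 1 with hz
  obtain ⟨d1, e1⟩ : ∃ d, HasDerivAt (solve1 t u) d z := ⟨_, (differentiableAt_solve1 hw h).hasDerivAt⟩
  obtain ⟨d3, e3⟩ : ∃ d, HasDerivAt (solve3 t u) d z := ⟨_, (differentiableAt_solve3 hw h).hasDerivAt⟩
  -- The equation satisfied by `solve1` is differentiated, rather than its quotient formula. The
  -- relations `f1, f3` for `d1, d3` then turn the determinant into the product of the two slopes.
  have f1 : d1 = (t ^ 2 * (3 * z ^ 2) * (w 2 + u 0) + t ^ 2 * z ^ 3 * d3) / u 2 := by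
    have hev : solve1 t u =ᶠ[𝓝 z] fun x => phi1 t u x (solve3 t u x) := by
      filter_upwards [(isOpen_lt continuous_norm continuous_const).mem_nhds hw'] with x hx
      exact solve1_eq hx.le h
    have := ((((hasDerivAt_pow 3 z).const_mul (t ^ 2)).mul (e3.add_const (u 0))).add_const
      (t * u 1 ^ 2)).div_const (u 2)
    refine (e1.congr_of_eventuallyEq hev.symm).unique (this.congr_deriv ?_)
    rw [h3]
    simp
  have f3 : d3 = (t ^ 2 * (3 * z ^ 2) * (1 + w 0) + t ^ 2 * z ^ 3 * d1) / (u 0 * u 1) := by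
    have := ((((hasDerivAt_pow 3 z).const_mul (t ^ 2)).mul (e1.const_add 1)).add_const
      (t * u 2 ^ 2)).div_const (u 0 * u 1)
    refine e3.unique (this.congr_deriv ?_)
    rw [h1]
    simp
  have f2 : deriv (solve2 t u) z = (t ^ 2 * u 1 * d1 + t * (u 0 * (2 * w 2 + u 0)) * d3) / u 2 := by
    have := (((e1.const_add 1).const_mul (t ^ 2 * u 1)).add
      (((e3.mul_const (u 0)).mul (e3.add_const (u 0))).const_mul t)).div_const (u 2)
    refine HasDerivAt.deriv (this.congr_deriv ?_)
    rw [h3]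
    ring
  rw [f2, jac_eq, Matrix.det_fin_three]
  simp only [joinPoint, Matrix.cons_val, Matrix.of_apply, kappa, ← hz]
  field_simp at f1 f3 ⊢
  linear_combination (t ^ 4 * u 1 * z ^ 3 + t * u 0 * (2 * w 2 + u 0) * u 2) * f3 +
    (t ^ 2 * u 0 * u 1 ^ 2 + t ^ 3 * z ^ 3 * u 0 * (2 * w 2 + u 0)) * f1

end IsSmall

end

/-! ### The residue form as an integral over a fixed torus -/

noncomputable section

open MeasureTheory Metric

/-- The rational function `P_{1,3,5} / (P_1 P_3 P_5)` of `w = (x_1, x_2, x_3)`. -/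
def residueIntegrand (t : ℂ) (u w : Fin 3 → ℂ) : ℂ :=
  u 2 / (P7 t 0 (chart (joinPoint w u)) * P7 t 2 (chart (joinPoint w u)) *
    P7 t 4 (chart (joinPoint w u)))

namespace IsSmall

variable {t : ℂ} {u : Fin 3 → ℂ}

theorem residueIntegrand_eq (h : IsSmall t u) (w : Fin 3 → ℂ) : residueIntegrand t u w =
    (u 0 * u 1 * u 2)⁻¹ * ((w 1 - phi2 t u (w 0) (w 2))⁻¹ * (w 2 - phi3 t u (w 0) (w 1))⁻¹ *
      (w 0 - phi1 t u (w 1) (w 2))⁻¹) := by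
  rw [residueIntegrand, P7_zero_join h.ne_zero, P7_two_join h.ne_zero, P7_four_join h.ne_zero]
  have n2 := h.ne_zero 2
  simp only [div_eq_mul_inv, mul_inv]
  field_simp

theorem sub_ne_zero_of_norm {x y : ℂ} (hx : ‖x‖ = 1) (hy : ‖y‖ ≤ 1 / 8) : x - y ≠ 0 := by
  intro h
  rw [← sub_eq_zero.1 h, hx] at hy
  norm_num at hy

/-- The only pole in `|x_3| ≤ 1` is `phi3`: the other two factors have the form `w - phi` with `|w|
= 1` and `|phi| ≤ 1/8`. -/
theorem integral_w3 (h : IsSmall t u) {w1 w2 : ℂ} (h1 : ‖w1‖ = 1) (h2 : ‖w2‖ = 1) :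
    ∮ w3 in C(0, 1), residueIntegrand t u ![w1, w2, w3] =
      2 * Real.pi * Complex.I * ((u 0 * u 1 * u 2)⁻¹ * (1 - kappa t u w2)⁻¹ *
        (w2 - phi2 t u w1 (phi3 t u w1 w2))⁻¹ * (w1 - solve1 t u w2)⁻¹) := by
  have hB : phi3 t u w1 w2 ∈ ball (0 : ℂ) 1 := by
    rw [mem_ball_zero_iff]
    exact (h.phi3_le _ _ (by linarith) (by linarith)).trans_lt (by norm_num)
  have hd : DifferentiableOn ℂ (fun w3 => (u 0 * u 1 * u 2)⁻¹ *
      ((w2 - phi2 t u w1 w3)⁻¹ * (w1 - phi1 t u w2 w3)⁻¹)) (closedBall 0 1) := by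
    intro z hz
    rw [mem_closedBall_zero_iff] at hz
    refine DifferentiableAt.differentiableWithinAt ?_
    refine ((DifferentiableAt.fun_inv ?_ ?_).mul (DifferentiableAt.fun_inv ?_ ?_)).const_mul _
    · unfold phi2
      fun_prop
    · exact sub_ne_zero_of_norm h2 (h.phi2_le _ _ (by linarith) (by linarith))
    · unfold phi1
      fun_prop
    · exact sub_ne_zero_of_norm h1 (h.phi1_le _ _ (by linarith) (by linarith))
  have hint := hd.circleIntegral_sub_inv_smul hB
  rw [smul_eq_mul, sub_phi1_solve (by linarith) h, mul_inv (1 - _)] at hint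
  refine Eq.trans ?_ (hint.trans (by ring))
  refine circleIntegral.integral_congr (by norm_num) fun z _ => ?_
  simp only [residueIntegrand_eq h, smul_eq_mul, Matrix.cons_val]
  ring

/-- After the integration over `x_3` the only pole in `x_1` is `solve1`, because the factor
containing `phi2` has no zero while `|x_2| = 1`. -/
theorem integral_w1 (h : IsSmall t u) {w2 : ℂ} (h2 : ‖w2‖ = 1) :
    ∮ w1 in C(0, 1), ∮ w3 in C(0, 1), residueIntegrand t u ![w1, w2, w3] =
      (2 * Real.pi * Complex.I) ^ 2 * ((u 0 * u 1 * u 2)⁻¹ *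
        ((1 - kappa t u w2)⁻¹ / (w2 - solve2 t u w2))) := by
  have hB : solve1 t u w2 ∈ ball (0 : ℂ) 1 := by
    rw [mem_ball_zero_iff]
    exact (norm_solve1_le (by linarith) h).trans_lt (by norm_num)
  have hd : DifferentiableOn ℂ (fun w1 => 2 * Real.pi * Complex.I * ((u 0 * u 1 * u 2)⁻¹ *
      (1 - kappa t u w2)⁻¹ * (w2 - phi2 t u w1 (phi3 t u w1 w2))⁻¹)) (closedBall 0 1) := by
    intro z hz
    rw [mem_closedBall_zero_iff] at hz
    refine DifferentiableAt.differentiableWithinAt ?_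
    refine ((DifferentiableAt.fun_inv ?_ ?_).const_mul _).const_mul _
    · unfold phi2 phi3
      fun_prop
    · exact sub_ne_zero_of_norm h2 (h.phi2_le _ _ (by linarith)
        ((h.phi3_le _ _ (by linarith) (by linarith)).trans (by norm_num)))
  have hint := hd.circleIntegral_sub_inv_smul hB
  refine Eq.trans ?_ (hint.trans ?_)
  · refine circleIntegral.integral_congr (by norm_num) fun z hz => ?_
    rw [integral_w3 h (by simpa using hz) h2]
    simp only [smul_eq_mul]
    ring
  · rw [solve2, solve3, smul_eq_mul]
    ring

theorem continuousOn_residueIntegrand (h : IsSmall t u) :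
    ContinuousOn (residueIntegrand t u) {w | ∀ i, ‖w i‖ = 1} := by
  intro w hw
  refine ContinuousAt.continuousWithinAt ?_
  rw [funext (residueIntegrand_eq h)]
  refine continuousAt_const.mul (((ContinuousAt.inv₀ ?_ ?_).mul (ContinuousAt.inv₀ ?_ ?_)).mul
    (ContinuousAt.inv₀ ?_ ?_))
  · unfold phi2
    fun_prop
  · exact sub_ne_zero_of_norm (hw 1) (h.phi2_le _ _ (by rw [hw]; norm_num) (by rw [hw]; norm_num))
  · unfold phi3
    fun_prop
  · exact sub_ne_zero_of_norm (hw 2) (h.phi3_le _ _ (by rw [hw]; norm_num) (by rw [hw]; norm_num))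
  · unfold phi1
    fun_prop
  · exact sub_ne_zero_of_norm (hw 0) (h.phi1_le _ _ (by rw [hw]; norm_num) (by rw [hw]; norm_num))

theorem continuous_residueIntegrand_torusMap (h : IsSmall t u) :
    Continuous fun θ => residueIntegrand t u (torusMap 0 1 θ) := by
  refine (continuousOn_residueIntegrand h).comp_continuous ?_ fun θ i => ?_
  · unfold torusMap
    fun_prop
  · simp [torusMap]

/-- The iterated residue of `P_{1,3,5} / (P_1 P_3 P_5)` is an integral over a torus of fixed
radius. -/
theorem torusIntegral_residueIntegrand (h : IsSmall t u) {w : Fin 3 → ℂ} (hw : ‖w 1‖ < 1)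
    (hmem : joinPoint w u ∈ X7 t) : jac t (joinPoint w u) ≠ 0 ∧
      torusIntegral (residueIntegrand t u) 0 1 =
        (2 * Real.pi * Complex.I) ^ 3 * (u 2 / jac t (joinPoint w u)) := by
  have hb {z : ℂ} (hz : z ∈ ball (0 : ℂ) 2) : ‖z‖ ≤ 2 := (mem_ball_zero_iff.1 hz).le
  obtain ⟨hne, hint⟩ := circleIntegral_div_sub_fixedPoint (ψ := solve2 t u)
    (h := fun z => (1 - kappa t u z)⁻¹) (W := w 1)
    (fun z hz => (differentiableAt_solve2 (hb hz) h).differentiableWithinAt)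
    (fun z hz => (((differentiableAt_kappa z).const_sub 1).fun_inv
      (one_sub_kappa_ne (hb hz) h)).differentiableWithinAt)
    (fun z hz => norm_solve2_le (hb hz) h) (mem_ball_zero_iff.2 hw)
    (eq_solve_of_mem (by linarith) h hmem).2.2
  have hk := one_sub_kappa_ne (w2 := w 1) (by linarith) h
  have hd := sub_ne_zero.2 hne.symm
  have n0 := h.ne_zero 0
  have n1 := h.ne_zero 1
  have n2 := h.ne_zero 2
  rw [jac_eq_mul (by linarith) h hmem]
  refine ⟨by positivity, ?_⟩
  have hi : TorusIntegrable (residueIntegrand t u) 0 1 :=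
    (continuous_residueIntegrand_torusMap h).integrableOn_Icc
  -- The order of integration is `x_3`, then `x_1`, then `x_2`, so that the two equations that can
  -- be solved rationally come first and the fixed point equation last.
  have h3 : torusIntegral (residueIntegrand t u) 0 1 = ∮ w2 in C(0, 1), ∮ w1 in C(0, 1),
      ∮ w3 in C(0, 1), residueIntegrand t u ![w1, w2, w3] := by
    rw [torusIntegral_succAbove hi 1]
    refine circleIntegral.integral_congr (by norm_num) fun w2 hw2 => ?_
    rw [torusIntegral_succ]
    · refine circleIntegral.integral_congr (by norm_num) fun w1 hw1 => ?_
      rw [torusIntegral_dim1]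
      refine circleIntegral.integral_congr (by norm_num) fun w3 hw3 => ?_
      congr 1
      ext i
      fin_cases i <;> rfl
    · refine Continuous.integrableOn_Icc ?_
      refine (continuousOn_residueIntegrand h).comp_continuous ?_ fun θ i => ?_
      · unfold torusMap
        fun_prop
      · refine Fin.succAboveCases 1 ?_ (fun j => ?_) i
        · simpa using hw2
        · rw [Fin.insertNth_apply_succAbove]
          simp [torusMap]
  rw [h3]
  calc _ = ∮ w2 in C(0, 1), (2 * Real.pi * Complex.I) ^ 2 * ((u 0 * u 1 * u 2)⁻¹ *
        ((1 - kappa t u w2)⁻¹ / (w2 - solve2 t u w2))) :=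
        circleIntegral.integral_congr (by norm_num) fun w2 hw2 => integral_w1 h (by simpa using hw2)
    _ = _ := by
      rw [circleIntegral.integral_const_mul, circleIntegral.integral_const_mul, hint]
      field_simp

end IsSmall

end

/-! ### Expansion into Laurent monomials and the balanced ones -/

noncomputable section

open MeasureTheory Metric Finset

/-- The term of the expansion of `x_4 x_5 x_6 P_{1,3,5} / (P_1 P_3 P_5)` as a product of geometric
series. -/
def geomTerm (t : ℂ) (u : Fin 3 → ℂ) (d : ℕ × ℕ × ℕ) (w : Fin 3 → ℂ) : ℂ :=
  phi2 t u (w 0) (w 2) ^ d.1 * (w 1 ^ (d.1 + 1))⁻¹ *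
    (phi3 t u (w 0) (w 1) ^ d.2.1 * (w 2 ^ (d.2.1 + 1))⁻¹) *
    (phi1 t u (w 1) (w 2) ^ d.2.2 * (w 0 ^ (d.2.2 + 1))⁻¹)

/-- The indices of the monomials in `geomTerm`. -/
abbrev MonomialIndex := ℕ × ℕ × ℕ × ℕ × ℕ

/-- A finite set that contains the indices of the monomials of `geomTerm`. -/
def monomialIndices (d : ℕ × ℕ × ℕ) : Finset MonomialIndex :=
  range (d.1 + 1) ×ˢ range (d.2.1 + 1) ×ˢ range (d.2.2 + 1) ×ˢ range (d.1 + d.2.1 + 1) ×ˢ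
    range (d.1 + d.2.2 + 1)

/-- The coefficient of a monomial in `geomTerm`. -/
def monomialCoeff (d : ℕ × ℕ × ℕ) : MonomialIndex → ℕ
  | (A, s, m, p, q) => d.1.choose A * d.2.1.choose s * d.2.2.choose m * (A + s).choose p *
      (d.1 - A + m).choose q

/-- The exponent of `t` in a monomial of `geomTerm`. -/
def monomialDegree (d : ℕ × ℕ × ℕ) : MonomialIndex → ℕ
  | (A, s, m, _, _) => 2 * A + (d.1 - A) + (2 * s + (d.2.1 - s)) + (2 * m + (d.2.2 - m))

/-- The exponents of `x_1, x_2, x_3` in a monomial of `geomTerm`. -/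
def innerExponent (d : ℕ × ℕ × ℕ) : MonomialIndex → Fin 3 → ℤ
  | (A, s, m, p, q) => ![(p : ℤ) - (d.2.2 + 1 : ℕ), (3 * s + 3 * m : ℕ) - (d.1 + 1 : ℕ),
      (d.1 - A + q : ℕ) - (d.2.1 + 1 : ℕ)]

/-- The exponents of `x_4, x_5, x_6` in a monomial of `geomTerm`. -/
def outerExponent (d : ℕ × ℕ × ℕ) : MonomialIndex → Fin 3 → ℤ
  | (A, s, m, _, q) => ![(d.1 - A + (d.1 - A + m - q) : ℕ) - (d.2.1 : ℤ),
      (A + 2 * (d.2.2 - m) : ℕ) - (d.2.1 : ℤ), (2 * (d.2.1 - s) : ℕ) - (d.1 + d.2.2 : ℕ)]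

/-- The range is padded with zero terms so that the index set of the monomials is a product of
ranges. -/
theorem add_pow_range {x y : ℂ} {n N : ℕ} (h : n ≤ N) :
    (x + y) ^ n = ∑ p ∈ range (N + 1), x ^ p * y ^ (n - p) * n.choose p := by
  rw [add_pow]
  refine sum_subset (range_mono (by lia)) fun p _ hp => ?_
  rw [Nat.choose_eq_zero_of_lt (by simpa using hp), Nat.cast_zero, mul_zero]

theorem geomTerm_eq {t : ℂ} {u : Fin 3 → ℂ} (hu : ∀ i, u i ≠ 0) (d : ℕ × ℕ × ℕ) {w : Fin 3 → ℂ}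
    (hw : ∀ i, w i ≠ 0) : geomTerm t u d w = ∑ e ∈ monomialIndices d,
      (monomialCoeff d e * t ^ monomialDegree d e * ∏ b, u b ^ outerExponent d e b) *
        ∏ b, w b ^ innerExponent d e b := by
  obtain ⟨i, j, k⟩ := d
  have e2 : phi2 t u (w 0) (w 2) ^ i * (w 1 ^ (i + 1))⁻¹ = ∑ A ∈ range (i + 1),
      (t ^ 2 * u 1 * (1 + w 0)) ^ A * (t * (w 2 * u 0 * (w 2 + u 0))) ^ (i - A) * i.choose A /
        u 2 ^ i * (w 1 ^ (i + 1))⁻¹ := by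
    rw [phi2, div_pow, add_pow, sum_div, sum_mul]
  have e3 : phi3 t u (w 0) (w 1) ^ j * (w 2 ^ (j + 1))⁻¹ = ∑ s ∈ range (j + 1),
      (t ^ 2 * w 1 ^ 3 * (1 + w 0)) ^ s * (t * u 2 ^ 2) ^ (j - s) * j.choose s /
        (u 0 * u 1) ^ j * (w 2 ^ (j + 1))⁻¹ := by
    rw [phi3, div_pow, add_pow, sum_div, sum_mul]
  have e1 : phi1 t u (w 1) (w 2) ^ k * (w 0 ^ (k + 1))⁻¹ = ∑ m ∈ range (k + 1),
      (t ^ 2 * w 1 ^ 3 * (w 2 + u 0)) ^ m * (t * u 1 ^ 2) ^ (k - m) * k.choose m /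
        u 2 ^ k * (w 0 ^ (k + 1))⁻¹ := by
    rw [phi1, div_pow, add_pow, sum_div, sum_mul]
  simp only [geomTerm, e1, e2, e3, monomialIndices, sum_product]
  rw [mul_assoc, sum_mul]
  refine sum_congr rfl fun A hA => ?_
  rw [sum_mul, mul_sum]
  refine sum_congr rfl fun s hs => ?_
  rw [mul_sum, mul_sum]
  refine sum_congr rfl fun m hm => ?_
  rw [mem_range] at hA hs hm
  have q1 : (w 0 + 1) ^ (A + s) = _ := add_pow_range (N := i + j) (by lia)
  have q2 : (w 2 + u 0) ^ (i - A + m) = _ := add_pow_range (N := i + k) (by lia)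
  rw [add_comm (w 0) 1] at q1
  calc _ = i.choose A * j.choose s * k.choose m * t ^ monomialDegree (i, j, k) (A, s, m, 0, 0) *
        (1 + w 0) ^ (A + s) * ((w 2 + u 0) ^ (i - A + m) *
        (w 2 ^ (i - A) * u 0 ^ (i - A) * u 1 ^ (A + 2 * (k - m)) * u 2 ^ (2 * (j - s)) *
          w 1 ^ (3 * s + 3 * m) * ((u 0 * u 1) ^ j * u 2 ^ (i + k) * w 1 ^ (i + 1) *
            w 2 ^ (j + 1) * w 0 ^ (k + 1))⁻¹)) := by
        simp only [monomialDegree, mul_pow, ← pow_mul, div_eq_mul_inv, mul_inv, pow_add]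
        ring
    _ = _ := by
        rw [q1, q2, mul_sum, sum_mul]
        refine sum_congr rfl fun p _ => ?_
        rw [sum_mul, mul_sum]
        refine sum_congr rfl fun q _ => ?_
        simp only [monomialCoeff, monomialDegree, outerExponent, innerExponent,
          Fin.prod_univ_three, Matrix.cons_val, zpow_sub₀ (hu _), zpow_sub₀ (hw _),
          zpow_natCast, div_eq_mul_inv, mul_pow, mul_inv]
        push_cast
        ring

/-- The undeformed case `h = 0` of the integral of a Laurent monomial; `dw = w d log w` shifts the
exponents by one. -/
theorem torusIntegral_prod_zpow (n : Fin 3 → ℤ) :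
    torusIntegral (fun w => ∏ b, w b ^ n b) 0 1 =
      if n = -1 then (2 * Real.pi * Complex.I) ^ 3 else 0 := by
  have h := integral_exp_mul_torusJac (h := fun _ _ => 0) (fun _ => contDiff_const)
    (fun _ _ _ => rfl) (n + 1)
  have hiff : n + 1 = 0 ↔ n = -1 := add_eq_zero_iff_eq_neg
  simp only [hiff] at h
  rw [← h, torusIntegral]
  refine congrArg _ (funext fun θ => ?_)
  have hj : torusJac (fun b x => (x b : ℂ) * Complex.I + 0) θ = Complex.I ^ 3 := by
    simp only [add_zero, torusJac, pderiv3_angle]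
    simp [Matrix.det_fin_three]
  rw [hj, Complex.exp_sum, smul_eq_mul, Fin.prod_univ_three, Fin.prod_univ_three,
    Fin.prod_univ_three]
  have he (b : Fin 3) : Complex.exp (((n + 1) b : ℤ) * ((θ b : ℂ) * Complex.I + 0)) =
      Complex.exp (θ b * Complex.I) * Complex.exp (θ b * Complex.I) ^ n b := by
    rw [add_zero, Complex.exp_int_mul, Pi.add_apply, Pi.one_apply,
      zpow_add_one₀ (Complex.exp_ne_zero _), mul_comm]
  simp only [he, torusMap, Pi.zero_apply, Pi.one_apply, Complex.ofReal_one, zero_add, one_mul]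
  ring

theorem torusMap_ne_zero (θ : Fin 3 → ℝ) (i : Fin 3) : torusMap 0 1 θ i ≠ 0 := by
  simp [torusMap, Complex.exp_ne_zero]

theorem torusIntegral_geomTerm {t : ℂ} {u : Fin 3 → ℂ} (hu : ∀ i, u i ≠ 0) (d : ℕ × ℕ × ℕ) :
    torusIntegral (geomTerm t u d) 0 1 = ∑ e ∈ monomialIndices d,
      (monomialCoeff d e * t ^ monomialDegree d e * ∏ b, u b ^ outerExponent d e b) *
        if innerExponent d e = -1 then (2 * Real.pi * Complex.I) ^ 3 else 0 := by
  simp only [← torusIntegral_prod_zpow, torusIntegral]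
  simp only [geomTerm_eq hu d (torusMap_ne_zero _), smul_eq_mul, mul_sum]
  rw [integral_finsetSum]
  · refine sum_congr rfl fun e _ => ?_
    rw [← integral_const_mul]
    refine congrArg _ (funext fun θ => ?_)
    ring
  · intro e _
    refine Continuous.integrableOn_Icc ?_
    refine Continuous.mul (by fun_prop) (continuous_const.mul ?_)
    refine continuous_finsetProd _ fun b _ => ?_
    refine Continuous.zpow₀ ?_ _ fun θ => Or.inl (torusMap_ne_zero θ b)
    unfold torusMap
    fun_prop

/-- The sum of the coefficients of the monomials of `geomTerm` with nonzero residue. -/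
def balancedSum (t : ℂ) (d : ℕ × ℕ × ℕ) : ℂ :=
  ∑ e ∈ monomialIndices d, monomialCoeff d e * t ^ monomialDegree d e *
    if innerExponent d e = -1 ∧ outerExponent d e = 0 then 1 else 0

/-- Six linear equations for eight exponents; the free parameters `k` and `s` become the indices of
the double sum. The bound on `q` protects a truncated subtraction; beyond it the binomial
coefficient is zero. -/
theorem exponents_balanced_iff {i j k A s m p q : ℕ} (hA : A ≤ i) (hs : s ≤ j) (hm : m ≤ k)
    (hq : q ≤ i - A + m) :
    innerExponent (i, j, k) (A, s, m, p, q) = -1 ∧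
      outerExponent (i, j, k) (A, s, m, p, q) = 0 ↔
    i = 3 * k ∧ j = 2 * k + s ∧ A + s = 2 * k ∧ m + s = k ∧ p = k ∧ q = k := by
  simp only [innerExponent, outerExponent, funext_iff, Fin.forall_fin_succ, Matrix.cons_val_zero,
    Matrix.cons_val_succ, Pi.neg_apply, Pi.one_apply, Pi.zero_apply, IsEmpty.forall_iff, and_true]
  omega

theorem balancedSum_eq_zero (t : ℂ) {d : ℕ × ℕ × ℕ}
    (hd : d ∉ Set.range fun x : ℕ × ℕ => (3 * x.1, 2 * x.1 + x.2, x.1)) : balancedSum t d = 0 := by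
  obtain ⟨i, j, k⟩ := d
  refine sum_eq_zero fun e he => ?_
  obtain ⟨A, s, m, p, q⟩ := e
  simp only [monomialIndices, mem_product, mem_range, Nat.lt_succ_iff] at he
  by_cases hq : q ≤ i - A + m
  · rw [if_neg, mul_zero]
    rw [exponents_balanced_iff he.1 he.2.1 he.2.2.1 hq]
    rintro ⟨rfl, rfl, -⟩
    exact hd ⟨(k, s), rfl⟩
  · simp [monomialCoeff, Nat.choose_eq_zero_of_lt (not_le.1 hq)]

/-- For `s ≤ n` the only balanced monomial is `(A, s, m, p, q) = (2n - s, s, n - s, n, n)`. Its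
degree in `t` is `9n`, which is why the period depends on `t^9`. -/
theorem balancedSum_eq (t : ℂ) (n s : ℕ) : balancedSum t (3 * n, 2 * n + s, n) =
    ((2 * n).choose n ^ 2 * innerTerm n s : ℕ) * (t ^ 9) ^ n := by
  by_cases hsn : s ≤ n
  · rw [balancedSum, sum_eq_single (2 * n - s, s, n - s, n, n)]
    · rw [if_pos ((exponents_balanced_iff (by lia) (by lia) (by lia) (by lia)).2
        ⟨rfl, rfl, by lia, by lia, rfl, rfl⟩)]
      have h1 : monomialDegree (3 * n, 2 * n + s, n) (2 * n - s, s, n - s, n, n) = 9 * n := by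
        simp only [monomialDegree]
        lia
      have h2 : monomialCoeff (3 * n, 2 * n + s, n) (2 * n - s, s, n - s, n, n) =
          (2 * n).choose n ^ 2 * innerTerm n s := by
        simp only [monomialCoeff, innerTerm]
        rw [show 2 * n - s + s = 2 * n by lia, show 3 * n - (2 * n - s) + (n - s) = 2 * n by lia,
          Nat.choose_symm hsn, ← Nat.choose_symm (show 2 * n - s ≤ 3 * n by lia),
          show 3 * n - (2 * n - s) = n + s by lia]
        ring
      rw [h1, h2, mul_one, pow_mul]
    · intro e he hne
      obtain ⟨A, r, m, p, q⟩ := e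
      simp only [monomialIndices, mem_product, mem_range, Nat.lt_succ_iff] at he
      by_cases hq : q ≤ 3 * n - A + m
      · rw [if_neg, mul_zero]
        rw [exponents_balanced_iff he.1 he.2.1 he.2.2.1 hq]
        rintro ⟨-, h1, h2, h3, h4, h5⟩
        refine hne ?_
        simp only [Prod.mk.injEq]
        lia
      · simp [monomialCoeff, Nat.choose_eq_zero_of_lt (not_le.1 hq)]
    · intro h
      refine absurd ?_ h
      simp only [monomialIndices, mem_product, mem_range]
      lia
  · have h0 : innerTerm n s = 0 := by
      rw [innerTerm, Nat.choose_eq_zero_of_lt (not_le.1 hsn), mul_zero]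
    rw [h0, mul_zero, Nat.cast_zero, zero_mul]
    refine sum_eq_zero fun e he => ?_
    obtain ⟨A, r, m, p, q⟩ := e
    simp only [monomialIndices, mem_product, mem_range, Nat.lt_succ_iff] at he
    by_cases hq : q ≤ 3 * n - A + m
    · rw [if_neg, mul_zero]
      rw [exponents_balanced_iff he.1 he.2.1 he.2.2.1 hq]
      lia
    · simp [monomialCoeff, Nat.choose_eq_zero_of_lt (not_le.1 hq)]

/-- The sum over the balanced monomials is the fundamental period. -/
theorem eq_fundamentalPeriod_of_hasSum {t S : ℂ} (ht : ‖t ^ 9‖ < 1 / 8192)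
    (h : HasSum (balancedSum t) S) : S = fundamentalPeriod (t ^ 9) := by
  have hinj : Function.Injective fun x : ℕ × ℕ => (3 * x.1, 2 * x.1 + x.2, x.1) := by
    rintro ⟨n, s⟩ ⟨n', s'⟩ hx
    simp only [Prod.mk.injEq] at hx ⊢
    lia
  -- Only the triples in the image of `(n, s)` contribute; summing over `s` first yields the period
  -- coefficients.
  rw [← hinj.hasSum_iff fun d hd => balancedSum_eq_zero t hd] at h
  refine (h.prod_fiberwise fun n => ?_).unique (hasSum_fundamentalPeriod ht)
  simp only [Function.comp_def, balancedSum_eq]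
  have hz : ∀ s ∉ range (n + 1),
      (((2 * n).choose n ^ 2 * innerTerm n s : ℕ) : ℂ) * (t ^ 9) ^ n = 0 := by
    intro s hs
    rw [innerTerm, Nat.choose_eq_zero_of_lt (by simpa using hs : n < s)]
    simp
  convert! hasSum_sum_of_ne_finset_zero (L := SummationFilter.unconditional ℕ) hz using 1
  rw [periodCoeff, innerSum, ← sum_mul, mul_sum]
  push_cast
  rfl

end

/-! ### Estimates and convergence of the expansion -/

noncomputable section

open MeasureTheory Metric

/-- Each function is bounded by a constant times `K^4 ‖t‖`; the largest constant, `64`, comes from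
`kappa`, and `512 = 8 * 64`. -/
theorem isSmall_of_norm_le {t : ℂ} {u : Fin 3 → ℂ} {K : ℝ} (hK : 1 ≤ K) (h0 : ∀ i, u i ≠ 0)
    (hu : ∀ i, ‖u i‖ ≤ K) (hu' : ∀ i, ‖u i‖⁻¹ ≤ K) (ht : 512 * K ^ 4 * ‖t‖ ≤ 1) :
    IsSmall t u := by
  have hK0 : 0 ≤ K := by linarith
  have hK2 : K ≤ K ^ 2 := le_self_pow₀ hK (by norm_num)
  have hK34 : K ^ 3 ≤ K ^ 4 := pow_le_pow_right₀ hK (by norm_num)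
  have hK24 : K ^ 2 ≤ K ^ 4 := pow_le_pow_right₀ hK (by norm_num)
  have hK4 : 1 ≤ K ^ 4 := one_le_pow₀ hK
  have htn := norm_nonneg t
  have ht1 : ‖t‖ ≤ 1 := by nlinarith
  have ht2 : ‖t‖ ^ 2 ≤ ‖t‖ := pow_le_of_le_one htn ht1 (by norm_num)
  have ht4 : ‖t‖ ^ 4 ≤ ‖t‖ := pow_le_of_le_one htn ht1 (by norm_num)
  refine ⟨h0, fun w2 w3 h2 h3 => ?_, fun w1 w3 h1 h3 => ?_, fun w1 w2 h1 h2 => ?_,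
    fun w2 h2 => ?_⟩
  · calc ‖phi1 t u w2 w3‖
        ≤ (‖t‖ ^ 2 * ‖w2‖ ^ 3 * (‖w3‖ + ‖u 0‖) + ‖t‖ * ‖u 1‖ ^ 2) * ‖u 2‖⁻¹ := by
          rw [phi1, norm_div, div_eq_mul_inv]
          gcongr
          refine (norm_add_le _ _).trans ?_
          simp only [norm_mul, norm_pow]
          gcongr
          exact norm_add_le _ _
      _ ≤ (‖t‖ * 2 ^ 3 * (2 + K) + ‖t‖ * K ^ 2) * K := by
          gcongr
          exacts [hu 0, hu 1, hu' 2]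
      _ ≤ 25 * K ^ 4 * ‖t‖ := by nlinarith [mul_nonneg htn hK0]
      _ ≤ 1 / 8 := by nlinarith
  · calc ‖phi2 t u w1 w3‖
        ≤ (‖t‖ ^ 2 * ‖u 1‖ * (1 + ‖w1‖) + ‖t‖ * (‖w3‖ * ‖u 0‖ * (‖w3‖ + ‖u 0‖))) * ‖u 2‖⁻¹ := by
          rw [phi2, norm_div, div_eq_mul_inv]
          gcongr
          refine (norm_add_le _ _).trans ?_
          simp only [norm_mul, norm_pow]
          gcongr
          · exact (norm_add_le _ _).trans (by rw [norm_one])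
          · exact norm_add_le _ _
      _ ≤ (‖t‖ * K * (1 + 2) + ‖t‖ * (2 * K * (2 + K))) * K := by
          gcongr
          exacts [hu 1, hu 0, hu 0, hu' 2]
      _ ≤ 9 * K ^ 4 * ‖t‖ := by nlinarith [mul_nonneg htn hK0]
      _ ≤ 1 / 8 := by nlinarith
  · calc ‖phi3 t u w1 w2‖
        ≤ (‖t‖ ^ 2 * ‖w2‖ ^ 3 * (1 + ‖w1‖) + ‖t‖ * ‖u 2‖ ^ 2) * (‖u 0‖⁻¹ * ‖u 1‖⁻¹) := by
          rw [phi3, norm_div, div_eq_mul_inv, norm_mul, mul_inv]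
          gcongr
          refine (norm_add_le _ _).trans ?_
          simp only [norm_mul, norm_pow]
          gcongr
          exact (norm_add_le _ _).trans (by rw [norm_one])
      _ ≤ (‖t‖ * 2 ^ 3 * (1 + 2) + ‖t‖ * K ^ 2) * (K * K) := by
          gcongr
          exacts [hu 2, hu' 0, hu' 1]
      _ ≤ 25 * K ^ 4 * ‖t‖ := by nlinarith [mul_nonneg htn hK0]
      _ ≤ 1 / 8 := by nlinarith
  · calc ‖kappa t u w2‖
        = ‖t‖ ^ 4 * ‖w2‖ ^ 6 * (‖u 0‖⁻¹ * ‖u 1‖⁻¹ * ‖u 2‖⁻¹) := by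
          simp only [kappa, norm_mul, norm_pow, norm_inv, div_eq_mul_inv, mul_inv]
      _ ≤ ‖t‖ * 2 ^ 6 * (K * K * K) := by
          gcongr
          exacts [hu' 0, hu' 1, hu' 2]
      _ ≤ 64 * K ^ 4 * ‖t‖ := by nlinarith [mul_nonneg htn hK0]
      _ ≤ 1 / 8 := by nlinarith

theorem volume_cube_lt_top : volume cube < ⊤ := measure_Icc_lt_top

theorem hasSum_integral_cube {ι : Type*} [Countable ι] {F : ι → (Fin 3 → ℝ) → ℂ}
    {G : (Fin 3 → ℝ) → ℂ} {b : ι → ℝ} (hF : ∀ i, Continuous (F i)) (hb : Summable b)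
    (hbound : ∀ i, ∀ θ ∈ cube, ‖F i θ‖ ≤ b i) (hs : ∀ θ ∈ cube, HasSum (fun i => F i θ) (G θ)) :
    HasSum (fun i => ∫ θ in cube, F i θ) (∫ θ in cube, G θ) := by
  refine hasSum_integral_of_dominated_convergence (fun i _ => b i)
    (fun i => (hF i).aestronglyMeasurable) (fun i => ?_) (ae_of_all _ fun _ => hb) ?_ ?_
  · exact (ae_restrict_iff' measurableSet_Icc).2 (ae_of_all _ (hbound i))
  · exact integrableOn_const volume_cube_lt_top.ne
  · exact (ae_restrict_iff' measurableSet_Icc).2 (ae_of_all _ hs)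

theorem hasSum_geometric_inv {x y : ℂ} (hx : ‖x‖ = 1) (hy : ‖y‖ ≤ 1 / 8) :
    HasSum (fun n : ℕ => y ^ n * (x ^ (n + 1))⁻¹) (x - y)⁻¹ := by
  have hx0 : x ≠ 0 := norm_ne_zero_iff.1 (by rw [hx]; norm_num)
  have h := (hasSum_geometric_of_norm_lt_one (ξ := y / x)
    (by rw [norm_div, hx, div_one]; linarith)).mul_left x⁻¹
  rw [← mul_inv, mul_sub, mul_one, mul_div_cancel₀ _ hx0] at h
  refine h.congr_fun fun n => ?_
  rw [div_pow, pow_succ, mul_inv]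
  ring

theorem hasSum_mul_mul {f g k : ℕ → ℂ} {a b c : ℂ} (hf : HasSum f a) (hg : HasSum g b)
    (hk : HasSum k c) : HasSum (fun d : ℕ × ℕ × ℕ => f d.1 * g d.2.1 * k d.2.2) (a * b * c) := by
  obtain ⟨l, hl⟩ : ∃ l : ℕ × ℕ → ℂ, l = fun x => g x.1 * k x.2 := ⟨_, rfl⟩
  have h1 : HasSum l (b * c) := by
    rw [hl]
    exact hg.mul hk (summable_mul_of_summable_norm hg.summable.norm hk.summable.norm)
  have h2 := hf.mul h1 (summable_mul_of_summable_norm hf.summable.norm h1.summable.norm)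
  simpa only [hl, ← mul_assoc] using h2

/-- The geometric majorant of the expansion. -/
def geomBound (d : ℕ × ℕ × ℕ) : ℝ := (1 / 8) ^ d.1 * ((1 / 8) ^ d.2.1 * (1 / 8) ^ d.2.2)

theorem summable_geomBound : Summable geomBound := by
  have h : Summable fun n : ℕ => (1 / 8 : ℝ) ^ n :=
    summable_geometric_of_lt_one (by norm_num) (by norm_num)
  have h2 := h.mul_of_nonneg h (fun _ => by positivity) (fun _ => by positivity)
  exact h.mul_of_nonneg h2 (fun _ => by positivity) (fun _ => by positivity)

namespace IsSmall

variable {t : ℂ} {u : Fin 3 → ℂ}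

theorem norm_geomTerm_le (h : IsSmall t u) (d : ℕ × ℕ × ℕ) {w : Fin 3 → ℂ}
    (hw : ∀ i, ‖w i‖ = 1) : ‖geomTerm t u d w‖ ≤ geomBound d := by
  have h1 := h.phi1_le (w 1) (w 2) (by rw [hw]; norm_num) (by rw [hw]; norm_num)
  have h2 := h.phi2_le (w 0) (w 2) (by rw [hw]; norm_num) (by rw [hw]; norm_num)
  have h3 := h.phi3_le (w 0) (w 1) (by rw [hw]; norm_num) (by rw [hw]; norm_num)
  simp only [geomTerm, geomBound, norm_mul, norm_inv, norm_pow, hw, one_pow, inv_one, mul_one,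
    one_mul, mul_assoc]
  gcongr

theorem hasSum_geomTerm (h : IsSmall t u) {w : Fin 3 → ℂ} (hw : ∀ i, ‖w i‖ = 1) :
    HasSum (fun d => geomTerm t u d w) (u 0 * u 1 * u 2 * residueIntegrand t u w) := by
  have h1 := hasSum_geometric_inv (hw 0)
    (h.phi1_le (w 1) (w 2) (by rw [hw]; norm_num) (by rw [hw]; norm_num))
  have h2 := hasSum_geometric_inv (hw 1)
    (h.phi2_le (w 0) (w 2) (by rw [hw]; norm_num) (by rw [hw]; norm_num))
  have h3 := hasSum_geometric_inv (hw 2)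
    (h.phi3_le (w 0) (w 1) (by rw [hw]; norm_num) (by rw [hw]; norm_num))
  rw [residueIntegrand_eq h, mul_inv_cancel_left₀
    (mul_ne_zero (mul_ne_zero (h.ne_zero 0) (h.ne_zero 1)) (h.ne_zero 2))]
  have h4 := hasSum_mul_mul h2 h3 h1
  have h5 : (fun d => geomTerm t u d w) = fun d =>
      phi2 t u (w 0) (w 2) ^ d.1 * (w 1 ^ (d.1 + 1))⁻¹ *
        (phi3 t u (w 0) (w 1) ^ d.2.1 * (w 2 ^ (d.2.1 + 1))⁻¹) *
        (phi1 t u (w 1) (w 2) ^ d.2.2 * (w 0 ^ (d.2.2 + 1))⁻¹) := rfl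
  rw [h5]
  beta_reduce at h4
  exact h4

/-- The torus integral as a series of Laurent polynomials in `u = (x_4, x_5, x_6)`. -/
theorem hasSum_torusIntegral (h : IsSmall t u) :
    HasSum (fun d => torusIntegral (geomTerm t u d) 0 1)
      (u 0 * u 1 * u 2 * torusIntegral (residueIntegrand t u) 0 1) := by
  have hn (θ : Fin 3 → ℝ) (i : Fin 3) : ‖torusMap 0 1 θ i‖ = 1 := by simp [torusMap]
  rw [← torusIntegral_const_mul]
  refine hasSum_integral_cube (b := geomBound) (fun d => ?_) summable_geomBound
    (fun d θ _ => ?_) fun θ _ => ?_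
  · have hc (i : Fin 3) : Continuous fun θ => torusMap (0 : Fin 3 → ℂ) 1 θ i := by
      unfold torusMap
      fun_prop
    have hi (i : Fin 3) (n : ℕ) : Continuous fun θ => (torusMap (0 : Fin 3 → ℂ) 1 θ i ^ n)⁻¹ :=
      ((hc i).pow n).inv₀ fun θ => pow_ne_zero _ (torusMap_ne_zero θ i)
    have hg : Continuous fun θ => geomTerm t u d (torusMap 0 1 θ) := by
      simp only [geomTerm, phi1, phi2, phi3]
      fun_prop
    have he : Continuous fun θ : Fin 3 → ℝ =>
        ∏ i, (((1 : Fin 3 → ℝ) i : ℂ) * Complex.exp (θ i * Complex.I) * Complex.I) := by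
      fun_prop
    exact he.smul hg
  · rw [norm_smul]
    have : ‖∏ i : Fin 3, ((1 : Fin 3 → ℝ) i : ℂ) * Complex.exp (θ i * Complex.I) * Complex.I‖ = 1 := by
      simp
    rw [this, one_mul]
    exact norm_geomTerm_le h d (hn θ)
  · exact (hasSum_geomTerm h (hn θ)).const_smul _

theorem norm_torusIntegral_geomTerm_le (h : IsSmall t u) (d : ℕ × ℕ × ℕ) :
    ‖torusIntegral (geomTerm t u d) 0 1‖ ≤ (2 * Real.pi) ^ 3 * geomBound d := by
  refine (norm_torusIntegral_le_of_norm_le_const (C := geomBound d)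
    fun θ => norm_geomTerm_le h d fun i => ?_).trans (by simp)
  simp [torusMap]

end IsSmall

end

/-! ### The period of a torus close to the initial one -/

noncomputable section

open MeasureTheory Metric

/-- A function on the torus takes all its values on the fundamental cube. -/
theorem exists_mem_cube_eq {X : Type*} {g : (Fin 3 → ℝ) → X}
    (hg : ∀ θ k, g (θ + Pi.single k (2 * Real.pi)) = g θ) (θ : Fin 3 → ℝ) :
    ∃ θ' ∈ cube, g θ' = g θ := by
  have hz (k : Fin 3) (n : ℤ) (θ : Fin 3 → ℝ) :
      g (θ + n • Pi.single k (2 * Real.pi)) = g θ :=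
    (show Function.Periodic g (Pi.single k (2 * Real.pi)) from fun θ => hg θ k).zsmul n θ
  refine ⟨fun k => toIcoMod Real.two_pi_pos 0 (θ k), ?_, ?_⟩
  · have h (k) := toIcoMod_mem_Ico Real.two_pi_pos 0 (θ k)
    exact ⟨fun k => (h k).1, fun k => by simpa using (h k).2.le⟩
  · rw [← hz 0 (toIcoDiv Real.two_pi_pos 0 (θ 0)), ← hz 1 (toIcoDiv Real.two_pi_pos 0 (θ 1)),
      ← hz 2 (toIcoDiv Real.two_pi_pos 0 (θ 2))]
    congr 1
    ext k
    fin_cases k <;> simp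

theorem joinPoint_eq (y : Fin 6 → ℂ) :
    joinPoint (fun b => y (Fin.castAdd 3 b)) (fun b => y (Fin.natAdd 3 b)) = y := by
  ext i
  fin_cases i <;> rfl

/-- The period of a torus in the small region around `w = 0` that winds once around the axes
`x_4, x_5, x_6`. -/
theorem period_eq_of_isSmall {t : ℂ} {γ : ℂ → (Fin 3 → ℝ) → (Fin 6 → ℂ)}
    (ht : ‖t ^ 9‖ < 1 / 8192) {h : Fin 3 → (Fin 3 → ℝ) → ℂ} (hh : ∀ i, ContDiff ℝ ∞ (h i))
    (hp : ∀ i, IsTorusPeriodic (h i)) (hmem : ∀ θ, γ t θ ∈ X7 t) (hγ : Differentiable ℝ (γ t))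
    (hu : ∀ θ b, γ t θ (Fin.natAdd 3 b) = Complex.exp (θ b * Complex.I + h b θ))
    (hw : ∀ θ, ‖γ t θ 1‖ < 1)
    (hs : ∀ θ, IsSmall t fun b => γ t θ (Fin.natAdd 3 b)) :
    period γ t = fundamentalPeriod (t ^ 9) := by
  set L : Fin 3 → (Fin 3 → ℝ) → ℂ := fun b x => (x b : ℂ) * Complex.I + h b x with hLdef
  set u : (Fin 3 → ℝ) → Fin 3 → ℂ := fun θ b => γ t θ (Fin.natAdd 3 b) with hudef
  have hL (i) : ContDiff ℝ ∞ (L i) := (contDiff_angle i).add (hh i)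
  have hue (b) : (fun θ => u θ b) = fun θ => Complex.exp (L b θ) := funext fun θ => hu θ b
  have hune (θ b) : u θ b ≠ 0 := (hs θ).ne_zero b
  have huc (b) : Continuous fun θ => u θ b := by
    rw [hue]
    exact (hL b).continuous.cexp
  have hJc : Continuous (torusJac L) := (contDiff_torusJac hL).continuous
  obtain ⟨C, hC⟩ : ∃ C, ∀ θ ∈ cube, ‖torusJac L θ‖ ≤ C :=
    isCompact_Icc.exists_bound_of_continuousOn hJc.continuousOn
  have hpi : (2 * (Real.pi : ℂ) * Complex.I) ≠ 0 := Complex.two_pi_I_ne_zero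
  -- The form `dx_4 ∧ dx_5 ∧ dx_6` is `u_0 u_1 u_2` times the wedge of the `d log u_b`. Three
  -- factors `2πi` come from the form and three from the residue integral, hence the sixth power.
  have hintegrand (θ : Fin 3 → ℝ) :
      alpha t (γ t θ) (fun a => fderiv ℝ (γ t) θ (Pi.single a 1)) =
        ((2 * Real.pi * Complex.I) ^ 6)⁻¹ * (u θ 0 * u θ 1 * u θ 2 *
          torusIntegral (residueIntegrand t (u θ)) 0 1) * torusJac L θ := by
    have hj := joinPoint_eq (γ t θ)
    obtain ⟨hne, hr⟩ := (hs θ).torusIntegral_residueIntegrand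
      (w := fun b => γ t θ (Fin.castAdd 3 b)) (hw θ) (by rw [hj]; exact hmem θ)
    rw [hj] at hne hr
    have hdet : (Matrix.of fun a b : Fin 3 => fderiv ℝ (γ t) θ (Pi.single a 1)
        (Fin.natAdd 3 b)).det = u θ 0 * u θ 1 * u θ 2 * torusJac L θ := by
      have hm := Matrix.det_mul_row (u θ) (Matrix.of fun a b : Fin 3 => pderiv3 a (L b) θ)
      rw [Fin.prod_univ_three] at hm
      rw [torusJac, ← hm]
      congr 1
      ext a b
      have h1 : HasFDerivAt (fun θ => u θ b) _ θ :=
        (hasFDerivAt_pi'.1 (hγ θ).hasFDerivAt (Fin.natAdd 3 b))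
      have h2 : HasFDerivAt (fun θ => Complex.exp (L b θ)) _ θ :=
        (((hL b).differentiable (by simp)) θ).hasFDerivAt.cexp
      rw [← hue] at h2
      have h3 := DFunLike.congr_fun (h1.unique h2) (Pi.single a 1)
      rw [Matrix.of_apply, Matrix.of_apply, Matrix.of_apply]
      refine h3.trans ?_
      rw [← congrFun (hue b) θ]
      rfl
    have hc : P7_135 t (chart (γ t θ)) = u θ 2 := P7_135_chart _ _
    rw [alpha, hdet, hr, hc]
    change _ = _ * (_ * ((2 * Real.pi * Complex.I) ^ 3 * (u θ 2 / _))) * _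
    field_simp
  have hsum : HasSum (fun d => ∫ θ in cube, ((2 * Real.pi * Complex.I) ^ 6)⁻¹ *
      torusIntegral (geomTerm t (u θ) d) 0 1 * torusJac L θ) (period γ t) := by
    unfold period
    simp only [hintegrand]
    refine hasSum_integral_cube
      (b := fun d => ((2 * Real.pi) ^ 6)⁻¹ * ((2 * Real.pi) ^ 3 * geomBound d) * C) (fun d => ?_)
      (((summable_geomBound.mul_left _).mul_left _).mul_right _) (fun d θ hθ => ?_) fun θ _ => ?_
    · refine (continuous_const.mul ?_).mul hJc
      simp only [torusIntegral_geomTerm (hune _)]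
      refine continuous_finsetSum _ fun e _ => (continuous_const.mul ?_).mul continuous_const
      exact continuous_finsetProd _ fun b _ => (huc b).zpow₀ _ fun θ => Or.inl (hune θ b)
    · have hn : ‖((2 * (Real.pi : ℂ) * Complex.I) ^ 6)⁻¹‖ = ((2 * Real.pi) ^ 6)⁻¹ := by
        simp [abs_of_pos Real.pi_pos]
      rw [norm_mul, norm_mul, hn]
      gcongr
      · have : 0 ≤ geomBound d := by
          unfold geomBound
          positivity
        positivity
      · exact (hs θ).norm_torusIntegral_geomTerm_le d
      · exact hC θ hθ
    · exact (((hs θ).hasSum_torusIntegral).mul_left _).mul_right _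
  refine eq_fundamentalPeriod_of_hasSum ht (hsum.congr_fun fun d => ?_)
  have hexp (θ) (m : Fin 3 → ℤ) :
      ∏ b, u θ b ^ m b = Complex.exp (∑ b, m b * ((θ b : ℂ) * Complex.I + h b θ)) := by
    rw [Complex.exp_sum]
    refine Finset.prod_congr rfl fun b _ => ?_
    rw [Complex.exp_int_mul, ← hu]
  simp only [torusIntegral_geomTerm (hune _), Finset.mul_sum, Finset.sum_mul, hexp]
  rw [integral_finsetSum]
  · rw [balancedSum]
    refine Finset.sum_congr rfl fun e _ => ?_
    -- The cycle enters only through its winding: this value does not depend on the deformation `h`.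
    have hI := integral_exp_mul_torusJac hh hp (outerExponent d e)
    by_cases hi : innerExponent d e = -1
    · calc _ = monomialCoeff d e * t ^ monomialDegree d e *
            (if innerExponent d e = -1 ∧ outerExponent d e = 0 then 1 else 0) := ?_
        _ = ∫ θ in cube, (((2 * Real.pi * Complex.I) ^ 6)⁻¹ * monomialCoeff d e *
              t ^ monomialDegree d e * (2 * Real.pi * Complex.I) ^ 3) *
              (Complex.exp (∑ b, outerExponent d e b * ((θ b : ℂ) * Complex.I + h b θ)) *
                torusJac L θ) := by
            rw [integral_const_mul, hI]
            simp only [hi, true_and]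
            split_ifs
            · field_simp
            · simp
        _ = _ := by
            refine congrArg _ (funext fun θ => ?_)
            rw [if_pos hi]
            ring
      rfl
    · simp [hi]
  · intro e _
    refine Continuous.integrableOn_Icc ?_
    have : Continuous fun θ => Complex.exp
        (∑ b, outerExponent d e b * ((θ b : ℂ) * Complex.I + h b θ)) :=
      (continuous_finsetSum _ fun b _ => continuous_const.mul (hL b).continuous).cexp
    fun_prop

end

/-! ### Arbitrary families of torus cycles -/

noncomputable section

open MeasureTheory Metric

theorem exp_angle_periodic (b : Fin 3) (θ : Fin 3 → ℝ) (k : Fin 3) :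
    Complex.exp ((θ + Pi.single k (2 * Real.pi) : Fin 3 → ℝ) b * Complex.I) =
      Complex.exp (θ b * Complex.I) := by
  by_cases h : b = k
  · subst h
    rw [Pi.add_apply, Pi.single_eq_same, Complex.ofReal_add, add_mul, Complex.exp_add]
    push_cast
    rw [Complex.exp_two_pi_mul_I, mul_one]
  · rw [Pi.add_apply, Pi.single_eq_of_ne h, add_zero]

namespace IsTorusCycleFamily

variable {ε r : ℝ} {γ : ℂ → (Fin 3 → ℝ) → (Fin 6 → ℂ)}

/-- The coordinates `x_4, x_5, x_6` along the family, relative to the initial torus. -/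
def ratio (ε : ℝ) (γ : ℂ → (Fin 3 → ℝ) → (Fin 6 → ℂ)) (t : ℂ) (θ : Fin 3 → ℝ) (b : Fin 3) : ℂ :=
  γ t θ (Fin.natAdd 3 b) / (ε * Complex.exp (θ b * Complex.I))

/-- Compactness of the cube makes the closeness to the initial torus uniform in `θ`; periodicity
extends it to all angles. -/
theorem eventually_close (hε : 0 < ε) (hr : 0 < r) (h : IsTorusCycleFamily ε r γ) :
    ∀ᶠ t in 𝓝 (0 : ℂ), ∀ θ, ‖γ t θ 1‖ < 1 ∧ ∀ b, ‖ratio ε γ t θ b - 1‖ < 1 / 2 := by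
  have hε' : (ε : ℂ) ≠ 0 := by exact_mod_cast hε.ne'
  have hcube : ∀ᶠ t in 𝓝 (0 : ℂ), ∀ θ ∈ cube,
      ‖γ t θ 1‖ < 1 ∧ ∀ b, ‖ratio ε γ t θ b - 1‖ < 1 / 2 := by
    refine isCompact_Icc.eventually_forall_of_forall_eventually fun θ _ => ?_
    have hc : ContinuousAt (fun p : ℂ × (Fin 3 → ℝ) => γ p.1 p.2) (0, θ) :=
      h.smooth.continuousOn.continuousAt
        ((isOpen_ball.prod isOpen_univ).mem_nhds ⟨mem_ball_self hr, Set.mem_univ _⟩)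
    have h1 : ContinuousAt (fun p : ℂ × (Fin 3 → ℝ) => ‖γ p.1 p.2 1‖) (0, θ) :=
      (continuousAt_pi.1 hc 1).norm
    have h2 (b) : ContinuousAt (fun p : ℂ × (Fin 3 → ℝ) => ‖ratio ε γ p.1 p.2 b - 1‖) (0, θ) := by
      refine ((ContinuousAt.div (continuousAt_pi.1 hc (Fin.natAdd 3 b)) (by fun_prop) ?_).sub
        continuousAt_const).norm
      exact mul_ne_zero hε' (Complex.exp_ne_zero _)
    have h10 : ‖γ 0 θ 1‖ < 1 := by simp [h.initial]
    have h20 (b) : ‖ratio ε γ 0 θ b - 1‖ < 1 / 2 := by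
      have : γ 0 θ (Fin.natAdd 3 b) = ε * Complex.exp (θ b * Complex.I) := by
        rw [h.initial]
        fin_cases b <;> rfl
      rw [ratio, this, div_self (mul_ne_zero hε' (Complex.exp_ne_zero _))]
      simp
    exact (h1.eventually_lt continuousAt_const h10).and
      (eventually_all.2 fun b => (h2 b).eventually_lt continuousAt_const (h20 b))
  filter_upwards [hcube, ball_mem_nhds _ hr] with t ht htr θ
  -- The exponentials are carried along, since the ratio depends on them as well as on the point of
  -- the cycle.
  obtain ⟨θ', hθ', he⟩ := exists_mem_cube_eq
    (g := fun θ => (γ t θ, fun b => Complex.exp (θ b * Complex.I)))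
    (fun θ k => Prod.ext (h.periodic t htr θ k) (funext fun b => exp_angle_periodic b θ k)) θ
  obtain ⟨e1, e2⟩ := Prod.ext_iff.1 he
  have h1 := ht θ' hθ'
  simp only [ratio] at e1 e2 h1 ⊢
  rw [e1] at h1
  refine ⟨h1.1, fun b => ?_⟩
  rw [← congrFun e2 b]
  exact h1.2 b

/-- The ratio to the initial torus lies within `1/2` of `1`, so its principal logarithm is smooth
and periodic. This gives `u_b = exp(iθ_b + h_b)` with `h_b = log ratio + log ε`, and `ε/2 ≤ |u_b| ≤
2ε` explains the choice of `K`. -/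
theorem period_eq (hε : 0 < ε) (hr : 0 < r) (h : IsTorusCycleFamily ε r γ) :
    ∀ᶠ t in 𝓝 (0 : ℂ), period γ t = fundamentalPeriod (t ^ 9) := by
  have hε' : (ε : ℂ) ≠ 0 := by exact_mod_cast hε.ne'
  obtain ⟨K, hK1, hK2, hK3⟩ : ∃ K : ℝ, 1 ≤ K ∧ 2 * ε ≤ K ∧ 2 / ε ≤ K :=
    ⟨max 1 (max (2 * ε) (2 / ε)), le_max_left _ _, (le_max_left _ _).trans (le_max_right _ _),
      (le_max_right _ _).trans (le_max_right _ _)⟩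
  have hK4 : ∀ᶠ t in 𝓝 (0 : ℂ), 512 * K ^ 4 * ‖t‖ < 1 :=
    ContinuousAt.eventually_lt (by fun_prop) continuousAt_const (by simp)
  have h9 : ∀ᶠ t in 𝓝 (0 : ℂ), ‖t ^ 9‖ < 1 / 8192 :=
    ContinuousAt.eventually_lt (by fun_prop) continuousAt_const (by simp)
  filter_upwards [h.eventually_close hε hr, hK4, h9, ball_mem_nhds _ hr] with t ht htK ht9 htr
  have hsm : ContDiff ℝ ∞ (γ t) := by
    rw [← contDiffOn_univ]
    exact h.smooth.comp (f := fun θ : Fin 3 → ℝ => (t, θ))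
      (contDiff_const.prodMk contDiff_id).contDiffOn fun θ _ => ⟨htr, Set.mem_univ _⟩
  have hene (θ : Fin 3 → ℝ) (b : Fin 3) : (ε : ℂ) * Complex.exp (θ b * Complex.I) ≠ 0 :=
    mul_ne_zero hε' (Complex.exp_ne_zero _)
  have hrs (b) : ContDiff ℝ ∞ fun θ => ratio ε γ t θ b := by
    simp only [ratio, div_eq_mul_inv]
    exact (contDiff_pi.1 hsm (Fin.natAdd 3 b)).mul
      ((contDiff_const.mul (contDiff_angle b).cexp).inv fun θ => hene θ b)
  have hslit (θ b) : ratio ε γ t θ b ∈ Complex.slitPlane := by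
    have h1 := (ht θ).2 b
    have h2 := Complex.abs_re_le_norm (ratio ε γ t θ b - 1)
    rw [Complex.sub_re, Complex.one_re] at h2
    refine Or.inl ?_
    have := (abs_le.1 (h2.trans h1.le)).1
    linarith
  have hrn (θ b) : 1 / 2 ≤ ‖ratio ε γ t θ b‖ ∧ ‖ratio ε γ t θ b‖ ≤ 2 := by
    have h1 := (ht θ).2 b
    have h2 := norm_sub_norm_le (1 : ℂ) (ratio ε γ t θ b)
    have h3 := norm_sub_norm_le (ratio ε γ t θ b) 1
    rw [norm_sub_rev, norm_one] at h2
    rw [norm_one] at h3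
    constructor <;> linarith
  have hu (θ b) : γ t θ (Fin.natAdd 3 b) = ratio ε γ t θ b * (ε * Complex.exp (θ b * Complex.I)) := by
    rw [ratio, div_mul_cancel₀ _ (hene θ b)]
  have hn (θ b) : ‖γ t θ (Fin.natAdd 3 b)‖ = ‖ratio ε γ t θ b‖ * ε := by
    rw [hu, norm_mul, norm_mul, Complex.norm_exp_ofReal_mul_I, mul_one, Complex.norm_real,
      Real.norm_of_nonneg hε.le]
  refine period_eq_of_isSmall ht9
    (h := fun b θ => Complex.log (ratio ε γ t θ b) + Complex.log ε)
    (fun b => ?_) (fun b θ k => ?_) (h.mem t htr) (hsm.differentiable (by simp)) (fun θ b => ?_)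
    (fun θ => (ht θ).1) fun θ => ?_
  · refine ContDiff.add (contDiff_iff_contDiffAt.2 fun θ => ?_) contDiff_const
    exact ((Complex.contDiffAt_log (hslit θ b)).restrict_scalars ℝ).comp θ (hrs b).contDiffAt
  · simp only [ratio, h.periodic t htr θ k, exp_angle_periodic]
  · rw [Complex.exp_add, Complex.exp_add, Complex.exp_log hε',
      Complex.exp_log (Complex.slitPlane_ne_zero (hslit θ b)), hu]
    ring
  · refine isSmall_of_norm_le hK1 (fun b => ?_) (fun b => ?_) (fun b => ?_) htK.le
    · exact norm_ne_zero_iff.1 (by rw [hn]; have := (hrn θ b).1; positivity)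
    · rw [hn]
      have := (hrn θ b).2
      nlinarith
    · rw [hn]
      refine le_trans ?_ hK3
      have := (hrn θ b).1
      rw [inv_le_comm₀ (by positivity) (by positivity), inv_div]
      nlinarith

end IsTorusCycleFamily

end

/-! ### Construction of a family of torus cycles -/

noncomputable section

open Metric

/-- The root near `G / B` of `A x ^ 2 + B x = G`, for small `A G`. -/
def quadRoot (A B G : ℂ) : ℂ :=
  2 * G / (B * (1 + Complex.exp (Complex.log (1 + 4 * A * G / B ^ 2) / 2)))

/-- The rationalized quadratic formula, with the square root written as `exp(log / 2)`. It remains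
valid for `A = 0`; where `A * G = 0` the radicand is `1`, away from the branch cut. -/
theorem quadRoot_spec {A B G : ℂ} (hB : B ≠ 0) (hD : 1 + 4 * A * G / B ^ 2 ≠ 0)
    (hs : 1 + Complex.exp (Complex.log (1 + 4 * A * G / B ^ 2) / 2) ≠ 0) :
    A * quadRoot A B G ^ 2 + B * quadRoot A B G = G := by
  have h2 : Complex.exp (Complex.log (1 + 4 * A * G / B ^ 2) / 2) ^ 2 = 1 + 4 * A * G / B ^ 2 := by
    rw [← Complex.exp_nat_mul, Nat.cast_ofNat, mul_div_cancel₀ _ two_ne_zero, Complex.exp_log hD]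
  rw [quadRoot]
  set s := Complex.exp (Complex.log (1 + 4 * A * G / B ^ 2) / 2)
  field_simp at h2 ⊢
  linear_combination (-G) * h2

theorem quadRoot_of_mul_eq_zero {A B G : ℂ} (h : A * G = 0) : quadRoot A B G = G / B := by
  rw [quadRoot, mul_assoc, h]
  simp only [mul_zero, zero_div, add_zero, Complex.log_one, Complex.exp_zero]
  rw [one_add_one_eq_two, mul_comm B, mul_div_mul_left _ _ two_ne_zero]

section quadRoot

variable {E : Type*} [NormedAddCommGroup E] [NormedSpace ℂ E] {f g h : E → ℂ} {x : E}

theorem analyticAt_quadRoot (hf : AnalyticAt ℂ f x) (hg : AnalyticAt ℂ g x)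
    (hh : AnalyticAt ℂ h x) (h0 : f x * h x = 0) (hg0 : g x ≠ 0) :
    AnalyticAt ℂ (fun y => quadRoot (f y) (g y) (h y)) x := by
  have h1 : 1 + 4 * f x * h x / g x ^ 2 = 1 := by rw [mul_assoc, h0]; simp
  have hD : AnalyticAt ℂ (fun y => 1 + 4 * f y * h y / g y ^ 2) x :=
    analyticAt_const.add (((analyticAt_const.mul hf).mul hh).div (hg.pow 2) (pow_ne_zero 2 hg0))
  have hs : AnalyticAt ℂ
      (fun y => 1 + Complex.exp (Complex.log (1 + 4 * f y * h y / g y ^ 2) / 2)) x :=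
    analyticAt_const.add ((hD.clog (by rw [h1]; exact Complex.one_mem_slitPlane)).div
      analyticAt_const two_ne_zero).cexp
  refine (analyticAt_const.mul hh).div (hg.mul hs) (mul_ne_zero hg0 ?_)
  rw [h1]
  norm_num

theorem eventually_quadRoot_spec (hf : AnalyticAt ℂ f x) (hg : AnalyticAt ℂ g x)
    (hh : AnalyticAt ℂ h x) (h0 : f x * h x = 0) (hg0 : g x ≠ 0) :
    ∀ᶠ y in 𝓝 x, f y * quadRoot (f y) (g y) (h y) ^ 2 + g y * quadRoot (f y) (g y) (h y) = h y := by
  have h1 : 1 + 4 * f x * h x / g x ^ 2 = 1 := by rw [mul_assoc, h0]; simp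
  have hD : AnalyticAt ℂ (fun y => 1 + 4 * f y * h y / g y ^ 2) x :=
    analyticAt_const.add (((analyticAt_const.mul hf).mul hh).div (hg.pow 2) (pow_ne_zero 2 hg0))
  have hs : AnalyticAt ℂ
      (fun y => 1 + Complex.exp (Complex.log (1 + 4 * f y * h y / g y ^ 2) / 2)) x :=
    analyticAt_const.add ((hD.clog (by rw [h1]; exact Complex.one_mem_slitPlane)).div
      analyticAt_const two_ne_zero).cexp
  filter_upwards [hg.continuousAt.eventually_ne hg0,
    hD.continuousAt.eventually_ne (y := 0) (by rw [h1]; exact one_ne_zero),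
    hs.continuousAt.eventually_ne (y := 0) (by rw [h1]; norm_num)] with y y1 y2 y3
  exact quadRoot_spec y1 y2 y3

end quadRoot

/-- The value of `x_2 / t ^ 2` that is prescribed on the torus with parameter `u`. -/
def cycleY (u : Fin 3 → ℂ) : ℂ := (u 1 ^ 2 + u 2 ^ 2 * u 0) / (u 1 * u 2)

/-- On the cycle, `1 + x_1 = cycleP + cycleP' * (x_3 + x_4)`. -/
def cycleP (p : ℂ × (Fin 3 → ℂ)) : ℂ := 1 + p.1 * p.2 1 ^ 2 / p.2 2

/-- On the cycle, `1 + x_1 = cycleP + cycleP' * (x_3 + x_4)`. -/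
def cycleP' (p : ℂ × (Fin 3 → ℂ)) : ℂ := p.1 ^ 8 * cycleY p.2 ^ 3 / p.2 2

/-- On the cycle, `x_3 x_4 = t * (cycleQ + cycleQ' * (x_3 + x_4))`. -/
def cycleQ (p : ℂ × (Fin 3 → ℂ)) : ℂ :=
  (p.1 ^ 7 * cycleY p.2 ^ 3 * cycleP p + p.2 2 ^ 2) / p.2 1

/-- On the cycle, `x_3 x_4 = t * (cycleQ + cycleQ' * (x_3 + x_4))`. -/
def cycleQ' (p : ℂ × (Fin 3 → ℂ)) : ℂ := p.1 ^ 7 * cycleY p.2 ^ 3 * cycleP' p / p.2 1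

/-- The sum `x_3 + x_4` on the cycle. -/
def cycleS (p : ℂ × (Fin 3 → ℂ)) : ℂ :=
  quadRoot (cycleQ' p) (cycleQ p + p.2 1 * cycleP' p) (cycleY p.2 * p.2 2 - p.2 1 * cycleP p)

/-- The coordinate `x_3` on the cycle. -/
def cycleW (p : ℂ × (Fin 3 → ℂ)) : ℂ :=
  quadRoot (-1) (cycleS p) (p.1 * (cycleQ p + cycleQ' p * cycleS p))

/-- The point of the cycle in `X̌_{7,t}` with parameter `u`, where `p = (t, u)`. -/
def cyclePoint (p : ℂ × (Fin 3 → ℂ)) : Fin 6 → ℂ :=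
  ![cycleP p + cycleP' p * cycleS p - 1, p.1 ^ 2 * cycleY p.2, cycleW p, cycleS p - cycleW p,
    p.2 1, p.2 2]

section cyclePoint

variable {u : Fin 3 → ℂ}

theorem analyticAt_cycle_coord (p : ℂ × (Fin 3 → ℂ)) (i : Fin 3) :
    AnalyticAt ℂ (fun p : ℂ × (Fin 3 → ℂ) => p.2 i) p :=
  ((ContinuousLinearMap.proj (R := ℂ) (φ := fun _ : Fin 3 => ℂ) i).comp
    (ContinuousLinearMap.snd ℂ ℂ (Fin 3 → ℂ))).analyticAt p

theorem analyticAt_cyclePQ (hu : ∀ i, u i ≠ 0) :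
    AnalyticAt ℂ (fun p => cycleY p.2) ((0 : ℂ), u) ∧ AnalyticAt ℂ cycleP (0, u) ∧
      AnalyticAt ℂ cycleP' (0, u) ∧ AnalyticAt ℂ cycleQ (0, u) ∧ AnalyticAt ℂ cycleQ' (0, u) := by
  have ht : AnalyticAt ℂ (fun p : ℂ × (Fin 3 → ℂ) => p.1) (0, u) := analyticAt_fst
  have h0 := analyticAt_cycle_coord (0, u) 0
  have h1 := analyticAt_cycle_coord (0, u) 1
  have h2 := analyticAt_cycle_coord (0, u) 2
  have hY : AnalyticAt ℂ (fun p => cycleY p.2) ((0 : ℂ), u) :=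
    ((h1.pow 2).add ((h2.pow 2).mul h0)).div (h1.mul h2) (mul_ne_zero (hu 1) (hu 2))
  have hP : AnalyticAt ℂ cycleP (0, u) :=
    analyticAt_const.add ((ht.mul (h1.pow 2)).div h2 (hu 2))
  have hP' : AnalyticAt ℂ cycleP' (0, u) := ((ht.pow 8).mul (hY.pow 3)).div h2 (hu 2)
  exact ⟨hY, hP, hP', ((((ht.pow 7).mul (hY.pow 3)).mul hP).add (h2.pow 2)).div h1 (hu 1),
    (((ht.pow 7).mul (hY.pow 3)).mul hP').div h1 (hu 1)⟩

theorem cycle_initial : cycleP (0, u) = 1 ∧ cycleP' (0, u) = 0 ∧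
    cycleQ (0, u) = u 2 ^ 2 / u 1 ∧ cycleQ' (0, u) = 0 := by
  simp [cycleP, cycleP', cycleQ, cycleQ']

theorem cycleS_initial (hu : ∀ i, u i ≠ 0) : cycleS (0, u) = u 0 := by
  obtain ⟨e1, e2, e3, e4⟩ := cycle_initial (u := u)
  have h1 := hu 1
  have h2 := hu 2
  rw [cycleS, e1, e2, e3, e4, quadRoot_of_mul_eq_zero (zero_mul _), cycleY]
  field_simp
  ring

theorem cycleW_initial : cycleW (0, u) = 0 := by
  rw [cycleW, quadRoot_of_mul_eq_zero] <;> simp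

theorem cyclePoint_initial (hu : ∀ i, u i ≠ 0) :
    cyclePoint (0, u) = ![0, 0, 0, u 0, u 1, u 2] := by
  obtain ⟨e1, e2, -⟩ := cycle_initial (u := u)
  simp [cyclePoint, e1, e2, cycleS_initial hu, cycleW_initial]

/-- Here `x_2 = t² Y`, `x_5`, `x_6` are prescribed and `S = x_3 + x_4` is unknown. `P_5 = 0` makes
`x_1` affine in `S`, `P_3 = 0` makes `x_3 x_4` affine in `S`, and `P_1 = 0`, divided by `t²`,
becomes a quadratic equation for `S`. Then `x_3` is the small root of the quadratic with sum `S` and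
product `x_3 x_4`. The value of `Y` is the one for which `S = u 0` at `t = 0`. -/
theorem cyclePoint_mem {p : ℂ × (Fin 3 → ℂ)} (h1 : p.2 1 ≠ 0) (h2 : p.2 2 ≠ 0)
    (hS : cycleQ' p * cycleS p ^ 2 + (cycleQ p + p.2 1 * cycleP' p) * cycleS p =
      cycleY p.2 * p.2 2 - p.2 1 * cycleP p)
    (hW : -1 * cycleW p ^ 2 + cycleS p * cycleW p =
      p.1 * (cycleQ p + cycleQ' p * cycleS p)) : cyclePoint p ∈ X7 p.1 := by
  have hQ : p.2 1 * (cycleQ p + cycleQ' p * cycleS p) =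
      p.1 ^ 7 * cycleY p.2 ^ 3 * (cycleP p + cycleP' p * cycleS p) + p.2 2 ^ 2 := by
    rw [cycleQ, cycleQ']
    field_simp
    ring
  have hP : p.2 2 * (cycleP p + cycleP' p * cycleS p - 1) =
      p.1 * p.2 1 ^ 2 + p.1 ^ 8 * cycleY p.2 ^ 3 * cycleS p := by
    rw [cycleP, cycleP']
    field_simp
    ring
  refine mem_X7_of_ne_zero h2 ?_ ?_ ?_
  · rw [P7_zero]
    simp only [cyclePoint, Matrix.cons_val]
    linear_combination (-p.1 ^ 2) * hS - p.1 * cycleS p * hW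
  · rw [P7_two]
    simp only [cyclePoint, Matrix.cons_val]
    linear_combination p.1 * hQ + p.2 1 * hW
  · rw [P7_four]
    simp only [cyclePoint, Matrix.cons_val]
    linear_combination hP

theorem eventually_cyclePoint (hu : ∀ i, u i ≠ 0) :
    ∀ᶠ p in 𝓝 ((0 : ℂ), u), AnalyticAt ℂ cyclePoint p ∧ cyclePoint p ∈ X7 p.1 := by
  obtain ⟨hY, hP, hP', hQ, hQ'⟩ := analyticAt_cyclePQ hu
  obtain ⟨e1, e2, e3, e4⟩ := cycle_initial (u := u)
  have ht : AnalyticAt ℂ (fun p : ℂ × (Fin 3 → ℂ) => p.1) (0, u) := analyticAt_fst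
  have h1 := analyticAt_cycle_coord (0, u) 1
  have h2 := analyticAt_cycle_coord (0, u) 2
  have hB := hQ.add (h1.mul hP')
  have hG := (hY.mul h2).sub (h1.mul hP)
  have hQ0 : cycleQ' (0, u) * (cycleY u * u 2 - u 1 * cycleP (0, u)) = 0 := by rw [e4, zero_mul]
  have hB0 : cycleQ (0, u) + u 1 * cycleP' (0, u) ≠ 0 := by
    rw [e2, e3, mul_zero, add_zero]
    exact div_ne_zero (pow_ne_zero 2 (hu 2)) (hu 1)
  have hS : AnalyticAt ℂ cycleS (0, u) := analyticAt_quadRoot hQ' hB hG hQ0 hB0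
  have hS0 : cycleS (0, u) ≠ 0 := by
    rw [cycleS_initial hu]
    exact hu 0
  have hR := ht.mul (hQ.add (hQ'.mul hS))
  have hR0 : (-1 : ℂ) * (0 * (cycleQ (0, u) + cycleQ' (0, u) * cycleS (0, u))) = 0 := by ring
  have hW : AnalyticAt ℂ cycleW (0, u) := analyticAt_quadRoot analyticAt_const hS hR hR0 hS0
  have hF : AnalyticAt ℂ cyclePoint (0, u) := by
    refine AnalyticAt.pi fun i => ?_
    fin_cases i
    exacts [(hP.add (hP'.mul hS)).sub analyticAt_const, (ht.pow 2).mul hY, hW, hS.sub hW, h1, h2]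
  filter_upwards [hF.eventually_analyticAt, eventually_quadRoot_spec hQ' hB hG hQ0 hB0,
    eventually_quadRoot_spec analyticAt_const hS hR hR0 hS0,
    h1.continuousAt.eventually_ne (hu 1), h2.continuousAt.eventually_ne (hu 2)] with p p1 p2 p3 p4 p5
  exact ⟨p1, cyclePoint_mem p4 p5 p2 p3⟩

end cyclePoint

/-- The initial torus extends to a smooth family of torus cycles. -/
theorem exists_isTorusCycleFamily {ε : ℝ} (hε : 0 < ε) :
    ∃ r : ℝ, 0 < r ∧ ∃ γ : ℂ → (Fin 3 → ℝ) → (Fin 6 → ℂ), IsTorusCycleFamily ε r γ := by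
  set U : (Fin 3 → ℝ) → Fin 3 → ℂ := fun θ b => ε * Complex.exp (θ b * Complex.I) with hU
  have hUs : ContDiff ℝ ∞ U := contDiff_pi.2 fun b => contDiff_const.mul (contDiff_angle b).cexp
  have hU0 (θ b) : U θ b ≠ 0 :=
    mul_ne_zero (by exact_mod_cast hε.ne') (Complex.exp_ne_zero _)
  have hUp (θ k) : U (θ + Pi.single k (2 * Real.pi)) = U θ :=
    funext fun b => congrArg (fun z => (ε : ℂ) * z) (exp_angle_periodic b θ k)
  -- Analyticity and membership hold near each point of the initial torus; compactness gives a
  -- common radius in `t`.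
  have hev : ∀ᶠ t in 𝓝 (0 : ℂ), ∀ θ ∈ cube,
      AnalyticAt ℂ cyclePoint (t, U θ) ∧ cyclePoint (t, U θ) ∈ X7 t := by
    refine isCompact_Icc.eventually_forall_of_forall_eventually fun θ _ => ?_
    have hc : ContinuousAt (fun z : ℂ × (Fin 3 → ℝ) => (z.1, U z.2)) (0, θ) :=
      (continuous_fst.prodMk (hUs.continuous.comp continuous_snd)).continuousAt
    exact hc.eventually (eventually_cyclePoint (hU0 θ))
  obtain ⟨r, hr, hball⟩ := Metric.eventually_nhds_iff_ball.1 hev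
  have hall (t : ℂ) (ht : t ∈ ball (0 : ℂ) r) (θ : Fin 3 → ℝ) :
      AnalyticAt ℂ cyclePoint (t, U θ) ∧ cyclePoint (t, U θ) ∈ X7 t := by
    obtain ⟨θ', hθ', he⟩ := exists_mem_cube_eq hUp θ
    rw [← he]
    exact hball t ht θ' hθ'
  refine ⟨r, hr, fun t θ => cyclePoint (t, U θ), ?_, fun t _ θ k => ?_,
    fun t ht θ => (hall t ht θ).2, fun θ => ?_⟩
  · rintro ⟨t, θ⟩ ⟨ht, -⟩
    refine ContDiffAt.contDiffWithinAt ?_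
    have h1 : ContDiffAt ℝ ∞ cyclePoint (t, U θ) :=
      ((hall t ht θ).1.contDiffAt (n := ∞)).restrict_scalars ℝ
    exact h1.comp (t, θ) (contDiff_fst.prodMk (hUs.comp contDiff_snd)).contDiffAt
  · simp only [hUp]
  · rw [cyclePoint_initial (hU0 θ)]

end

end PfaffianMirror

/-! ### The main theorem -/

theorem mainTheorem4 :
    ∃ Φ : ℂ → ℂ, AnalyticAt ℂ Φ 0 ∧
      (∀ ε : ℝ, 0 < ε →
        (∃ r : ℝ, 0 < r ∧ ∃ γ : ℂ → (Fin 3 → ℝ) → (Fin 6 → ℂ),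
          PfaffianMirror.IsTorusCycleFamily ε r γ) ∧
        ∀ r : ℝ, 0 < r → ∀ γ : ℂ → (Fin 3 → ℝ) → (Fin 6 → ℂ),
          PfaffianMirror.IsTorusCycleFamily ε r γ →
            ∀ᶠ t in 𝓝 (0 : ℂ), PfaffianMirror.period γ t = Φ (t ^ 9)) ∧
      (∀ᶠ φ in 𝓝 (0 : ℂ), HasSum
        (fun n : ℕ => (((2 * n).choose n ^ 2 * ∑ k ∈ Finset.range (2 * n + 1),
          (n + k).choose k * (2 * n).choose k ^ 2 : ℕ) : ℂ) * φ ^ n) (Φ φ)) ∧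
      PfaffianMirror.IsPicardFuchsOperator PfaffianMirror.D7 Φ := by
  refine ⟨PfaffianMirror.fundamentalPeriod, PfaffianMirror.analyticAt_fundamentalPeriod,
    fun ε hε => ⟨PfaffianMirror.exists_isTorusCycleFamily hε,
      fun r hr γ hγ => hγ.period_eq hε hr⟩, ?_, PfaffianMirror.isPicardFuchsOperator_D7⟩
  have : Metric.ball (0 : ℂ) (1 / 8192) ∈ 𝓝 (0 : ℂ) := Metric.ball_mem_nhds _ (by norm_num)
  filter_upwards [this] with φ hφ
  simp only [← PfaffianMirror.periodCoeff_eq]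
  exact PfaffianMirror.hasSum_fundamentalPeriod (mem_ball_zero_iff.1 hφ)
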